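/- Let $\mathcal L_A=\{0,\mathsf s,+,\cdot,\leqslant\}$ and let $\mathcal L_A^{\rm Sk}$ be its closure under Skolem function symbols: for every $\mathcal L_A^{\rm Sk}$-formula $\exists x\psi$ with exactly $m$ free variables it contains an $m$-ary function symbol $\mathfrak f_{\exists x\psi}$. Let $\mathcal M$ be a model of $\mathrm{I}\Delta_0$ (Robinson's arithmetic with induction, with parameters, for bounded formulas). Terms, formulas and finite sets of terms are coded in $\mathcal M$ by an efficient coding, as follows. Terms and formulas are words in Polish notation over a finite alphabet of symbols of fixed binary length, coded by the number with the concatenated binary expansion. A finite set of positive elements $a_1<\dots<a_n$ has the code $\langle X,Y\rangle=(X+Y)^2+X$, where $X$ is the concatenation of the binary expansions of the $a_i$ (with $a_1$ at the low end) and the binary digits $1$ of $Y$ mark the boundaries of these blocks. The recursive notions below (term, formula, $\exp$, and so on) are read inside $\mathcal M$: an object has such a property if this is witnessed by a derivation coded in $\mathcal M$. For a set $\Lambda$ of closed $\mathcal L_A^{\rm Sk}$-terms coded in $\mathcal M$ put $\Lambda^{\langle 0\rangle}=\Lambda$ and $$\Lambda^{\langle k+1\rangle}=\Lambda^{\langle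 k\rangle}\cup\{f(t_1,\dots,t_m)\mid f\in\mathcal L_A,\ t_i\in\Lambda^{\langle k\rangle}\}\cup\{\mathfrak f_{\exists x\psi}(t_1,\dots,t_m)\mid \ulcorner\psi\urcorner\leqslant k,\ \ulcorner x\urcorner\leqslant k,\ t_i\in\Lambda^{\langle k\rangle}\}$$ (the condition $\ulcorner x\urcorner\leqslant k$ follows from $\ulcorner\psi\urcorner\leqslant k$ when $x$ occurs in $\psi$). Further let $\exp(x)=2^x$, $\log x=\min\{y\mid x\leqslant\exp(y)\}$, $\omega_0(x)=x^2$ and $\omega_{n+1}(x)=\exp(\omega_n(\log x))$; these may be partial in $\mathcal M$. **Theorem.** If $\Lambda$ is a set of closed $\mathcal L_A^{\rm Sk}$-terms whose code $\ulcorner\Lambda\urcorner\in\mathcal M$ is non-standard, and the value $\omega_2(\ulcorner\Lambda\urcorner)$ exists in $\mathcal M$, then there is a non-standard $j\in\mathcal M$ such that the code $\ulcorner\Lambda^{\langle j\rangle}\urcorner$ exists in $\mathcal M$. -/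

import Mathlib

open FirstOrder

namespace BA

/-! ## The language of arithmetic, bounded formulas, and models of bounded arithmetic -/

/-- Function symbols of the language of arithmetic with `0`, successor, `+`, `·`, `≤`. -/
inductive ArithFunc : ℕ → Type
  | zero : ArithFunc 0
  | succ : ArithFunc 1
  | add : ArithFunc 2
  | mul : ArithFunc 2

/-- Relation symbols of the language of arithmetic (equality is logical). -/
inductive ArithRel : ℕ → Type
  | le : ArithRel 2

/-- The language of arithmetic. -/
def LA : Language := ⟨ArithFunc, ArithRel⟩

/-- The relation symbol `≤`. -/
def leSymb : LA.Relations 2 := ArithRel.le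

/-- Bounded formulas: every quantifier has the form `∀ x ≤ t` or `∃ x ≤ t`, where the term `t`
does not contain `x`. Negation is `φ → ⊥`, and the other connectives are defined from `→`, `⊥`. -/
inductive IsBounded {α : Type} : {n : ℕ} → LA.BoundedFormula α n → Prop
  | falsum {n : ℕ} : IsBounded (⊥ : LA.BoundedFormula α n)
  | equal {n : ℕ} (t u : LA.Term (α ⊕ Fin n)) : IsBounded (t.bdEqual u)
  | le {n : ℕ} (t u : LA.Term (α ⊕ Fin n)) : IsBounded (leSymb.boundedFormula₂ t u)
  | imp {n : ℕ} {φ ψ : LA.BoundedFormula α n} :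
      IsBounded φ → IsBounded ψ → IsBounded (φ.imp ψ)
  | all {n : ℕ} (t : LA.Term (α ⊕ Fin n)) {φ : LA.BoundedFormula α (n + 1)} :
      IsBounded φ →
      IsBounded (((leSymb.boundedFormula₂ (Language.Term.var (Sum.inr (Fin.last n)))
        (t.relabel (Sum.map id Fin.castSucc))).imp φ).all)
  | ex {n : ℕ} (t : LA.Term (α ⊕ Fin n)) {φ : LA.BoundedFormula α (n + 1)} :
      IsBounded φ →
      IsBounded ((leSymb.boundedFormula₂ (Language.Term.var (Sum.inr (Fin.last n)))
        (t.relabel (Sum.map id Fin.castSucc))) ⊓ φ).ex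

/-- A structure for the language of arithmetic. No laws are assumed. -/
class ArithStructure (M : Type*) extends Zero M, Add M, Mul M, LE M where
  succ : M → M

/-- An arithmetical structure as a first-order structure. -/
instance instLAStructure (M : Type*) [ArithStructure M] : LA.Structure M where
  funMap := fun {_} f v => match f, v with
    | ArithFunc.zero, _ => (0 : M)
    | ArithFunc.succ, v => ArithStructure.succ (v 0)
    | ArithFunc.add, v => v 0 + v 1
    | ArithFunc.mul, v => v 0 * v 1
  RelMap := fun {_} r v => match r, v with
    | ArithRel.le, v => v 0 ≤ v 1

/-- `M` is a model of bounded arithmetic `IΔ₀`: Robinson's arithmetic `Q` together with induction,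
with parameters, for bounded formulas. The induction variable is variable number `0`, and the
valuation `e` provides the parameters. -/
structure IsModelIDelta0 (M : Type*) [ArithStructure M] : Prop where
  succ_ne_zero : ∀ x : M, ArithStructure.succ x ≠ 0
  succ_inj : ∀ x y : M, ArithStructure.succ x = ArithStructure.succ y → x = y
  exists_pred : ∀ x : M, x ≠ 0 → ∃ y, x = ArithStructure.succ y
  le_iff : ∀ x y : M, x ≤ y ↔ ∃ z, x + z = y
  add_zero : ∀ x : M, x + 0 = x
  add_succ : ∀ x y : M, x + ArithStructure.succ y = ArithStructure.succ (x + y)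
  mul_zero : ∀ x : M, x * 0 = 0
  mul_succ : ∀ x y : M, x * ArithStructure.succ y = x * y + x
  induction : ∀ φ : LA.Formula ℕ, IsBounded φ → ∀ e : ℕ → M,
    φ.Realize (Function.update e 0 0) →
    (∀ x, φ.Realize (Function.update e 0 x) →
      φ.Realize (Function.update e 0 (ArithStructure.succ x))) →
    ∀ x, φ.Realize (Function.update e 0 x)

section Internal

variable {M : Type*} [ArithStructure M]

/-- The value in `M` of the standard numeral `n`. -/
def num : ℕ → M
  | 0 => 0
  | n + 1 => ArithStructure.succ (num n)

/-- An element of `M` is non-standard if it is the value of no numeral. -/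
def NonStandard (x : M) : Prop := ∀ n : ℕ, x ≠ num n

/-- The strict order of `M`. -/
def Less (x y : M) : Prop := x ≤ y ∧ x ≠ y

/-! ## Coding of pairs and finite sets inside `M`

A finite set `{a₁ < ⋯ < aₙ}` of positive elements of `M` is coded by `pair X Y`. The number `X` is
the binary word `aₙ ⋯ a₁` (each `aᵢ` written in binary, without leading zeros, `a₁` at the low end),
and the binary digits `1` of `Y` mark the ends of these blocks. Positions in a binary word are given
by powers of two. The code of `{a}` is at most `9(a+1)²`, the code of `A ∪ B` is at most
`64` times the product of the codes of `A` and `B`, and a set has at most as many elements as the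
logarithm of its code. -/

/-- The pairing function. -/
def pair (x y : M) : M := (x + y) * (x + y) + x

/-- `u` is a power of two: every divisor of `u` other than `1` is even. -/
def Pow2 (u : M) : Prop := ∀ d e : M, u = d * e → d = num 1 ∨ ∃ f, d = num 2 * f

/-- `u` is a power of two, and the binary digit of `y` at position `u` is `1`. -/
def Bit (u y : M) : Prop :=
  Pow2 u ∧ ∃ q r : M, Less r u ∧ y = (num 2 * q + num 1) * u + r

/-- `a` is the number written in the digits of `X` from position `u` up to, and excluding,
position `v`, i.e. `a = ⌊(X mod v) / u⌋`. -/
def Block (X u v a : M) : Prop :=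
  ∃ h r : M, Less r u ∧ Less (a * u + r) v ∧ X = h * v + (a * u + r)

/-- `u < v` are consecutive marks of `Y`, and `a` is the block of `X` between them. -/
def Entry (X Y u v a : M) : Prop :=
  Bit u Y ∧ Bit v Y ∧ Less u v ∧ (∀ w, Bit w Y → ¬ (Less u w ∧ Less w v)) ∧ Block X u v a

/-- `a` belongs to the finite set coded by `c`. -/
def Mem (a c : M) : Prop := ∃ X Y u v : M, c = pair X Y ∧ Entry X Y u v a

/-- `c` is the code of a finite set: the lowest mark is at position `1`, there are no digits of `X`
at or above the highest mark `t`, each block begins with the digit `1`, and the blocks increase. -/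
def IsSetCode (c : M) : Prop :=
  ∃ X Y : M, c = pair X Y ∧ Bit (num 1) Y ∧
    (∃ t, Bit t Y ∧ Less X t ∧ Less Y (num 2 * t)) ∧
    (∀ u v a, Entry X Y u v a → v ≤ num 2 * (a * u)) ∧
    (∀ u v w a b, Entry X Y u v a → Entry X Y v w b → Less a b)

/-- `c` codes the empty set. -/
def IsEmptyCode (c : M) : Prop := IsSetCode c ∧ ∀ z, ¬ Mem z c

/-- `c` codes `{x}`. -/
def IsSingletonCode (c x : M) : Prop := IsSetCode c ∧ ∀ z, Mem z c ↔ z = x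

/-- `c` codes the union of the sets coded by `a` and `b`. -/
def IsUnionCode (c a b : M) : Prop := IsSetCode c ∧ ∀ z, Mem z c ↔ Mem z a ∨ Mem z b

/-- `c` codes the set coded by `a` with `x` adjoined. -/
def IsInsertCode (c a x : M) : Prop := IsSetCode c ∧ ∀ z, Mem z c ↔ Mem z a ∨ z = x

/-- `c` codes the set coded by `a` with `x` removed. -/
def IsEraseCode (c a x : M) : Prop := IsSetCode c ∧ ∀ z, Mem z c ↔ Mem z a ∧ z ≠ x

/-- Recursive definitions inside `M`: `x` has a derivation coded in `M`, that is, a coded finite set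
which contains `x` and each member of which follows by a rule from members of that set.
In all rules below the premises are simpler than the conclusion, so derivations are not circular. -/
def Derivable (rule : (M → Prop) → M → Prop) (x : M) : Prop :=
  ∃ d, IsSetCode d ∧ Mem x d ∧ ∀ y, Mem y d → rule (fun z => Mem z d) y

/-! ## Exponentiation, logarithm and the functions `ω_n` inside `M` -/

/-- The rules `2^0 = 1`, `2^(2a) = (2^a)²` for `a ≠ 0`, and `2^(2a+1) = 2(2^a)²`. -/
inductive ExpRule (D : M → Prop) : M → Prop
  | zero : ExpRule D (pair 0 (num 1))
  | even {a b : M} : D (pair a b) → a ≠ 0 → ExpRule D (pair (num 2 * a) (b * b))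
  | odd {a b : M} : D (pair a b) →
      ExpRule D (pair (num 2 * a + num 1) (num 2 * (b * b)))

/-- The graph of exponentiation in `M`: `exp x` exists and `y = exp x = 2^x`. -/
def Exp (x y : M) : Prop := Derivable ExpRule (pair x y)

/-- `l = log x`, the least `l` with `x ≤ exp l`. -/
def Log (x l : M) : Prop :=
  (∃ y, Exp l y ∧ x ≤ y) ∧ ∀ l' y, Exp l' y → x ≤ y → l ≤ l'

/-- `Omega n x y`: the value `ω_n x` exists in `M` and equals `y`, where `ω_0 x = x²` and
`ω_{n+1} x = exp (ω_n (log x))`. -/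
def Omega : ℕ → M → M → Prop
  | 0, x, y => y = x * x
  | n + 1, x, y => ∃ l z, Log x l ∧ Omega n l z ∧ Exp z y

/-! ## Words, terms and formulas inside `M`

Terms and formulas of the Skolem closure of the language of arithmetic are words, in Polish
notation, over an alphabet of sixteen symbols. The symbols are the binary words of length five that
begin with `1`, and a word is the number with the concatenated binary expansion, so that the code of
a concatenation is at most three times the product of the codes. The empty word is `0`. -/

/-- The alphabet. A variable is a word in the letters `a`, `b` followed by `v`. The Skolem function
symbol of the formula `∃xψ` is the word `sk ∃xψ`. -/
inductive Symb
  | zero | succ | add | mul | v | a | b | eq | le | not | and | or | imp | all | ex | sk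

/-- The number coding a symbol. -/
def Symb.code : Symb → ℕ
  | .zero => 16
  | .succ => 17
  | .add => 18
  | .mul => 19
  | .v => 20
  | .a => 21
  | .b => 22
  | .eq => 23
  | .le => 24
  | .not => 25
  | .and => 26
  | .or => 27
  | .imp => 28
  | .all => 29
  | .ex => 30
  | .sk => 31

/-- A symbol as an element of `M`. -/
def sym (s : Symb) : M := num s.code

/-- `z` is the concatenation of the words `x` and `y`: `z = x·p + y` for the least power of two `p`
greater than `y`. -/
def Cat (x y z : M) : Prop :=
  ∃ p, Pow2 p ∧ Less y p ∧ (∀ q, Pow2 q → Less y q → p ≤ q) ∧ z = x * p + y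

/-- `z` is the concatenation of a (standard) list of words. -/
def Word : List M → M → Prop
  | [], z => z = 0
  | x :: l, z => ∃ w, Word l w ∧ Cat x w z

/-- The judgement "`x` is a variable". -/
def varJ (x : M) : M := pair (num 1) x

/-- The judgement "`t` is a term, and `V` is the set of its variables". -/
def termJ (t V : M) : M := pair (num 2) (pair t V)

/-- The judgement "`φ` is a formula, and `V` is the set of its free variables". -/
def formJ (φ V : M) : M := pair (num 3) (pair φ V)

/-- The judgement "`w` is a concatenation of `m` terms, where `m` is the cardinality of the finite
set `U`, and `V` is the set of the variables of these terms". -/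
def argsJ (U w V : M) : M := pair (num 4) (pair U (pair w V))

/-- The formation rules for variables, terms and formulas of the Skolem closure of the language of
arithmetic. The arity of the Skolem function symbol of `∃xψ` is the number of free variables
of `∃xψ`. -/
inductive FormationRule (D : M → Prop) : M → Prop
  | var {x : M} : Word [sym .v] x → FormationRule D (varJ x)
  | varA {x y : M} : D (varJ x) → Word [sym .a, x] y → FormationRule D (varJ y)
  | varB {x y : M} : D (varJ x) → Word [sym .b, x] y → FormationRule D (varJ y)
  | termVar {x V : M} : D (varJ x) → IsSingletonCode V x → FormationRule D (termJ x V)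
  | termZero {y V : M} : Word [sym .zero] y → IsEmptyCode V → FormationRule D (termJ y V)
  | termSucc {t y V : M} : D (termJ t V) → Word [sym .succ, t] y → FormationRule D (termJ y V)
  | termAdd {t u y V W Z : M} : D (termJ t V) → D (termJ u W) → IsUnionCode Z V W →
      Word [sym .add, t, u] y → FormationRule D (termJ y Z)
  | termMul {t u y V W Z : M} : D (termJ t V) → D (termJ u W) → IsUnionCode Z V W →
      Word [sym .mul, t, u] y → FormationRule D (termJ y Z)
  | termSkolem {x ψ V U w W y : M} : D (varJ x) → D (formJ ψ V) → IsEraseCode U V x →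
      D (argsJ U w W) → Word [sym .sk, sym .ex, x, ψ, w] y → FormationRule D (termJ y W)
  | argsNil {U V : M} : IsEmptyCode U → IsEmptyCode V → FormationRule D (argsJ U 0 V)
  | argsCons {U U' v w w' t V W Z : M} : D (argsJ U w V) → ¬ Mem v U → IsInsertCode U' U v →
      D (termJ t W) → IsUnionCode Z V W → Word [w, t] w' → FormationRule D (argsJ U' w' Z)
  | formEq {t u y V W Z : M} : D (termJ t V) → D (termJ u W) → IsUnionCode Z V W →
      Word [sym .eq, t, u] y → FormationRule D (formJ y Z)
  | formLe {t u y V W Z : M} : D (termJ t V) → D (termJ u W) → IsUnionCode Z V W →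
      Word [sym .le, t, u] y → FormationRule D (formJ y Z)
  | formNot {φ y V : M} : D (formJ φ V) → Word [sym .not, φ] y → FormationRule D (formJ y V)
  | formAnd {φ ψ y V W Z : M} : D (formJ φ V) → D (formJ ψ W) → IsUnionCode Z V W →
      Word [sym .and, φ, ψ] y → FormationRule D (formJ y Z)
  | formOr {φ ψ y V W Z : M} : D (formJ φ V) → D (formJ ψ W) → IsUnionCode Z V W →
      Word [sym .or, φ, ψ] y → FormationRule D (formJ y Z)
  | formImp {φ ψ y V W Z : M} : D (formJ φ V) → D (formJ ψ W) → IsUnionCode Z V W →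
      Word [sym .imp, φ, ψ] y → FormationRule D (formJ y Z)
  | formAll {x φ y V U : M} : D (varJ x) → D (formJ φ V) → IsEraseCode U V x →
      Word [sym .all, x, φ] y → FormationRule D (formJ y U)
  | formEx {x φ y V U : M} : D (varJ x) → D (formJ φ V) → IsEraseCode U V x →
      Word [sym .ex, x, φ] y → FormationRule D (formJ y U)

/-- `x` is a variable in the sense of `M`. -/
def IsVar (x : M) : Prop := Derivable FormationRule (varJ x)

/-- `φ` is a formula in the sense of `M`, with set of free variables (coded by) `V`. -/
def IsForm (φ V : M) : Prop := Derivable FormationRule (formJ φ V)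

/-- `t` is a closed term in the sense of `M`. -/
def IsClosedTerm (t : M) : Prop := ∃ V, IsEmptyCode V ∧ Derivable FormationRule (termJ t V)

/-- `c` is the code of a set of closed terms. -/
def IsTermSetCode (c : M) : Prop := IsSetCode c ∧ ∀ t, Mem t c → IsClosedTerm t

/-! ## The iterated closure of a set of terms -/

/-- Rules generating the pairs of a finite set `U` and a word `w` such that `w` is a concatenation
of as many members of the set coded by `c` as `U` has elements. -/
inductive TupleRule (c : M) (D : M → Prop) : M → Prop
  | nil {U : M} : IsEmptyCode U → TupleRule c D (pair U 0)
  | cons {U U' v w w' t : M} : D (pair U w) → ¬ Mem v U → IsInsertCode U' U v → Mem t c →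
      Word [w, t] w' → TupleRule c D (pair U' w')

/-- `w = t₁ ⋯ t_m`, where `m` is the cardinality of the finite set coded by `U`, and the `tᵢ` belong
to the set coded by `c`. -/
def IsTuple (c U w : M) : Prop := Derivable (TupleRule c) (pair U w)

/-- The members of the next closure stage, after the stage with index `k` and code `c`: the members
of `c`, the terms obtained from members of `c` by a function symbol of the language of arithmetic,
and the terms obtained from members of `c` by the Skolem function symbol of a formula `∃xψ` such
that `ψ` (and `x`) have code at most `k`. -/
inductive NextStage (k c : M) : M → Prop
  | old {y : M} : Mem y c → NextStage k c y
  | zero {y : M} : Word [sym .zero] y → NextStage k c y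
  | succ {t y : M} : Mem t c → Word [sym .succ, t] y → NextStage k c y
  | add {t u y : M} : Mem t c → Mem u c → Word [sym .add, t, u] y → NextStage k c y
  | mul {t u y : M} : Mem t c → Mem u c → Word [sym .mul, t, u] y → NextStage k c y
  | skolem {x ψ V U w y : M} : IsVar x → IsForm ψ V → x ≤ k → ψ ≤ k → IsEraseCode U V x →
      IsTuple c U w → Word [sym .sk, sym .ex, x, ψ, w] y → NextStage k c y

/-- Rules generating the pairs of an index `k` and the code of the `k`-th closure stage of the set
coded by `l`. -/
inductive StageRule (l : M) (D : M → Prop) : M → Prop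
  | zero : StageRule l D (pair 0 l)
  | succ {k c c' : M} : D (pair k c) → IsSetCode c' → (∀ y, Mem y c' ↔ NextStage k c y) →
      StageRule l D (pair (ArithStructure.succ k) c')

/-- `c` is the code of the `k`-th closure stage `Λ^⟨k⟩` of the set `Λ` with code `l`. -/
def IsStageCode (l k c : M) : Prop := Derivable (StageRule l) (pair k c)

end Internal

end BA

/-! Put n = log ⌜Λ⌝, m = log n and N = exp m. Then ⌜Λ⌝ ≤ exp N, and Y = ω_2(⌜Λ⌝) is exp(exp(m²)).
Since m is non-standard, e·m ≤ m² for every standard e, hence exp(N^e) ≤ Y (`exists_scale`). The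
numbers below some exp(N^e) with e standard form an initial segment `Cut N` that contains ⌜Λ⌝ and
lies below Y. It is closed under multiplication, because N^e + N^e ≤ N^(e+1). More importantly, it
is closed under unions of coded families. A set with code at most exp(N^e) has at most about N^e
members, and the union of two sets has code at most A·B⁴. So a union of that many sets, each with
code at most exp(N^e), has code at most exp(4·N^e·N^e) (`exists_biUnion`, `Scale.biUnion`). Images
under partial functions and products follow.

For a standard index the Skolem functions used in a closure step have standard arity, so the next
stage arises by finitely many unions, images and products and stays in the cut (`exists_nextStage`).
Thus every standard stage is coded below Y. The statement `HasStages`, that the stages up to j are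
derived by witnesses below Y, is a bounded formula (`d0_hasStages`). Since it holds for all standard
j, it holds for some non-standard j by `D0Pred.overspill`.

The main labour is to find that bounded formula, since exponentials, formulas and tuples are defined
by derivations of unlimited size. For exponentiation, repeated squaring yields derivations
polynomial in the value (`isDer_exp_bound`). For formation judgements about words up to j, a
derivation can be cut down to judgements that are themselves small (`derivable_small_iff`). Its code
is then bounded by an iterated exponential of j, and `Room j B` says that this bound lies below B.
This is true for standard j as soon as B exceeds all standard numbers (`room_natCast`), so `Room`
can be part of the overspilled formula. Tuples are collected in a table whose closure conditions
force agreement with derivability (`IsTupleTable.mem_iff`).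

Bounded definability is tracked semantically by `Poly` and `D0`, and most instances are found by
instance search. -/

namespace BA

/-! ### Bounded definability with parameters -/

section Definability

variable {M : Type*}

/-- Valuation of the free variables: variable `0` has value `x`, the other ones are parameters. -/
def paramVal (x : M) (e : ℕ → M) : ℕ → M
  | 0 => x
  | k + 1 => e k

/-- Renaming of the parameters. -/
def shiftVar (g : ℕ → ℕ) : ℕ → ℕ
  | 0 => 0
  | k + 1 => g k + 1

theorem paramVal_shiftVar {x : M} {e e' : ℕ → M} {g : ℕ → ℕ} (hg : ∀ i, e' (g i) = e i) (k : ℕ) :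
    paramVal x e' (shiftVar g k) = paramVal x e k := by
  cases k with
  | zero => rfl
  | succ k => exact hg k

/-- Interleaving: even positions carry the first sequence, odd positions the second. This lets two
definitions with different parameters be combined. -/
theorem exists_common_params (e₁ e₂ : ℕ → M) :
    ∃ e : ℕ → M, (∀ i, ∃ j, e j = e₁ i) ∧ ∀ i, ∃ j, e j = e₂ i := by
  refine ⟨fun k => if k % 2 = 0 then e₁ (k / 2) else e₂ (k / 2), fun i => ⟨2 * i, ?_⟩,
    fun i => ⟨2 * i + 1, ?_⟩⟩
  · simp
  · have h1 : (2 * i + 1) % 2 = 1 := by omega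
    have h2 : (2 * i + 1) / 2 = i := by omega
    simp [h1, h2]

theorem snoc_tail {n : ℕ} (v : Fin (n + 1) → M) (x : M) :
    (fun i : Fin (n + 1) => (Fin.snoc v x : Fin (n + 2) → M) i.succ) =
      Fin.snoc (fun i => v i.succ) x := by
  funext i
  refine Fin.lastCases ?_ (fun i => ?_) i
  · rw [Fin.snoc_last, Fin.succ_last, Fin.snoc_last]
  · rw [Fin.snoc_castSucc, Fin.succ_castSucc, Fin.snoc_castSucc]

variable [ArithStructure M]

/-- The function `f` is the value of a term with parameters from `e`. -/
def PolyAt (e : ℕ → M) {n : ℕ} (f : (Fin (n + 1) → M) → M) : Prop :=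
  ∃ t : LA.Term (ℕ ⊕ Fin n), ∀ v : Fin (n + 1) → M,
    t.realize (Sum.elim (paramVal (v 0) e) (fun i => v i.succ)) = f v

/-- The predicate `P` is defined by a bounded formula with parameters from `e`. -/
def D0At (e : ℕ → M) {n : ℕ} (P : (Fin (n + 1) → M) → Prop) : Prop :=
  ∃ φ : LA.BoundedFormula ℕ n, IsBounded φ ∧ ∀ v : Fin (n + 1) → M,
    φ.Realize (paramVal (v 0) e) (fun i => v i.succ) ↔ P v

/-- The function `f` is the value of a term with parameters. -/
class Poly {n : ℕ} (f : (Fin (n + 1) → M) → M) : Prop where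
  out : ∃ e, PolyAt e f

/-- The predicate `P` is defined by a bounded formula with parameters. -/
class D0 {n : ℕ} (P : (Fin (n + 1) → M) → Prop) : Prop where
  out : ∃ e, D0At e P

theorem PolyAt.mono {e e' : ℕ → M} (h : ∀ i, ∃ j, e' j = e i) {n : ℕ}
    {f : (Fin (n + 1) → M) → M} (hf : PolyAt e f) : PolyAt e' f := by
  choose g hg using h
  obtain ⟨t, ht⟩ := hf
  refine ⟨t.relabel (Sum.map (shiftVar g) id), fun v => ?_⟩
  rw [Language.Term.realize_relabel, ← ht v]
  congr 1
  ext (k | k)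
  · exact paramVal_shiftVar hg k
  · rfl

/-- The bound of a quantifier is a term weakened past the quantified variable. Substitution must
commute with this weakening for the result to have literally the shape demanded by `IsBounded`. -/
theorem relabel_subst_castSucc {n : ℕ} (f : ℕ → LA.Term ℕ) (t : LA.Term (ℕ ⊕ Fin n)) :
    (t.relabel (Sum.map id Fin.castSucc) : LA.Term (ℕ ⊕ Fin (n + 1))).subst
      (Sum.elim (Language.Term.relabel Sum.inl ∘ f) (Language.Term.var ∘ Sum.inr)) =
    (t.subst (Sum.elim (Language.Term.relabel Sum.inl ∘ f)
      (Language.Term.var ∘ Sum.inr))).relabel (Sum.map id Fin.castSucc) := by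
  induction t with
  | var a =>
    rcases a with a | a
    · simp [Language.Term.subst, Language.Term.relabel, Language.Term.relabel_relabel]
      rfl
    · simp [Language.Term.subst, Language.Term.relabel]
  | func g ts ih =>
    simp only [Language.Term.relabel, Language.Term.subst]
    congr 1
    funext i
    exact ih i

theorem IsBounded.subst {n : ℕ} {φ : LA.BoundedFormula ℕ n} (h : IsBounded φ)
    (f : ℕ → LA.Term ℕ) : IsBounded (φ.subst f) := by
  induction h with
  | falsum => exact IsBounded.falsum
  | equal t u => exact IsBounded.equal _ _
  | le t u =>
    have := IsBounded.le (t.subst (Sum.elim (Language.Term.relabel Sum.inl ∘ f)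
      (Language.Term.var ∘ Sum.inr))) (u.subst (Sum.elim (Language.Term.relabel Sum.inl ∘ f)
      (Language.Term.var ∘ Sum.inr)))
    convert this using 1
    simp only [Language.BoundedFormula.subst, Language.Relations.boundedFormula₂,
      Language.Relations.boundedFormula, Language.BoundedFormula.mapTermRel]
    congr 1
    funext i
    fin_cases i <;> rfl
  | imp _ _ h1 h2 => exact IsBounded.imp h1 h2
  | @all n t φ _ ih =>
    have := IsBounded.all (t.subst (Sum.elim (Language.Term.relabel Sum.inl ∘ f)
      (Language.Term.var ∘ Sum.inr))) ih
    convert this using 1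
    simp only [Language.BoundedFormula.subst, Language.Relations.boundedFormula₂,
      Language.Relations.boundedFormula, Language.BoundedFormula.mapTermRel,
      ← relabel_subst_castSucc]
    simp only [id_eq, Language.BoundedFormula.all.injEq, Language.BoundedFormula.imp.injEq,
      and_true]
    congr 1
    funext i
    fin_cases i <;> rfl
  | @ex n t φ _ ih =>
    have := IsBounded.ex (t.subst (Sum.elim (Language.Term.relabel Sum.inl ∘ f)
      (Language.Term.var ∘ Sum.inr))) ih
    convert this using 1
    simp only [Language.BoundedFormula.subst, Language.Relations.boundedFormula₂,
      Language.Relations.boundedFormula, Language.BoundedFormula.mapTermRel,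
      Language.BoundedFormula.ex, Language.BoundedFormula.not, min,
      ← relabel_subst_castSucc]
    simp only [id_eq, Language.BoundedFormula.all.injEq, Language.BoundedFormula.imp.injEq]
    refine ⟨⟨⟨⟨?_, trivial, rfl⟩, rfl⟩, rfl⟩, rfl⟩
    congr 1
    funext i
    fin_cases i <;> rfl

/-- Only the values of the parameters matter, so their variables may be renamed. Renaming is a
substitution, and `IsBounded.subst` keeps the formula bounded. -/
theorem D0At.mono {e e' : ℕ → M} (h : ∀ i, ∃ j, e' j = e i) {n : ℕ}
    {P : (Fin (n + 1) → M) → Prop} (hP : D0At e P) : D0At e' P := by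
  choose g hg using h
  obtain ⟨φ, hb, hφ⟩ := hP
  refine ⟨φ.subst (fun k => Language.Term.var (shiftVar g k)), hb.subst _, fun v => ?_⟩
  rw [Language.BoundedFormula.realize_subst, ← hφ v]
  simp only [Language.Term.realize_var, paramVal_shiftVar hg]

variable {n : ℕ}

instance Poly.const (c : M) : Poly (fun _ : Fin (n + 1) → M => c) :=
  ⟨fun _ => c, Language.Term.var (Sum.inl 1), fun _ => rfl⟩

instance Poly.var (i : Fin (n + 1)) : Poly (fun v : Fin (n + 1) → M => v i) := by
  refine ⟨fun _ => 0, ?_⟩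
  refine Fin.cases ⟨Language.Term.var (Sum.inl 0), fun _ => rfl⟩
    (fun i => ⟨Language.Term.var (Sum.inr i), fun _ => rfl⟩) i

theorem Poly.comp₂ {f g : (Fin (n + 1) → M) → M} (hf : Poly f) (hg : Poly g)
    (s : LA.Functions 2) :
    Poly (fun v => Language.Structure.funMap s ![f v, g v]) := by
  obtain ⟨e₁, h₁⟩ := hf.out
  obtain ⟨e₂, h₂⟩ := hg.out
  obtain ⟨e, i₁, i₂⟩ := exists_common_params e₁ e₂
  obtain ⟨t, ht⟩ := h₁.mono i₁
  obtain ⟨u, hu⟩ := h₂.mono i₂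
  refine ⟨e, Language.Functions.apply₂ s t u, fun v => ?_⟩
  rw [Language.Term.realize_functions_apply₂, ht, hu]

instance Poly.add {f g : (Fin (n + 1) → M) → M} [hf : Poly f] [hg : Poly g] :
    Poly (fun v => f v + g v) :=
  Poly.comp₂ hf hg ArithFunc.add

instance Poly.mul {f g : (Fin (n + 1) → M) → M} [hf : Poly f] [hg : Poly g] :
    Poly (fun v => f v * g v) :=
  Poly.comp₂ hf hg ArithFunc.mul

instance Poly.succ {f : (Fin (n + 1) → M) → M} [hf : Poly f] :
    Poly (fun v => ArithStructure.succ (f v)) := by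
  obtain ⟨e, t, ht⟩ := hf.out
  refine ⟨e, Language.Functions.apply₁ (L := LA) ArithFunc.succ t, fun v => ?_⟩
  exact (Language.Term.realize_functions_apply₁ (L := LA) (f := ArithFunc.succ)).trans
    (congrArg ArithStructure.succ (ht v))

theorem D0.of_iff {P Q : (Fin (n + 1) → M) → Prop} (h : ∀ v, P v ↔ Q v) (hQ : D0 Q) : D0 P := by
  rwa [show P = Q from funext fun v => propext (h v)]

instance D0.eq {f g : (Fin (n + 1) → M) → M} [hf : Poly f] [hg : Poly g] :
    D0 (fun v => f v = g v) := by
  obtain ⟨e₁, h₁⟩ := hf.out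
  obtain ⟨e₂, h₂⟩ := hg.out
  obtain ⟨e, i₁, i₂⟩ := exists_common_params e₁ e₂
  obtain ⟨t, ht⟩ := h₁.mono i₁
  obtain ⟨u, hu⟩ := h₂.mono i₂
  refine ⟨e, t.bdEqual u, IsBounded.equal t u, fun v => ?_⟩
  rw [Language.BoundedFormula.realize_bdEqual, ht, hu]

theorem realize_le {n : ℕ} (t u : LA.Term (ℕ ⊕ Fin n)) (a : ℕ → M) (b : Fin n → M) :
    (leSymb.boundedFormula₂ t u).Realize a b ↔
      t.realize (Sum.elim a b) ≤ u.realize (Sum.elim a b) := by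
  rw [Language.BoundedFormula.realize_rel₂]
  rfl

instance D0.le {f g : (Fin (n + 1) → M) → M} [hf : Poly f] [hg : Poly g] :
    D0 (fun v => f v ≤ g v) := by
  obtain ⟨e₁, h₁⟩ := hf.out
  obtain ⟨e₂, h₂⟩ := hg.out
  obtain ⟨e, i₁, i₂⟩ := exists_common_params e₁ e₂
  obtain ⟨t, ht⟩ := h₁.mono i₁
  obtain ⟨u, hu⟩ := h₂.mono i₂
  refine ⟨e, leSymb.boundedFormula₂ t u, IsBounded.le t u, fun v => ?_⟩
  rw [realize_le, ht, hu]

instance D0.false : D0 (fun _ : Fin (n + 1) → M => False) :=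
  ⟨fun _ => 0, ⊥, IsBounded.falsum, fun _ => Iff.rfl⟩

instance D0.imp {P Q : (Fin (n + 1) → M) → Prop} [hP : D0 P] [hQ : D0 Q] :
    D0 (fun v => P v → Q v) := by
  obtain ⟨e₁, h₁⟩ := hP.out
  obtain ⟨e₂, h₂⟩ := hQ.out
  obtain ⟨e, i₁, i₂⟩ := exists_common_params e₁ e₂
  obtain ⟨t, bt, ht⟩ := h₁.mono i₁
  obtain ⟨u, bu, hu⟩ := h₂.mono i₂
  refine ⟨e, t.imp u, bt.imp bu, fun v => ?_⟩
  rw [Language.BoundedFormula.realize_imp, ht, hu]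

instance D0.not {P : (Fin (n + 1) → M) → Prop} [D0 P] : D0 (fun v => ¬ P v) :=
  D0.imp (Q := fun _ => False)

instance D0.ne {f g : (Fin (n + 1) → M) → M} [Poly f] [Poly g] : D0 (fun v => f v ≠ g v) :=
  D0.not

instance D0.and {P Q : (Fin (n + 1) → M) → Prop} [D0 P] [D0 Q] : D0 (fun v => P v ∧ Q v) :=
  D0.of_iff (Q := fun v => ¬ (P v → ¬ Q v)) (fun _ => by tauto) inferInstance

instance D0.or {P Q : (Fin (n + 1) → M) → Prop} [D0 P] [D0 Q] : D0 (fun v => P v ∨ Q v) :=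
  D0.of_iff (Q := fun v => ¬ P v → Q v) (fun _ => by tauto) inferInstance

instance D0.iff {P Q : (Fin (n + 1) → M) → Prop} [D0 P] [D0 Q] : D0 (fun v => (P v ↔ Q v)) :=
  D0.of_iff (Q := fun v => (P v → Q v) ∧ (Q v → P v)) (fun _ => by tauto) inferInstance

/-- The quantified variable becomes the last coordinate of the extended valuation, while coordinate
0 remains the variable reserved for induction. -/
instance D0.all {f : (Fin (n + 1) → M) → M} {P : (Fin (n + 1) → M) → M → Prop} [hf : Poly f]
    [hP : D0 (fun w : Fin (n + 2) → M => P (fun i => w i.castSucc) (w (Fin.last (n + 1))))] :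
    D0 (fun v => ∀ x, x ≤ f v → P v x) := by
  obtain ⟨e₁, h₁⟩ := hf.out
  obtain ⟨e₂, h₂⟩ := hP.out
  obtain ⟨e, i₁, i₂⟩ := exists_common_params e₁ e₂
  obtain ⟨t, ht⟩ := h₁.mono i₁
  obtain ⟨φ, bφ, hφ⟩ := h₂.mono i₂
  refine ⟨e, _, IsBounded.all t bφ, fun v => ?_⟩
  rw [Language.BoundedFormula.realize_all]
  refine forall_congr' fun x => ?_
  rw [Language.BoundedFormula.realize_imp, realize_le, Language.Term.realize_relabel, ← ht v]
  have := hφ (Fin.snoc v x)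
  rw [snoc_tail] at this
  simp only [Fin.snoc_castSucc, Fin.snoc_last] at this
  have h0 : (Fin.snoc v x : Fin (n + 2) → M) 0 = v 0 :=
    Fin.snoc_castSucc (α := fun _ => M) x v 0
  rw [h0] at this
  rw [this]
  have h3 : (Sum.elim (paramVal (v 0) e) (Fin.snoc (fun i : Fin n => v i.succ) x : Fin (n + 1) → M)
      ∘ Sum.map id Fin.castSucc) = Sum.elim (paramVal (v 0) e) (fun i => v i.succ) := by
    funext k
    rcases k with k | k
    · rfl
    · exact Fin.snoc_castSucc (α := fun _ => M) x (fun i : Fin n => v i.succ) k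
  rw [h3]
  simp [Language.Term.realize_var]

instance D0.ex {f : (Fin (n + 1) → M) → M} {P : (Fin (n + 1) → M) → M → Prop} [hf : Poly f]
    [hP : D0 (fun w : Fin (n + 2) → M => P (fun i => w i.castSucc) (w (Fin.last (n + 1))))] :
    D0 (fun v => ∃ x, x ≤ f v ∧ P v x) :=
  D0.of_iff (Q := fun v => ¬ ∀ x, x ≤ f v → ¬ P v x) (fun _ => by push Not; rfl) inferInstance

theorem D0.ex_of_bound (f : (Fin (n + 1) → M) → M) [Poly f]
    {P : (Fin (n + 1) → M) → M → Prop} (hb : ∀ v x, P v x → x ≤ f v)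
    (hP : D0 (fun w : Fin (n + 2) → M => P (fun i => w i.castSucc) (w (Fin.last (n + 1))))) :
    D0 (fun v => ∃ x, P v x) :=
  D0.of_iff (fun v => exists_congr fun x => ⟨fun h => ⟨hb v x h, h⟩, fun h => h.2⟩) D0.ex

theorem D0.all_of_bound (f : (Fin (n + 1) → M) → M) [Poly f]
    {P : (Fin (n + 1) → M) → M → Prop} (hb : ∀ v x, ¬ P v x → x ≤ f v)
    (hP : D0 (fun w : Fin (n + 2) → M => P (fun i => w i.castSucc) (w (Fin.last (n + 1))))) :
    D0 (fun v => ∀ x, P v x) :=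
  D0.of_iff (fun v => forall_congr' fun x =>
    ⟨fun h (_ : x ≤ f v) => h, fun h => by by_contra hn; exact hn (h (hb v x hn))⟩) D0.all

/-- Induction for predicates defined by bounded formulas. -/
theorem IsModelIDelta0.induct (hM : IsModelIDelta0 M) {P : M → Prop}
    (hP : D0 (fun v : Fin 1 → M => P (v 0))) (h0 : P 0)
    (hs : ∀ x, P x → P (ArithStructure.succ x)) (x : M) : P x := by
  obtain ⟨e, φ, hb, hφ⟩ := hP.out
  have key : ∀ x, φ.Realize (Function.update (paramVal 0 e) 0 x) default ↔ P x := fun x => by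
    refine Iff.trans ?_ (hφ (fun _ => x))
    have h1 : Function.update (paramVal 0 e) 0 x = paramVal x e := by
      funext k
      cases k <;> rfl
    rw [h1]
    exact iff_of_eq (congrArg _ (Subsingleton.elim _ _))
  refine (key x).1 (hM.induction φ hb (paramVal 0 e) ((key 0).2 h0) (fun x h => ?_) x)
  exact (key _).2 (hs x ((key x).1 h))

end Definability

/-! ### Laws of addition, multiplication and order from bounded induction -/

section Arithmetic

variable {M : Type*} [ArithStructure M]

local notation "S" => ArithStructure.succ

namespace IsModelIDelta0

variable (hM : IsModelIDelta0 M)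
include hM

theorem zero_add (x : M) : 0 + x = x :=
  hM.induct (P := fun x => 0 + x = x) inferInstance (hM.add_zero 0)
    (fun x h => by rw [hM.add_succ, h]) x

theorem succ_add (x y : M) : S x + y = S (x + y) :=
  hM.induct (P := fun y => S x + y = S (x + y)) inferInstance
    (by rw [hM.add_zero, hM.add_zero]) (fun y h => by rw [hM.add_succ, h, hM.add_succ]) y

theorem add_comm (x y : M) : x + y = y + x :=
  hM.induct (P := fun y => x + y = y + x) inferInstance
    (by rw [hM.add_zero, hM.zero_add]) (fun y h => by rw [hM.add_succ, h, hM.succ_add]) y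

theorem add_assoc (x y z : M) : x + y + z = x + (y + z) :=
  hM.induct (P := fun z => x + y + z = x + (y + z)) inferInstance
    (by rw [hM.add_zero, hM.add_zero])
    (fun z h => by rw [hM.add_succ, h, hM.add_succ, hM.add_succ]) z

theorem zero_mul (x : M) : 0 * x = 0 :=
  hM.induct (P := fun x => 0 * x = 0) inferInstance (hM.mul_zero 0)
    (fun x h => by rw [hM.mul_succ, h, hM.add_zero]) x

theorem succ_mul (x y : M) : S x * y = x * y + y :=
  hM.induct (P := fun y => S x * y = x * y + y) inferInstance
    (by rw [hM.mul_zero, hM.mul_zero, hM.add_zero])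
    (fun y h => by
      rw [hM.mul_succ, h, hM.mul_succ, hM.add_succ, hM.add_succ, hM.add_assoc, hM.add_assoc,
        hM.add_comm x y]) y

theorem mul_comm (x y : M) : x * y = y * x :=
  hM.induct (P := fun y => x * y = y * x) inferInstance
    (by rw [hM.mul_zero, hM.zero_mul]) (fun y h => by rw [hM.mul_succ, h, hM.succ_mul]) y

theorem mul_add (x y z : M) : x * (y + z) = x * y + x * z :=
  hM.induct (P := fun z => x * (y + z) = x * y + x * z) inferInstance
    (by rw [hM.add_zero, hM.mul_zero, hM.add_zero])
    (fun z h => by rw [hM.add_succ, hM.mul_succ, h, hM.mul_succ, hM.add_assoc]) z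

theorem mul_assoc (x y z : M) : x * y * z = x * (y * z) :=
  hM.induct (P := fun z => x * y * z = x * (y * z)) inferInstance
    (by rw [hM.mul_zero, hM.mul_zero, hM.mul_zero])
    (fun z h => by rw [hM.mul_succ, h, hM.mul_succ, hM.mul_add]) z

theorem mul_one (x : M) : x * S 0 = x := by
  rw [hM.mul_succ, hM.mul_zero, hM.zero_add]

theorem add_right_cancel {x y z : M} : x + z = y + z → x = y :=
  hM.induct (P := fun z => x + z = y + z → x = y) inferInstance
    (fun h => by rwa [hM.add_zero, hM.add_zero] at h)
    (fun z ih h => ih (hM.succ_inj _ _ (by rwa [hM.add_succ, hM.add_succ] at h))) z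

theorem eq_zero_of_add {x y : M} (h : x + y = 0) : y = 0 := by
  by_contra hy
  obtain ⟨z, rfl⟩ := hM.exists_pred y hy
  rw [hM.add_succ] at h
  exact hM.succ_ne_zero _ h

theorem le_total (x y : M) : x ≤ y ∨ y ≤ x := by
  refine hM.induct (P := fun y => x ≤ y ∨ y ≤ x) inferInstance
    (Or.inr ((hM.le_iff _ _).2 ⟨x, hM.zero_add x⟩)) (fun y h => ?_) y
  rcases h with h | h
  · obtain ⟨z, rfl⟩ := (hM.le_iff _ _).1 h
    exact Or.inl ((hM.le_iff _ _).2 ⟨S z, hM.add_succ _ _⟩)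
  · obtain ⟨z, rfl⟩ := (hM.le_iff _ _).1 h
    by_cases hz : z = 0
    · subst hz
      exact Or.inl ((hM.le_iff _ _).2 ⟨S 0, by rw [hM.add_zero, hM.add_succ, hM.add_zero]⟩)
    · obtain ⟨w, rfl⟩ := hM.exists_pred z hz
      exact Or.inr ((hM.le_iff _ _).2 ⟨w, by rw [hM.add_succ, hM.succ_add]⟩)

theorem le_antisymm {x y : M} (h₁ : x ≤ y) (h₂ : y ≤ x) : x = y := by
  obtain ⟨z, rfl⟩ := (hM.le_iff _ _).1 h₁
  obtain ⟨w, hw⟩ := (hM.le_iff _ _).1 h₂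
  have h : (z + w) + x = 0 + x := by
    rw [hM.zero_add, hM.add_comm, ← hM.add_assoc, hw]
  have h3 := hM.add_right_cancel h
  rw [hM.add_comm] at h3
  rw [hM.eq_zero_of_add h3, hM.add_zero]

end IsModelIDelta0

/-- Models of bounded arithmetic, as a class. -/
class Model (M : Type*) extends ArithStructure M where
  isModel : IsModelIDelta0 M

end Arithmetic

/-! ### The model as a discretely ordered commutative semiring -/

section Semiring

variable {M : Type*} [Model M]

theorem hmod : IsModelIDelta0 M := Model.isModel

instance : CommSemiring M where
  one := ArithStructure.succ 0
  zero_add := hmod.zero_add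
  add_zero := hmod.add_zero
  add_comm := hmod.add_comm
  add_assoc := hmod.add_assoc
  zero_mul := hmod.zero_mul
  mul_zero := hmod.mul_zero
  mul_comm := hmod.mul_comm
  mul_assoc := hmod.mul_assoc
  mul_one := hmod.mul_one
  one_mul x := (hmod.mul_comm _ _).trans (hmod.mul_one x)
  left_distrib := hmod.mul_add
  right_distrib x y z := by
    rw [hmod.mul_comm, hmod.mul_add, hmod.mul_comm z, hmod.mul_comm z]
  nsmul := nsmulRec
  npow := fun n x => @npowRec M ⟨ArithStructure.succ 0⟩ _ n x
  -- With this choice numerals and casts agree by definition.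
  natCast := num
  natCast_zero := rfl
  natCast_succ n := by
    change ArithStructure.succ (num n) = num n + ArithStructure.succ 0
    rw [hmod.add_succ, hmod.add_zero]

theorem succ_eq (x : M) : ArithStructure.succ x = x + 1 := by
  change _ = x + ArithStructure.succ 0
  rw [hmod.add_succ, hmod.add_zero]

noncomputable instance : LinearOrder M where
  le_refl x := (hmod.le_iff _ _).2 ⟨0, add_zero x⟩
  le_trans x y z h₁ h₂ := by
    obtain ⟨a, rfl⟩ := (hmod.le_iff _ _).1 h₁
    obtain ⟨b, rfl⟩ := (hmod.le_iff _ _).1 h₂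
    exact (hmod.le_iff _ _).2 ⟨a + b, (add_assoc _ _ _).symm⟩
  le_antisymm _ _ := hmod.le_antisymm
  le_total := hmod.le_total
  toDecidableLE := Classical.decRel _

instance : CanonicallyOrderedAdd M where
  exists_add_of_le h := by
    obtain ⟨z, hz⟩ := (hmod.le_iff _ _).1 h
    exact ⟨z, hz.symm⟩
  le_self_add x y := (hmod.le_iff _ _).2 ⟨y, rfl⟩
  le_add_self x y := (hmod.le_iff _ _).2 ⟨y, add_comm _ _⟩

theorem exists_succ {x : M} (h : x ≠ 0) : ∃ y, x = y + 1 := by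
  obtain ⟨y, hy⟩ := hmod.exists_pred x h
  exact ⟨y, by rw [hy, succ_eq]⟩

instance : IsCancelAdd M where
  add_right_cancel a b c h := hmod.add_right_cancel h
  add_left_cancel a b c h := hmod.add_right_cancel (z := a) (by
    rw [hmod.add_comm b, hmod.add_comm c]; exact h)

instance : IsOrderedAddMonoid M where
  add_le_add_left a b h c := by
    obtain ⟨d, rfl⟩ := exists_add_of_le h
    rw [add_right_comm]
    exact le_self_add

/-- Discreteness of the order: a non-zero difference is a successor, and 1 + d is never zero. -/
theorem lt_iff_succ_le {x y : M} : x < y ↔ x + 1 ≤ y := by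
  constructor
  · intro h
    obtain ⟨d, rfl⟩ := exists_add_of_le h.le
    obtain ⟨e, rfl⟩ := exists_succ (x := d) (fun hd => by simp [hd] at h)
    rw [add_comm e, ← add_assoc]
    exact le_self_add
  · intro h
    refine lt_of_le_of_ne (le_self_add.trans h) ?_
    rintro rfl
    obtain ⟨d, hd⟩ := exists_add_of_le h
    rw [add_assoc] at hd
    have h2 : 1 + d = 0 := add_left_cancel (a := x) (by rw [← hd, add_zero])
    rw [add_comm, ← succ_eq] at h2
    exact hmod.succ_ne_zero _ h2

instance : Nontrivial M := ⟨0, 1, fun h => hmod.succ_ne_zero (0 : M) h.symm⟩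

theorem mul_lt_mul_aux {a b c : M} (hc : 0 < c) (h : a < b) : c * a < c * b := by
  obtain ⟨c, rfl⟩ := exists_succ hc.ne'
  obtain ⟨d, rfl⟩ := exists_add_of_le (lt_iff_succ_le.1 h)
  rw [mul_add (c + 1), mul_add (c + 1), mul_one]
  refine lt_iff_succ_le.2 ?_
  rw [add_assoc, add_comm c, add_assoc 1 c, ← add_assoc _ 1]
  exact le_self_add

instance : IsStrictOrderedRing M where
  zero_le_one := zero_le
  mul_lt_mul_of_pos_left c hc a b h := mul_lt_mul_aux hc h
  mul_lt_mul_of_pos_right c hc a b h := by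
    simpa only [mul_comm] using mul_lt_mul_aux hc h
  le_of_add_le_add_left a b c h := by
    obtain ⟨d, hd⟩ := exists_add_of_le h
    rw [add_assoc] at hd
    rw [add_left_cancel hd]
    exact le_self_add

theorem num_eq (n : ℕ) : (num n : M) = (n : M) := rfl

theorem less_iff {x y : M} : Less x y ↔ x < y := lt_iff_le_and_ne.symm

end Semiring

/-! ### The ring of differences -/

section Integers

variable {M : Type*} [Model M]

/-- Two pairs represent the same difference. -/
instance diffSetoid (M : Type*) [Model M] : Setoid (M × M) where
  r p q := p.1 + q.2 = q.1 + p.2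
  iseqv := ⟨fun _ => rfl, fun h => h.symm, fun {p q r} h h' => by
    have : (p.1 + r.2) + q.2 = (r.1 + p.2) + q.2 := by grind
    exact add_right_cancel this⟩

/-- The ring of differences of a model of bounded arithmetic. -/
def Diff (M : Type*) [Model M] : Type _ := Quotient (diffSetoid M)

namespace Diff

theorem sound {p q : M × M} (h : p.1 + q.2 = q.1 + p.2) :
    (Quotient.mk (diffSetoid M) p : Diff M) = Quotient.mk (diffSetoid M) q :=
  Quotient.sound h

instance : Zero (Diff M) where
  zero := Quotient.mk _ (0, 0)

instance : One (Diff M) where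
  one := Quotient.mk _ (1, 0)

instance : Add (Diff M) where
  add := Quotient.lift₂ (fun p q => Quotient.mk _ (p.1 + q.1, p.2 + q.2))
    (fun p q r s (h : _ = _) (h' : _ = _) => sound (by grind))

instance : Mul (Diff M) where
  mul := Quotient.lift₂
    (fun p q => Quotient.mk _ (p.1 * q.1 + p.2 * q.2, p.1 * q.2 + p.2 * q.1))
    (fun p q r s (h : _ = _) (h' : _ = _) => sound (by
      -- Adding the mixed products to both sides replaces the missing subtraction: the goal becomes
      -- a sum of multiples of the two hypotheses.
      refine add_right_cancel (b := r.1 * q.2 + r.2 * q.1) ?_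
      have h1 : (p.1 + r.2) * q.1 = (r.1 + p.2) * q.1 := by rw [h]
      have h2 : (p.1 + r.2) * q.2 = (r.1 + p.2) * q.2 := by rw [h]
      have h3 : r.1 * (q.1 + s.2) = r.1 * (s.1 + q.2) := by rw [h']
      have h4 : r.2 * (q.1 + s.2) = r.2 * (s.1 + q.2) := by rw [h']
      grind))

instance : Neg (Diff M) where
  neg := Quotient.lift (fun p => Quotient.mk _ (p.2, p.1))
    (fun p q (h : _ = _) => sound (by grind))

instance : CommRing (Diff M) where
  nsmul := nsmulRec
  zsmul := zsmulRec
  zero_add := by rintro ⟨a⟩; exact sound (by grind)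
  add_zero := by rintro ⟨a⟩; exact sound (by grind)
  add_comm := by rintro ⟨a⟩ ⟨b⟩; exact sound (by grind)
  add_assoc := by rintro ⟨a⟩ ⟨b⟩ ⟨c⟩; exact sound (by grind)
  neg_add_cancel := by rintro ⟨a⟩; exact sound (by grind)
  zero_mul := by rintro ⟨a⟩; exact sound (by grind)
  mul_zero := by rintro ⟨a⟩; exact sound (by grind)
  one_mul := by rintro ⟨a⟩; exact sound (by grind)
  mul_one := by rintro ⟨a⟩; exact sound (by grind)
  mul_comm := by rintro ⟨a⟩ ⟨b⟩; exact sound (by grind)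
  mul_assoc := by rintro ⟨a⟩ ⟨b⟩ ⟨c⟩; exact sound (by grind)
  left_distrib := by rintro ⟨a⟩ ⟨b⟩ ⟨c⟩; exact sound (by grind)
  right_distrib := by rintro ⟨a⟩ ⟨b⟩ ⟨c⟩; exact sound (by grind)

noncomputable instance : LinearOrder (Diff M) where
  le := Quotient.lift₂ (fun p q => p.1 + q.2 ≤ q.1 + p.2)
    (fun p q r s (h : _ = _) (h' : _ = _) => by
      apply propext
      constructor <;> intro _ <;> grind)
  le_refl := by rintro ⟨a⟩; exact le_refl (a.1 + a.2)
  le_trans := by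
    rintro ⟨a⟩ ⟨b⟩ ⟨c⟩ (h : _ ≤ _) (h' : _ ≤ _)
    change _ ≤ _
    grind
  le_antisymm := by
    rintro ⟨a⟩ ⟨b⟩ (h : _ ≤ _) (h' : _ ≤ _)
    exact sound (le_antisymm h h')
  le_total := by
    rintro ⟨a⟩ ⟨b⟩
    exact le_total (a.1 + b.2) (b.1 + a.2)
  toDecidableLE := Classical.decRel _

instance : IsOrderedAddMonoid (Diff M) where
  add_le_add_left := by
    rintro ⟨a⟩ ⟨b⟩ (h : a.1 + b.2 ≤ b.1 + a.2) ⟨c⟩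
    change (a.1 + c.1) + (b.2 + c.2) ≤ (b.1 + c.1) + (a.2 + c.2)
    grind

/-- The inclusion of the model into its ring of differences. -/
def ofM (x : M) : Diff M := Quotient.mk _ (x, 0)

instance : Coe M (Diff M) := ⟨ofM⟩

theorem coe_le {x y : M} : (x : Diff M) ≤ y ↔ x ≤ y := by
  change x + 0 ≤ y + 0 ↔ _
  simp

theorem coe_lt {x y : M} : (x : Diff M) < y ↔ x < y := by
  rw [← not_le, ← not_le, coe_le]

theorem coe_inj {x y : M} : (x : Diff M) = y ↔ x = y := by
  rw [le_antisymm_iff, le_antisymm_iff, coe_le, coe_le]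

theorem coe_add (x y : M) : ((x + y : M) : Diff M) = x + y := sound (by simp)
theorem coe_mul (x y : M) : ((x * y : M) : Diff M) = x * y := sound (by simp)
theorem coe_zero : ((0 : M) : Diff M) = 0 := rfl
theorem coe_one : ((1 : M) : Diff M) = 1 := rfl

theorem coe_natCast (n : ℕ) : ((n : M) : Diff M) = n := by
  induction n with
  | zero => rw [Nat.cast_zero, Nat.cast_zero, coe_zero]
  | succ n ih => rw [Nat.cast_succ, Nat.cast_succ, coe_add, ih, coe_one]

theorem coe_ofNat (n : ℕ) [n.AtLeastTwo] :
    ((no_index (OfNat.ofNat n) : M) : Diff M) = OfNat.ofNat n := by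
  simpa using coe_natCast (M := M) (OfNat.ofNat n)

theorem coe_nonneg (x : M) : (0 : Diff M) ≤ x := by
  rw [← coe_zero, coe_le]
  exact zero_le

theorem exists_coe {x : Diff M} (h : 0 ≤ x) : ∃ y : M, x = y := by
  induction x using Quotient.inductionOn with
  | h p =>
    have h1 : 0 + p.2 ≤ p.1 + 0 := h
    simp only [zero_add, add_zero] at h1
    obtain ⟨y, hy⟩ := exists_add_of_le h1
    exact ⟨y, sound (by simp [hy, add_comm])⟩

instance : Nontrivial (Diff M) := ⟨0, 1, fun h => zero_ne_one (coe_inj (M := M).1 h)⟩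

instance : ZeroLEOneClass (Diff M) := ⟨coe_nonneg (1 : M)⟩

instance : IsStrictOrderedRing (Diff M) :=
  IsStrictOrderedRing.of_mul_pos (fun a b ha hb => by
    obtain ⟨x, rfl⟩ := exists_coe ha.le
    obtain ⟨y, rfl⟩ := exists_coe hb.le
    rw [← coe_zero, coe_lt] at ha hb
    rw [← coe_mul, ← coe_zero, coe_lt]
    exact mul_pos ha hb)

end Diff

theorem num_two : (num 2 : M) = 2 := (Nat.cast_ofNat : ((2 : ℕ) : M) = 2)
theorem num_one : (num 1 : M) = 1 := (Nat.cast_one : ((1 : ℕ) : M) = 1)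

/-- Inequalities of the semiring are moved to an ordered ring, where `nlinarith` applies. -/
theorem diff_le {x y : M} : x ≤ y ↔ (x : Diff M) ≤ y := Diff.coe_le.symm
theorem diff_lt {x y : M} : x < y ↔ (x : Diff M) < y := Diff.coe_lt.symm
attribute [push_cast] Diff.coe_add Diff.coe_mul Diff.coe_zero Diff.coe_one Diff.coe_natCast
  Diff.coe_ofNat


end Integers

/-! ### Substitution of terms, and induction principles -/

section Induction

variable {M : Type*} [Model M]

instance D0.less {n : ℕ} {f g : (Fin (n + 1) → M) → M} [Poly f] [Poly g] :
    D0 (fun v => Less (f v) (g v)) :=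
  D0.and (P := fun v => f v ≤ g v)

instance D0.lt {n : ℕ} {f g : (Fin (n + 1) → M) → M} [Poly f] [Poly g] :
    D0 (fun v => f v < g v) :=
  D0.of_iff (fun _ => less_iff.symm) D0.less

instance Poly.pow {n : ℕ} {f : (Fin (n + 1) → M) → M} [hf : Poly f] (k : ℕ) :
    Poly (fun v => f v ^ k) := by
  induction k with
  | zero => simp only [pow_zero]; infer_instance
  | succ k ih => simp only [pow_succ]; infer_instance

theorem Poly.weaken {n : ℕ} {f : (Fin (n + 1) → M) → M} (hf : Poly f) :
    Poly (fun w : Fin (n + 2) → M => f (fun i => w i.castSucc)) := by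
  obtain ⟨e, t, ht⟩ := hf.out
  refine ⟨e, t.relabel (Sum.map id Fin.castSucc), fun v => ?_⟩
  rw [FirstOrder.Language.Term.realize_relabel]
  refine Eq.trans ?_ (ht (fun i => v i.castSucc))
  congr 1
  ext (k | k) <;> rfl

instance D0.all_lt {n : ℕ} {f : (Fin (n + 1) → M) → M} {P : (Fin (n + 1) → M) → M → Prop}
    [hf : Poly f]
    [D0 (fun w : Fin (n + 2) → M => P (fun i => w i.castSucc) (w (Fin.last (n + 1))))] :
    D0 (fun v => ∀ x, x < f v → P v x) :=
  D0.all_of_bound f (fun v x h => by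
    by_contra hn
    exact h fun h' => absurd h'.le hn) (by
    have := hf.weaken
    infer_instance)

instance D0.ex_lt {n : ℕ} {f : (Fin (n + 1) → M) → M} {P : (Fin (n + 1) → M) → M → Prop}
    [Poly f]
    [D0 (fun w : Fin (n + 2) → M => P (fun i => w i.castSucc) (w (Fin.last (n + 1))))] :
    D0 (fun v => ∃ x, x < f v ∧ P v x) :=
  D0.of_iff (Q := fun v => ¬ ∀ x, x < f v → ¬ P v x) (fun _ => by push Not; rfl) inferInstance

/-- A predicate defined by a bounded formula. -/
def D0Pred (P : M → Prop) : Prop := ∀ (n : ℕ) (i : Fin (n + 1)), D0 (fun v => P (v i))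

/-- A binary relation defined by a bounded formula. -/
def D0Pred₂ (P : M → M → Prop) : Prop :=
  ∀ (n : ℕ) (i j : Fin (n + 1)), D0 (fun v => P (v i) (v j))

/-- A ternary relation defined by a bounded formula. -/
def D0Pred₃ (P : M → M → M → Prop) : Prop :=
  ∀ (n : ℕ) (i j k : Fin (n + 1)), D0 (fun v => P (v i) (v j) (v k))

/-- A term is substituted by quantifying over a new variable that is bounded by the term and equal
to it. Definability of a predicate thus has to be checked on variables only. -/
theorem D0Pred.comp {P : M → Prop} (hP : D0Pred P) {n : ℕ} {t : (Fin (n + 1) → M) → M}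
    (ht : Poly t) : D0 (fun v => P (t v)) := by
  refine D0.of_iff (Q := fun v => ∃ x, x ≤ t v ∧ x = t v ∧ P x)
    (fun v => ⟨fun h => ⟨_, le_rfl, rfl, h⟩, by rintro ⟨x, _, rfl, h⟩; exact h⟩) ?_
  have := ht.weaken
  have := hP (n + 1) (Fin.last (n + 1))
  infer_instance

theorem D0Pred₂.comp {P : M → M → Prop} (hP : D0Pred₂ P) {n : ℕ} {t u : (Fin (n + 1) → M) → M}
    (ht : Poly t) (hu : Poly u) : D0 (fun v => P (t v) (u v)) := by
  refine D0.of_iff (Q := fun v => ∃ x, x ≤ t v ∧ ∃ y, y ≤ u v ∧ x = t v ∧ y = u v ∧ P x y)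
    (fun v => ⟨fun h => ⟨_, le_rfl, _, le_rfl, rfl, rfl, h⟩,
      by rintro ⟨x, _, y, _, rfl, rfl, h⟩; exact h⟩) ?_
  have := hu.weaken
  have := ht.weaken.weaken
  have := hu.weaken.weaken
  have := hP (n + 2) (Fin.last (n + 1)).castSucc (Fin.last (n + 2))
  infer_instance

theorem D0Pred₃.comp {P : M → M → M → Prop} (hP : D0Pred₃ P) {n : ℕ}
    {t u s : (Fin (n + 1) → M) → M} (ht : Poly t) (hu : Poly u) (hs : Poly s) :
    D0 (fun v => P (t v) (u v) (s v)) := by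
  refine D0.of_iff (Q := fun v => ∃ x, x ≤ t v ∧ ∃ y, y ≤ u v ∧ ∃ z, z ≤ s v ∧
      x = t v ∧ y = u v ∧ z = s v ∧ P x y z)
    (fun v => ⟨fun h => ⟨_, le_rfl, _, le_rfl, _, le_rfl, rfl, rfl, rfl, h⟩,
      by rintro ⟨x, _, y, _, z, _, rfl, rfl, rfl, h⟩; exact h⟩) ?_
  have := hu.weaken
  have := hs.weaken.weaken
  have := ht.weaken.weaken.weaken
  have := hu.weaken.weaken.weaken
  have := hs.weaken.weaken.weaken
  have := hP (n + 3) (Fin.last (n + 1)).castSucc.castSucc (Fin.last (n + 2)).castSucc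
    (Fin.last (n + 3))
  infer_instance

theorem D0Pred.not {P : M → Prop} (h : D0Pred P) : D0Pred (fun x => ¬ P x) :=
  fun n i => have := h n i; inferInstance

theorem D0Pred.induct {P : M → Prop} (hP : D0Pred P) (h0 : P 0) (hs : ∀ x, P x → P (x + 1))
    (x : M) : P x :=
  hmod.induct (hP 0 0) h0 (fun x h => by rw [succ_eq]; exact hs x h) x

theorem lt_add_one_iff' {x y : M} : x < y + 1 ↔ x ≤ y := by
  rw [lt_iff_succ_le, add_le_add_iff_right]

theorem D0Pred.strong {P : M → Prop} (hP : D0Pred P) (h : ∀ x, (∀ y, y < x → P y) → P x)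
    (x : M) : P x := by
  have : D0Pred (fun x => ∀ y, y < x → P y) := fun n i => by
    have := hP (n + 1) (Fin.last (n + 1))
    exact D0.all_lt (f := fun v => v i) (P := fun _ y => P y)
  refine h x (this.induct (fun y hy => absurd hy not_lt_zero) (fun x ih y hy => ?_) x)
  rcases (le_iff_lt_or_eq.1 (lt_add_one_iff'.1 hy)) with h1 | h1
  · exact ih y h1
  · exact h y (h1 ▸ ih)

theorem D0Pred.least {P : M → Prop} (hP : D0Pred P) (h : ∃ x, P x) :
    ∃ x, P x ∧ ∀ y, y < x → ¬ P y := by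
  by_contra hn
  push Not at hn
  obtain ⟨x, hx⟩ := h
  refine hP.not.strong (fun x ih hx => ?_) x hx
  obtain ⟨y, hy, hy'⟩ := hn x hx
  exact ih y hy hy'

/-- The least upper bound of the solutions is itself a solution, since otherwise its predecessor
would be an upper bound too. -/
theorem D0Pred.greatest {P : M → Prop} (hP : D0Pred P) (b : M) (hb : ∀ x, P x → x ≤ b)
    (h : ∃ x, P x) : ∃ x, P x ∧ ∀ y, P y → y ≤ x := by
  have h1 : D0Pred (fun z => ∀ y, y ≤ b → P y → y ≤ z) := fun n i => by
    have := hP (n + 1) (Fin.last (n + 1))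
    exact D0.all (f := fun v => b) (P := fun v y => P y → y ≤ v i)
  obtain ⟨z, hz, hm⟩ := h1.least ⟨b, fun y hy _ => hy⟩
  refine ⟨z, ?_, fun y hy => hz y (hb y hy) hy⟩
  by_contra hn
  by_cases hz0 : z = 0
  · obtain ⟨x, hx⟩ := h
    have := hz x (hb x hx) hx
    rw [hz0, nonpos_iff_eq_zero] at this
    rw [this, ← hz0] at hx
    exact hn hx
  · obtain ⟨w, rfl⟩ := exists_succ hz0
    refine hm w (lt_add_one w) (fun y hy hPy => ?_)
    have h2 := hz y hy hPy
    rcases h2.lt_or_eq with h3 | rfl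
    · exact lt_add_one_iff'.1 h3
    · exact absurd hPy hn

theorem exists_div (x : M) {u : M} (hu : 0 < u) : ∃ q r, r < u ∧ x = q * u + r := by
  have : D0Pred (fun x : M => ∃ q, q ≤ x ∧ ∃ r, r < u ∧ x = q * u + r) :=
    fun n i => inferInstance
  obtain ⟨q, _, r, h⟩ := this.induct ⟨0, le_rfl, 0, hu, by ring⟩ (fun x => by
    rintro ⟨q, hq, r, hr, hx⟩
    rcases (lt_iff_succ_le.1 hr).lt_or_eq with h | h
    · exact ⟨q, hq.trans le_self_add, r + 1, h, by rw [hx]; ring⟩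
    · exact ⟨q + 1, by gcongr, 0, hu, by rw [hx, ← h]; ring⟩) x
  exact ⟨q, r, h⟩

theorem div_unique {q r q' r' u : M} (hr : r < u) (hr' : r' < u)
    (h : q * u + r = q' * u + r') : q = q' ∧ r = r' := by
  have key : ∀ {q r q' r' : M}, r < u → r' < u → q * u + r = q' * u + r' → q ≤ q' := by
    intro q r q' r' hr hr' h
    by_contra hn
    obtain ⟨d, rfl⟩ := exists_add_of_le (lt_iff_succ_le.1 (not_le.1 hn))
    have h1 : r' = u + d * u + r := by
      apply add_left_cancel (a := q' * u)
      rw [← h]; ring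
    rw [h1, add_assoc] at hr'
    exact absurd hr' (not_lt.2 le_self_add)
  have hq := le_antisymm (key hr hr' h) (key hr' hr h.symm)
  subst hq
  exact ⟨rfl, add_left_cancel h⟩

theorem even_ne_odd {a b : M} : 2 * a ≠ 2 * b + 1 := by
  intro h
  have h2 : (1 : M) < 2 := by
    rw [← one_add_one_eq_two]
    exact lt_add_of_pos_right _ zero_lt_one
  have := (div_unique (q := a) (r := 0) (q' := b) (r' := 1) (u := 2) (zero_lt_one.trans h2) h2
    (by rw [add_zero, mul_comm, h, mul_comm])).2
  exact zero_ne_one this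

theorem even_or_odd (x : M) : ∃ y, x = 2 * y ∨ x = 2 * y + 1 := by
  obtain ⟨q, r, hr, rfl⟩ := exists_div x (u := 2) two_pos
  refine ⟨q, ?_⟩
  have hr : r ≤ 1 := lt_add_one_iff'.1 (by rwa [one_add_one_eq_two])
  rcases hr.lt_or_eq with h | h
  · have : r = 0 := by
      rw [← zero_add (1 : M), lt_add_one_iff'] at h
      exact nonpos_iff_eq_zero.1 h
    left; rw [this]; ring
  · right; rw [h]; ring

end Induction

/-! ### Powers of two -/

section PowersOfTwo

variable {M : Type*} [Model M]

theorem pow2_iff {u : M} : Pow2 u ↔ ∀ d e, u = d * e → d = 1 ∨ ∃ f, d = 2 * f := by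
  simp only [Pow2, num_two, num_one]

theorem Pow2.pos {u : M} (h : Pow2 u) : 0 < u := by
  rw [pos_iff_ne_zero]
  rintro rfl
  -- Zero is excluded by its divisor 3, which is neither 1 nor even.
  rcases pow2_iff.1 h (2 * 1 + 1) 0 (by ring) with h1 | ⟨f, h1⟩
  · have : (2 : M) * 1 = 0 := add_right_cancel (b := 1) (by rw [h1]; ring)
    simp at this
  · exact even_ne_odd h1.symm

theorem le_mul_of_pos {x y : M} (h : 0 < y) : x ≤ x * y :=
  le_mul_of_one_le_right zero_le (by rw [← zero_add (1 : M)]; exact lt_iff_succ_le.1 h)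

theorem le_mul_of_pos' {x y : M} (h : 0 < y) : x ≤ y * x := by
  rw [mul_comm]; exact le_mul_of_pos h

/-- Divisors are bounded by the number only if it is not zero, hence the extra clause in the bounded
form. -/
theorem d0_pow2 : D0Pred (Pow2 : M → Prop) := fun n i => by
  refine D0.of_iff (Q := fun v => ¬ v i = 0 ∧ ∀ d, d ≤ v i → ∀ e, e ≤ v i → v i = d * e →
    d = 1 ∨ ∃ f, f ≤ d ∧ d = 2 * f) (fun v => ?_) inferInstance
  constructor
  · intro h
    refine ⟨h.pos.ne', fun d _ e _ hde => ?_⟩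
    rcases pow2_iff.1 h d e hde with h1 | ⟨f, h1⟩
    · exact Or.inl h1
    · exact Or.inr ⟨f, by rw [h1, two_mul]; exact le_self_add, h1⟩
  · rintro ⟨h0, h⟩
    refine pow2_iff.2 fun d e hde => ?_
    have hd : d ≠ 0 := by rintro rfl; exact h0 (by rw [hde, zero_mul])
    have he : e ≠ 0 := by rintro rfl; exact h0 (by rw [hde, mul_zero])
    rcases h d (by rw [hde]; exact le_mul_of_pos (pos_iff_ne_zero.2 he)) e
      (by rw [hde]; exact le_mul_of_pos' (pos_iff_ne_zero.2 hd)) hde with h1 | ⟨f, _, h1⟩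
    · exact Or.inl h1
    · exact Or.inr ⟨f, h1⟩

instance D0.pow2 {n : ℕ} {t : (Fin (n + 1) → M) → M} [ht : Poly t] : D0 (fun v => Pow2 (t v)) :=
  d0_pow2.comp ht

theorem pow2_one : Pow2 (1 : M) := pow2_iff.2 fun d e h => by
  left
  have hd : d ≠ 0 := by rintro rfl; simp at h
  have he : e ≠ 0 := by rintro rfl; simp at h
  refine le_antisymm ?_ ?_
  · rw [h]; exact le_mul_of_pos (pos_iff_ne_zero.2 he)
  · rw [← zero_add (1 : M)]; exact lt_iff_succ_le.1 (pos_iff_ne_zero.2 hd)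

theorem two_cancel {a b : M} (h : 2 * a = 2 * b) : a = b := mul_left_cancel₀ two_ne_zero h

/-- An odd divisor of 2p has an even cofactor and therefore divides p. -/
theorem Pow2.double {p : M} (hp : Pow2 p) : Pow2 (2 * p) := pow2_iff.2 fun d e h => by
  obtain ⟨f, rfl | rfl⟩ := even_or_odd d
  · exact Or.inr ⟨f, rfl⟩
  · obtain ⟨g, rfl | rfl⟩ := even_or_odd e
    · exact pow2_iff.1 hp _ g (two_cancel (h.trans (by ring)))
    · exact absurd (h.trans (by ring : _ = 2 * (2 * f * g + f + g) + 1)) even_ne_odd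

theorem Pow2.left {p q : M} (h : Pow2 (p * q)) : Pow2 p := pow2_iff.2 fun d e hde =>
  pow2_iff.1 h d (e * q) (by rw [hde, mul_assoc])

theorem Pow2.right {p q : M} (h : Pow2 (p * q)) : Pow2 q := by
  rw [mul_comm] at h; exact h.left

theorem Pow2.half {p : M} (hp : Pow2 p) (h : p ≠ 1) : ∃ q, Pow2 q ∧ p = 2 * q := by
  rcases pow2_iff.1 hp p 1 (mul_one p).symm with h1 | ⟨q, rfl⟩
  · exact absurd h1 h
  · exact ⟨q, hp.right, rfl⟩

theorem lt_double {p : M} (h : 0 < p) : p < 2 * p := by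
  rw [two_mul]; exact lt_add_of_pos_left _ h

theorem Pow2.induct {P : M → Prop} (hP : D0Pred P) (h1 : P 1)
    (hs : ∀ p, Pow2 p → P p → P (2 * p)) {p : M} (hp : Pow2 p) : P p := by
  have : D0Pred (fun p => Pow2 p → P p) := fun n i => by
    have := hP n i
    infer_instance
  refine this.strong (fun p ih hp => ?_) p hp
  by_cases h : p = 1
  · rwa [h]
  · obtain ⟨q, hq, rfl⟩ := hp.half h
    exact hs q hq (ih q (lt_double hq.pos) hq)

theorem Pow2.mul {p q : M} (hp : Pow2 p) (hq : Pow2 q) : Pow2 (p * q) := by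
  refine Pow2.induct (P := fun q => Pow2 (p * q)) (fun n i => inferInstance) (by rwa [mul_one])
    (fun q _ h => ?_) hq
  rw [mul_left_comm]
  exact h.double

theorem Pow2.one_le {p : M} (hp : Pow2 p) : 1 ≤ p := by
  rw [← zero_add (1 : M)]; exact lt_iff_succ_le.1 hp.pos

/-- Both powers are halved until the smaller one is 1. -/
theorem Pow2.exists_mul {p q : M} (hp : Pow2 p) (hq : Pow2 q) (h : p ≤ q) :
    ∃ r, Pow2 r ∧ q = p * r := by
  have key : ∀ p, p ≤ q → Pow2 p → ∃ r, r ≤ q ∧ Pow2 r ∧ q = p * r := by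
    refine Pow2.induct (P := fun q => ∀ p, p ≤ q → Pow2 p → ∃ r, r ≤ q ∧ Pow2 r ∧ q = p * r)
      (fun n i => inferInstance) (fun p hp1 hp => ⟨1, le_rfl, pow2_one, ?_⟩)
      (fun q hq ih p hpq hp => ?_) hq
    · rw [mul_one]; exact (le_antisymm hp1 hp.one_le).symm
    · by_cases h1 : p = 1
      · exact ⟨2 * q, le_rfl, hq.double, by rw [h1, one_mul]⟩
      · obtain ⟨p, hp', rfl⟩ := hp.half h1
        obtain ⟨r, hr, h2, rfl⟩ := ih p (le_of_mul_le_mul_left hpq two_pos) hp'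
        exact ⟨r, hr.trans (lt_double hq.pos).le, h2, by ring⟩
  obtain ⟨r, _, hr⟩ := key p h hp
  exact ⟨r, hr⟩

theorem Pow2.exists_lt {p q : M} (hp : Pow2 p) (hq : Pow2 q) (h : p < q) :
    ∃ r, Pow2 r ∧ q = p * (2 * r) := by
  obtain ⟨r, hr, rfl⟩ := hp.exists_mul hq h.le
  obtain ⟨s, hs, rfl⟩ := hr.half (by rintro rfl; simp at h)
  exact ⟨s, hs, rfl⟩

theorem exists_pow2 {x : M} (hx : 0 < x) : ∃ p, Pow2 p ∧ p ≤ x ∧ x < 2 * p := by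
  obtain ⟨p, ⟨hp, hpx⟩, hm⟩ := D0Pred.greatest (P := fun p => Pow2 p ∧ p ≤ x)
    (fun n i => inferInstance) x (fun _ h => h.2)
    ⟨1, pow2_one, by rw [← zero_add (1 : M)]; exact lt_iff_succ_le.1 hx⟩
  refine ⟨p, hp, hpx, ?_⟩
  by_contra hn
  exact absurd (hm _ ⟨hp.double, not_lt.1 hn⟩) (not_le.2 (lt_double hp.pos))

theorem lt_pow2_self (x : M) : ∃ p, Pow2 p ∧ x < p ∧ p ≤ 2 * x + 1 := by
  rcases eq_or_ne x 0 with rfl | h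
  · exact ⟨1, pow2_one, zero_lt_one, by simp⟩
  · obtain ⟨p, hp, h1, h2⟩ := exists_pow2 (pos_iff_ne_zero.2 h)
    exact ⟨2 * p, hp.double, h2, (mul_le_mul_right h1 2).trans le_self_add⟩

end PowersOfTwo

/-! ### Binary digits and blocks -/

section Bits

variable {M : Type*} [Model M]

theorem bit_iff {u y : M} : Bit u y ↔ Pow2 u ∧ ∃ q r, r < u ∧ y = (2 * q + 1) * u + r := by
  simp only [Bit, num_two, num_one, less_iff]

theorem Bit.pow2 {u y : M} (h : Bit u y) : Pow2 u := h.1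

theorem Bit.le {u y : M} (h : Bit u y) : u ≤ y := by
  obtain ⟨_, q, r, _, rfl⟩ := bit_iff.1 h
  calc u = 1 * u := (one_mul u).symm
    _ ≤ (2 * q + 1) * u := by gcongr; exact le_add_self
    _ ≤ _ := le_self_add

theorem d0_bit : D0Pred₂ (Bit : M → M → Prop) := fun n i j => by
  refine D0.of_iff (Q := fun v => Pow2 (v i) ∧ ∃ q, q ≤ v j ∧ ∃ r, r ≤ v j ∧ r < v i ∧
    v j = (2 * q + 1) * v i + r) (fun v => ?_) inferInstance
  rw [bit_iff]
  refine and_congr_right fun hp => ⟨?_, ?_⟩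
  · rintro ⟨q, r, hr, h⟩
    refine ⟨q, ?_, r, ?_, hr, h⟩
    · rw [h]
      refine le_trans ?_ le_self_add
      refine le_trans ?_ (le_mul_of_pos hp.pos)
      rw [two_mul, add_assoc]
      exact le_self_add
    · rw [h]; exact le_add_self
  · rintro ⟨q, _, r, _, h⟩
    exact ⟨q, r, h⟩

instance D0.bit {n : ℕ} {t u : (Fin (n + 1) → M) → M} [ht : Poly t] [hu : Poly u] :
    D0 (fun v => Bit (t v) (u v)) := d0_bit.comp ht hu

/-- With t = w·2s, the part A·t adds the even number A·2s to the quotient by w, so the parity that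
decides the digit does not change. -/
theorem bit_low {t A L w : M} (ht : Pow2 t) (hw : w < t) : Bit w (A * t + L) ↔ Bit w L := by
  simp only [bit_iff]
  refine and_congr_right fun hp => ?_
  obtain ⟨s, hs, rfl⟩ := hp.exists_lt ht hw
  constructor
  · rintro ⟨q, r, hr, h⟩
    obtain ⟨q1, r1, hr1, rfl⟩ := exists_div L hp.pos
    obtain ⟨h1, rfl⟩ := div_unique hr1 hr (q := A * (2 * s) + q1)
      (by rw [← h]; ring)
    obtain ⟨q2, rfl | rfl⟩ := even_or_odd q1
    · exact absurd ((by ring : _ = A * (2 * s) + 2 * q2).trans h1) (even_ne_odd (a := A * s + q2))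
    · exact ⟨q2, r1, hr1, rfl⟩
  · rintro ⟨q, r, hr, rfl⟩
    exact ⟨A * s + q, r, hr, by ring⟩

theorem add_lt_mul {a b r u : M} (hr : r < u) (h : a < b) : a * u + r < b * u := by
  calc a * u + r < a * u + u := by gcongr
    _ = (a + 1) * u := by ring
    _ ≤ b * u := by gcongr; exact lt_iff_succ_le.1 h

theorem bit_high {t A L w : M} (ht : Pow2 t) (hL : L < t) :
    Bit (t * w) (A * t + L) ↔ Bit w A := by
  simp only [bit_iff]
  constructor
  · rintro ⟨hp, q, r, hr, h⟩
    refine ⟨hp.right, ?_⟩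
    obtain ⟨r1, r0, hr0, rfl⟩ := exists_div r ht.pos
    obtain ⟨h1, rfl⟩ := div_unique hL hr0 (q' := (2 * q + 1) * w + r1) (by rw [h]; ring)
    refine ⟨q, r1, ?_, h1⟩
    by_contra hn
    refine absurd hr (not_lt.2 ?_)
    calc t * w ≤ r1 * t := by rw [mul_comm]; gcongr; exact not_lt.1 hn
      _ ≤ _ := le_self_add
  · rintro ⟨hp, q, r, hr, rfl⟩
    refine ⟨ht.mul hp, q, r * t + L, ?_, by ring⟩
    rw [mul_comm t w]
    exact add_lt_mul hL hr

theorem bit_mul_add {t A L w : M} (ht : Pow2 t) (hL : L < t) :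
    Bit w (A * t + L) ↔ (w < t ∧ Bit w L) ∨ ∃ w', w = t * w' ∧ Bit w' A := by
  constructor
  · intro h
    rcases lt_or_ge w t with h1 | h1
    · exact Or.inl ⟨h1, (bit_low ht h1).1 h⟩
    · obtain ⟨s, hs, rfl⟩ := ht.exists_mul h.pow2 h1
      exact Or.inr ⟨s, rfl, (bit_high ht hL).1 h⟩
  · rintro (⟨h1, h⟩ | ⟨w', rfl, h⟩)
    · exact (bit_low ht h1).2 h
    · exact (bit_high ht hL).2 h

theorem bit_self {p : M} (hp : Pow2 p) : Bit p p :=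
  bit_iff.2 ⟨hp, 0, 0, hp.pos, by ring⟩

theorem bit_pow2 {w p : M} (hp : Pow2 p) (h : Bit w p) : w = p := by
  obtain ⟨s, hs, rfl⟩ := h.pow2.exists_mul hp h.le
  obtain ⟨hw, q, r, hr, h1⟩ := bit_iff.1 h
  obtain ⟨h2, _⟩ := div_unique hw.pos hr (q := s) (r := 0) (by rw [← h1]; ring)
  by_contra hn
  obtain ⟨t, _, rfl⟩ := hs.half (by rintro rfl; simp at hn)
  exact even_ne_odd h2

theorem block_iff {X u v a : M} :
    Block X u v a ↔ ∃ h r, r < u ∧ a * u + r < v ∧ X = h * v + (a * u + r) := by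
  simp only [Block, less_iff]

theorem block_low {t A L u v a : M} (ht : Pow2 t) (hv : Pow2 v) (h : v ≤ t) :
    Block (A * t + L) u v a ↔ Block L u v a := by
  obtain ⟨s, hs, rfl⟩ := hv.exists_mul ht h
  simp only [block_iff]
  constructor
  · rintro ⟨h, r, hr, hv', he⟩
    obtain ⟨q, r', hr', rfl⟩ := exists_div L hv.pos
    obtain ⟨h1, rfl⟩ := div_unique hr' hv' (q := A * s + q) (by rw [← he]; ring)
    exact ⟨q, r, hr, hv', rfl⟩
  · rintro ⟨h, r, hr, hv', rfl⟩
    exact ⟨A * s + h, r, hr, hv', by ring⟩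

theorem lt_of_mul_add_lt {a v u r : M} (h : a * u + r < v * u) : a < v := by
  by_contra hn
  refine absurd h (not_lt.2 ?_)
  calc v * u ≤ a * u := by gcongr; exact not_lt.1 hn
    _ ≤ _ := le_self_add

theorem block_high {t A L u v a : M} (hL : L < t) :
    Block (A * t + L) (t * u) (t * v) a ↔ Block A u v a := by
  have ht : 0 < t := pos_of_gt hL
  simp only [block_iff]
  constructor
  · rintro ⟨h, r, hr, hv', he⟩
    obtain ⟨r1, r0, hr0, rfl⟩ := exists_div r ht
    obtain ⟨h1, rfl⟩ := div_unique hL hr0 (q' := h * v + (a * u + r1)) (by rw [he]; ring)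
    refine ⟨h, r1, ?_, ?_, h1⟩
    · rw [mul_comm t u] at hr
      exact lt_of_mul_add_lt hr
    · rw [mul_comm t v, show a * (t * u) + (r1 * t + L) = (a * u + r1) * t + L by ring] at hv'
      exact lt_of_mul_add_lt hv'
  · rintro ⟨h, r, hr, hv', rfl⟩
    refine ⟨h, r * t + L, ?_, ?_, by ring⟩
    · rw [mul_comm t u]; exact add_lt_mul hL hr
    · rw [mul_comm t v, show a * (t * u) + (r * t + L) = (a * u + r) * t + L by ring]
      exact add_lt_mul hL hv'

theorem Block.unique {X u v a b : M} (ha : Block X u v a) (hb : Block X u v b) : a = b := by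
  obtain ⟨h, r, hr, hv, rfl⟩ := block_iff.1 ha
  obtain ⟨h', r', hr', hv', he⟩ := block_iff.1 hb
  exact (div_unique hr hr' (div_unique hv hv' he).2).1

theorem exists_block (X : M) {u v : M} (hu : 0 < u) (hv : 0 < v) : ∃ a, Block X u v a := by
  obtain ⟨h, s, hs, rfl⟩ := exists_div X hv
  obtain ⟨a, r, hr, rfl⟩ := exists_div s hu
  exact ⟨a, block_iff.2 ⟨h, r, hr, hs, rfl⟩⟩

theorem Block.mul_le {X u v a : M} (h : Block X u v a) : a * u ≤ X := by
  obtain ⟨h, r, hr, hv, rfl⟩ := block_iff.1 h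
  exact le_self_add.trans le_add_self

theorem Block.mul_lt {X u v a : M} (h : Block X u v a) : a * u < v := by
  obtain ⟨h, r, hr, hv, rfl⟩ := block_iff.1 h
  exact le_self_add.trans_lt hv

end Bits

/-! ### Marked words and their concatenation -/

section Chains

variable {M : Type*} [Model M]

theorem entry_iff {X Y u v a : M} : Entry X Y u v a ↔
    Bit u Y ∧ Bit v Y ∧ u < v ∧ (∀ w, Bit w Y → u < w → v ≤ w) ∧ Block X u v a := by
  simp only [Entry, less_iff, not_and, not_lt]

/-- A word `X` with marks `Y` between `1` and `t`. -/
structure Chain (X Y t : M) : Prop where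
  pow2 : Pow2 t
  lt : X < t
  one : Bit 1 Y
  top : ∃ Z, Z < t ∧ Y = t + Z

namespace Chain

variable {X Y t : M}

theorem bit_top (h : Chain X Y t) : Bit t Y := by
  obtain ⟨Z, hZ, rfl⟩ := h.top
  have := (bit_mul_add (w := t) (A := 1) h.pow2 hZ).2 (Or.inr ⟨1, (mul_one t).symm, bit_self pow2_one⟩)
  rwa [one_mul] at this

theorem le_top (h : Chain X Y t) {w : M} (hw : Bit w Y) : w ≤ t := by
  obtain ⟨Z, hZ, rfl⟩ := h.top
  rw [← one_mul t] at hw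
  rcases (bit_mul_add h.pow2 hZ).1 hw with ⟨h1, _⟩ | ⟨w', rfl, h1⟩
  · exact h1.le
  · rw [bit_pow2 pow2_one h1, mul_one]

/-- Concatenation of marked words. -/
theorem append {X₁ Y₁ t₁ X₂ Y₂ t₂ : M} (h₁ : Chain X₁ (t₁ + Y₁) t₁) (hY : Y₁ < t₁)
    (h₂ : Chain X₂ Y₂ t₂) :
    Chain (X₂ * t₁ + X₁) (Y₂ * t₁ + Y₁) (t₁ * t₂) := by
  refine ⟨h₁.pow2.mul h₂.pow2, ?_, ?_, ?_⟩
  · rw [mul_comm t₁]; exact add_lt_mul h₁.lt h₂.lt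
  -- If the first word is empty, the lowest mark is that of the second word; otherwise it is found
  -- among the low digits.
  · by_cases h : t₁ = 1
    · subst h
      have : Y₁ = 0 := nonpos_iff_eq_zero.1 (lt_add_one_iff'.1 (by rwa [zero_add]))
      rw [this, mul_one, add_zero]
      exact h₂.one
    · have h1 : 1 < t₁ := lt_of_le_of_ne h₁.pow2.one_le (Ne.symm h)
      refine (bit_low h₁.pow2 h1).2 ?_
      have := h₁.one
      rwa [← one_mul t₁, bit_low h₁.pow2 h1] at this
  · obtain ⟨Z, hZ, rfl⟩ := h₂.top
    exact ⟨Z * t₁ + Y₁, by rw [mul_comm t₁]; exact add_lt_mul hY hZ, by ring⟩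

/-- The mark at t₁ ends the first word and begins the second, but is stored once: the first word
contributes only Y₁, and the digit at t₁ comes from the lowest mark of Y₂. -/
theorem bit_append {Y₁ t₁ Y₂ w : M} (ht : Pow2 t₁) (hY : Y₁ < t₁) (h2 : Bit 1 Y₂) :
    Bit w (Y₂ * t₁ + Y₁) ↔ (w ≤ t₁ ∧ Bit w (t₁ + Y₁)) ∨ ∃ w', w = t₁ * w' ∧ Bit w' Y₂ := by
  rw [bit_mul_add ht hY]
  constructor
  · rintro (⟨h, h'⟩ | h)
    · refine Or.inl ⟨h.le, ?_⟩
      rw [← one_mul t₁]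
      exact (bit_low ht h).2 h'
    · exact Or.inr h
  · rintro (⟨h, h'⟩ | h)
    · rcases h.lt_or_eq with h1 | rfl
      · rw [← one_mul t₁, bit_low ht h1] at h'
        exact Or.inl ⟨h1, h'⟩
      · exact Or.inr ⟨1, (mul_one _).symm, h2⟩
    · exact Or.inr h

/-- As t₁ is itself a mark, consecutive marks never lie strictly on both sides of it, so no block
straddles the joint. -/
theorem entry_append {X₁ Y₁ t₁ X₂ Y₂ t₂ u v a : M} (h₁ : Chain X₁ (t₁ + Y₁) t₁) (hY : Y₁ < t₁)
    (h₂ : Chain X₂ Y₂ t₂) :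
    Entry (X₂ * t₁ + X₁) (Y₂ * t₁ + Y₁) u v a ↔
      Entry X₁ (t₁ + Y₁) u v a ∨ ∃ u' v', u = t₁ * u' ∧ v = t₁ * v' ∧ Entry X₂ Y₂ u' v' a := by
  have hb : ∀ {w}, Bit w (Y₂ * t₁ + Y₁) ↔
      (w ≤ t₁ ∧ Bit w (t₁ + Y₁)) ∨ ∃ w', w = t₁ * w' ∧ Bit w' Y₂ :=
    bit_append h₁.pow2 hY h₂.one
  have ht := h₁.pow2.pos
  have htop : Bit t₁ (Y₂ * t₁ + Y₁) := hb.2 (Or.inr ⟨1, (mul_one _).symm, h₂.one⟩)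
  simp only [entry_iff]
  constructor
  · rintro ⟨hu, hv, huv, hc, hB⟩
    rcases lt_or_ge u t₁ with h | h
    · left
      have hvt := hc _ htop h
      have hu' : Bit u (t₁ + Y₁) := by
        rcases hb.1 hu with h1 | ⟨w', rfl, h1⟩
        · exact h1.2
        · exact absurd h (not_lt.2 (le_mul_of_pos h1.pow2.pos))
      have hv' : Bit v (t₁ + Y₁) := by
        rcases hvt.lt_or_eq with h' | rfl
        · rcases hb.1 hv with h1 | ⟨w', rfl, h1⟩
          · exact h1.2
          · exact absurd h' (not_lt.2 (le_mul_of_pos h1.pow2.pos))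
        · exact h₁.bit_top
      exact ⟨hu', hv', huv, fun w hw huw => hc w (hb.2 (Or.inl ⟨h₁.le_top hw, hw⟩)) huw,
        (block_low h₁.pow2 hv.pow2 hvt).1 hB⟩
    · right
      have hge : ∀ {w}, Bit w (Y₂ * t₁ + Y₁) → t₁ ≤ w → ∃ w', w = t₁ * w' ∧ Bit w' Y₂ := by
        intro w hw hle
        rcases hb.1 hw with h1 | h1
        · exact ⟨1, by rw [mul_one]; exact le_antisymm h1.1 hle, h₂.one⟩
        · exact h1
      obtain ⟨u', rfl, hu'⟩ := hge hu h
      obtain ⟨v', rfl, hv'⟩ := hge hv (h.trans huv.le)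
      refine ⟨u', v', rfl, rfl, hu', hv', lt_of_mul_lt_mul_left huv zero_le, fun w hw huw => ?_,
        (block_high h₁.lt).1 hB⟩
      exact le_of_mul_le_mul_left
        (hc (t₁ * w) (hb.2 (Or.inr ⟨w, rfl, hw⟩)) (mul_lt_mul_of_pos_left huw ht)) ht
  · rintro (⟨hu, hv, huv, hc, hB⟩ | ⟨u', v', rfl, rfl, hu, hv, huv, hc, hB⟩)
    · have hvt := h₁.le_top hv
      refine ⟨hb.2 (Or.inl ⟨huv.le.trans hvt, hu⟩), hb.2 (Or.inl ⟨hvt, hv⟩), huv,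
        fun w hw huw => ?_, (block_low h₁.pow2 hv.pow2 hvt).2 hB⟩
      rcases hb.1 hw with h1 | ⟨w', rfl, h1⟩
      · exact hc w h1.2 huw
      · exact hvt.trans (le_mul_of_pos h1.pow2.pos)
    · refine ⟨hb.2 (Or.inr ⟨u', rfl, hu⟩), hb.2 (Or.inr ⟨v', rfl, hv⟩),
        mul_lt_mul_of_pos_left huv ht, fun w hw huw => ?_, (block_high h₁.lt).2 hB⟩
      have hlt : t₁ ≤ t₁ * u' := le_mul_of_pos hu.pow2.pos
      rcases hb.1 hw with h1 | ⟨w', rfl, h1⟩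
      · exact absurd (hlt.trans_lt huw) (not_lt.2 h1.1)
      · gcongr
        exact hc w' h1 (lt_of_mul_lt_mul_left huw zero_le)

/-- Splitting a marked word at a mark. -/
theorem split (h : Chain X Y t) {u : M} (hu : Bit u Y) :
    ∃ X₁ Y₁ X₂ Y₂ t₂, Chain X₁ (u + Y₁) u ∧ Y₁ < u ∧ Chain X₂ Y₂ t₂ ∧
      X = X₂ * u + X₁ ∧ Y = Y₂ * u + Y₁ ∧ t = u * t₂ := by
  have hp := hu.pow2
  obtain ⟨t₂, ht₂, rfl⟩ := hp.exists_mul h.pow2 (h.le_top hu)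
  obtain ⟨X₂, X₁, hX₁, rfl⟩ := exists_div X hp.pos
  obtain ⟨Z, hZ, rfl⟩ := h.top
  obtain ⟨Z₂, Y₁, hY₁, rfl⟩ := exists_div Z hp.pos
  have e : u * t₂ + (Z₂ * u + Y₁) = (t₂ + Z₂) * u + Y₁ := by ring
  have h1 := h.one
  have h2 := h.lt
  rw [e] at hu h1
  have hb1 : Bit 1 (t₂ + Z₂) := by
    rw [← mul_one u] at hu
    nth_rewrite 2 [mul_one] at hu
    exact (bit_high hp hY₁).1 hu
  refine ⟨X₁, Y₁, X₂, t₂ + Z₂, t₂, ⟨hp, hX₁, ?_, Y₁, hY₁, rfl⟩, hY₁,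
    ⟨ht₂, ?_, hb1, Z₂, ?_, rfl⟩, rfl, e, rfl⟩
  · by_cases hu1 : u = 1
    · subst hu1
      have : Y₁ = 0 := nonpos_iff_eq_zero.1 (lt_add_one_iff'.1 (by rwa [zero_add]))
      rw [this, add_zero]
      exact bit_self pow2_one
    · have h1u : 1 < u := lt_of_le_of_ne hp.one_le (Ne.symm hu1)
      have := (bit_low hp h1u).1 h1
      rw [← one_mul u]
      exact (bit_low hp h1u).2 this
  · rw [mul_comm u] at h2; exact lt_of_mul_add_lt h2
  · rw [mul_comm u] at hZ; exact lt_of_mul_add_lt hZ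

/-- The marked word with a single block. -/
theorem single {x q : M} (hq : Pow2 q) (h : x < q) (hq1 : 1 < q) : Chain x (q + 1) q := by
  refine ⟨hq, h, ?_, 1, hq1, rfl⟩
  rw [← one_mul q]
  exact (bit_low hq hq1).2 (bit_self pow2_one)

theorem entry_single {x q u v a : M} (hq : Pow2 q) (h : x < q) (hq1 : 1 < q) :
    Entry x (q + 1) u v a ↔ u = 1 ∧ v = q ∧ a = x := by
  have hc := single hq h hq1
  have hb : ∀ {w}, Bit w (q + 1) ↔ w = 1 ∨ w = q := by
    intro w
    constructor
    · intro hw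
      rcases (hc.le_top hw).lt_or_eq with h1 | h1
      · rw [← one_mul q] at hw
        exact Or.inl (bit_pow2 pow2_one ((bit_low hq h1).1 hw))
      · exact Or.inr h1
    · rintro (rfl | rfl)
      · exact hc.one
      · exact hc.bit_top
  have hB : Block x 1 q x := block_iff.2 ⟨0, 0, zero_lt_one, by simpa using h, by simp⟩
  rw [entry_iff]
  constructor
  · rintro ⟨hu, hv, huv, _, hB'⟩
    rcases hb.1 hu with rfl | rfl
    · rcases hb.1 hv with rfl | rfl
      · exact absurd huv (lt_irrefl _)
      · exact ⟨rfl, rfl, hB'.unique hB⟩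
    · exact absurd (hc.le_top hv) (not_le.2 huv)
  · rintro ⟨rfl, rfl, rfl⟩
    refine ⟨hc.one, hc.bit_top, hq1, fun w hw h1 => ?_, hB⟩
    rcases hb.1 hw with rfl | rfl
    · exact absurd h1 (lt_irrefl _)
    · exact le_rfl

end Chain

end Chains

/-! ### Codes of finite sets -/

section SetCodes

variable {M : Type*} [Model M]

/-- A relation between five elements defined by a bounded formula. -/
def D0Pred₅ (P : M → M → M → M → M → Prop) : Prop :=
  ∀ (n : ℕ) (i j k l m : Fin (n + 1)), D0 (fun v => P (v i) (v j) (v k) (v l) (v m))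

theorem D0Pred₅.comp {P : M → M → M → M → M → Prop} (hP : D0Pred₅ P) {n : ℕ}
    {t₁ t₂ t₃ t₄ t₅ : (Fin (n + 1) → M) → M} (h₁ : Poly t₁) (h₂ : Poly t₂) (h₃ : Poly t₃)
    (h₄ : Poly t₄) (h₅ : Poly t₅) : D0 (fun v => P (t₁ v) (t₂ v) (t₃ v) (t₄ v) (t₅ v)) := by
  have aux : ∀ (m : ℕ) {a b : (Fin (m + 1) → M) → M} (_ : Poly a) (_ : Poly b) (i j k : Fin (m + 1)),
      D0 (fun v => P (v i) (v j) (v k) (a v) (b v)) := by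
    intro m a b ha hb i j k
    refine D0.of_iff (Q := fun v => ∃ x, x ≤ a v ∧ ∃ y, y ≤ b v ∧ x = a v ∧ y = b v ∧
      P (v i) (v j) (v k) x y) (fun v => ⟨fun h => ⟨_, le_rfl, _, le_rfl, rfl, rfl, h⟩,
        by rintro ⟨x, _, y, _, rfl, rfl, h⟩; exact h⟩) ?_
    have := hb.weaken
    have := ha.weaken.weaken
    have := hb.weaken.weaken
    have := hP (m + 2) i.castSucc.castSucc j.castSucc.castSucc k.castSucc.castSucc
      (Fin.last (m + 1)).castSucc (Fin.last (m + 2))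
    infer_instance
  refine D0.of_iff (Q := fun v => ∃ x, x ≤ t₁ v ∧ ∃ y, y ≤ t₂ v ∧ ∃ z, z ≤ t₃ v ∧
      x = t₁ v ∧ y = t₂ v ∧ z = t₃ v ∧ P x y z (t₄ v) (t₅ v))
    (fun v => ⟨fun h => ⟨_, le_rfl, _, le_rfl, _, le_rfl, rfl, rfl, rfl, h⟩,
      by rintro ⟨x, _, y, _, z, _, rfl, rfl, rfl, h⟩; exact h⟩) ?_
  have := h₂.weaken
  have := h₃.weaken.weaken
  have := h₁.weaken.weaken.weaken
  have := h₂.weaken.weaken.weaken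
  have := h₃.weaken.weaken.weaken
  have := aux (n + 3) h₄.weaken.weaken.weaken h₅.weaken.weaken.weaken
    (Fin.last (n + 1)).castSucc.castSucc (Fin.last (n + 2)).castSucc (Fin.last (n + 3))
  infer_instance

theorem le_pair_left (x y : M) : x ≤ pair x y := le_add_self

theorem self_le_mul_self (x : M) : x ≤ x * x := by
  rcases eq_or_ne x 0 with rfl | h
  · exact zero_le
  · exact le_mul_of_pos (pos_iff_ne_zero.2 h)

theorem le_pair_right (x y : M) : y ≤ pair x y :=
  (le_add_self.trans (self_le_mul_self (x + y))).trans le_self_add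

theorem mul_self_le_pair (x y : M) : y * y ≤ pair x y :=
  (mul_le_mul' le_add_self le_add_self).trans le_self_add

theorem pair_mono {x y x' y' : M} (h : x ≤ x') (h' : y ≤ y') : pair x y ≤ pair x' y' := by
  unfold pair
  gcongr

/-- Since (x+y)² + x lies below (x+y+1)², the code determines the sum, and then both components. -/
theorem pair_inj {x y x' y' : M} : pair x y = pair x' y' ↔ x = x' ∧ y = y' := by
  constructor
  · intro h
    have key : ∀ {x y x' y' : M}, x + y < x' + y' → pair x y < pair x' y' := by
      intro x y x' y' h
      unfold pair
      obtain ⟨d, hd⟩ := exists_add_of_le (lt_iff_succ_le.1 h)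
      rw [hd]
      have := Diff.coe_nonneg x
      have := Diff.coe_nonneg y
      have := Diff.coe_nonneg d
      have := Diff.coe_nonneg x'
      simp only [diff_lt, push_cast]
      nlinarith [mul_nonneg (Diff.coe_nonneg x) (Diff.coe_nonneg d),
        mul_nonneg (Diff.coe_nonneg y) (Diff.coe_nonneg d),
        mul_nonneg (Diff.coe_nonneg d) (Diff.coe_nonneg d)]
    have hs : x + y = x' + y' := by
      rcases lt_trichotomy (x + y) (x' + y') with h1 | h1 | h1
      · exact absurd h (key h1).ne
      · exact h1
      · exact absurd h (key h1).ne'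
    unfold pair at h
    rw [hs] at h
    have hx := add_left_cancel h
    subst hx
    exact ⟨rfl, add_left_cancel hs⟩
  · rintro ⟨rfl, rfl⟩
    rfl

instance Poly.pair {n : ℕ} {t u : (Fin (n + 1) → M) → M} [Poly t] [Poly u] :
    Poly (fun v => pair (t v) (u v)) := by
  unfold BA.pair; infer_instance

theorem Entry.le {X Y u v a : M} (h : Entry X Y u v a) : u ≤ Y ∧ v ≤ Y ∧ a ≤ X := by
  obtain ⟨hu, hv, _, _, hB⟩ := entry_iff.1 h
  exact ⟨hu.le, hv.le, (le_mul_of_pos hu.pow2.pos).trans hB.mul_le⟩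

theorem d0_entry : D0Pred₅ (Entry : M → M → M → M → M → Prop) := fun n i j k l m => by
  refine D0.of_iff (Q := fun e => Bit (e k) (e j) ∧ Bit (e l) (e j) ∧ e k < e l ∧
    (∀ w, w ≤ e j → Bit w (e j) → e k < w → e l ≤ w) ∧ ∃ h, h ≤ e i ∧ ∃ r, r ≤ e k ∧
      r < e k ∧ e m * e k + r < e l ∧ e i = h * e l + (e m * e k + r)) (fun v => ?_) inferInstance
  rw [entry_iff, block_iff]
  refine and_congr_right fun hu => and_congr_right fun hv => and_congr_right fun huv =>
    and_congr (forall_congr' fun w => ⟨fun h _ => h, fun h hw => h hw.le hw⟩) ?_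
  constructor
  · rintro ⟨h, r, hr, h1, h2⟩
    exact ⟨h, by rw [h2]; exact (le_mul_of_pos hv.pow2.pos).trans le_self_add, r, hr.le, hr, h1, h2⟩
  · rintro ⟨h, _, r, _, h1⟩
    exact ⟨h, r, h1⟩

instance D0.entry {n : ℕ} {t₁ t₂ t₃ t₄ t₅ : (Fin (n + 1) → M) → M} [h₁ : Poly t₁] [h₂ : Poly t₂]
    [h₃ : Poly t₃] [h₄ : Poly t₄] [h₅ : Poly t₅] :
    D0 (fun v => Entry (t₁ v) (t₂ v) (t₃ v) (t₄ v) (t₅ v)) := d0_entry.comp h₁ h₂ h₃ h₄ h₅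

theorem d0_mem : D0Pred₂ (Mem : M → M → Prop) := fun n i j => by
  refine D0.of_iff (Q := fun e => ∃ X, X ≤ e j ∧ ∃ Y, Y ≤ e j ∧ ∃ u, u ≤ Y ∧ ∃ v, v ≤ Y ∧
    e j = BA.pair X Y ∧ Entry X Y u v (e i)) (fun v => ?_) inferInstance
  constructor
  · rintro ⟨X, Y, u, w, h1, h2⟩
    exact ⟨X, by rw [h1]; exact le_pair_left _ _, Y, by rw [h1]; exact le_pair_right _ _, u,
      h2.le.1, w, h2.le.2.1, h1, h2⟩
  · rintro ⟨X, _, Y, _, u, _, w, _, h1, h2⟩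
    exact ⟨X, Y, u, w, h1, h2⟩

instance D0.mem {n : ℕ} {t u : (Fin (n + 1) → M) → M} [ht : Poly t] [hu : Poly u] :
    D0 (fun v => Mem (t v) (u v)) := d0_mem.comp ht hu

theorem mem_pair {X Y a : M} : Mem a (pair X Y) ↔ ∃ u v, Entry X Y u v a := by
  constructor
  · rintro ⟨X', Y', u, v, h1, h2⟩
    obtain ⟨rfl, rfl⟩ := pair_inj.1 h1
    exact ⟨u, v, h2⟩
  · rintro ⟨u, v, h⟩
    exact ⟨X, Y, u, v, rfl, h⟩

theorem Mem.le {a c : M} (h : Mem a c) : a ≤ c := by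
  obtain ⟨X, Y, u, v, rfl, h⟩ := h
  exact h.le.2.2.trans (le_pair_left _ _)

theorem Entry.right_unique {X Y u v v' a a' : M} (h : Entry X Y u v a) (h' : Entry X Y u v' a') :
    v = v' ∧ a = a' := by
  obtain ⟨_, hv, huv, hc, hB⟩ := entry_iff.1 h
  obtain ⟨_, hv', huv', hc', hB'⟩ := entry_iff.1 h'
  have := le_antisymm (hc _ hv' huv') (hc' _ hv huv)
  subst this
  exact ⟨rfl, hB.unique hB'⟩

theorem Entry.lt {X Y u v a : M} (h : Entry X Y u v a) : u < v := (entry_iff.1 h).2.2.1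

theorem Entry.le_of_lt {X Y u v a w : M} (h : Entry X Y u v a) (hw : Bit w Y) (hwv : w < v) :
    w ≤ u := by
  by_contra hn
  exact absurd ((entry_iff.1 h).2.2.2.1 w hw (not_le.1 hn)) (not_le.2 hwv)

theorem Entry.left_unique {X Y u u' v a a' : M} (h : Entry X Y u v a) (h' : Entry X Y u' v a') :
    u = u' ∧ a = a' := by
  have h1 := h.le_of_lt h'.1 h'.lt
  have h2 := h'.le_of_lt h.1 h.lt
  have := le_antisymm h1 h2
  subst this
  exact ⟨rfl, (h.right_unique h').2⟩

/-- A marked word that represents a finite set. -/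
structure SetChain (X Y t : M) : Prop extends Chain X Y t where
  full : ∀ u v a, Entry X Y u v a → v ≤ 2 * (a * u)
  incr : ∀ u v w a b, Entry X Y u v a → Entry X Y v w b → a < b

theorem isSetCode_iff {c : M} : IsSetCode c ↔ ∃ X Y t, c = pair X Y ∧ SetChain X Y t := by
  simp only [IsSetCode, num_one, num_two, less_iff]
  constructor
  · rintro ⟨X, Y, rfl, h1, ⟨t, ht, hX, hY⟩, hf, hi⟩
    obtain ⟨Z, rfl⟩ := exists_add_of_le ht.le
    rw [two_mul] at hY
    exact ⟨X, t + Z, t, rfl, ⟨ht.pow2, hX, h1, Z, lt_of_add_lt_add_left hY, rfl⟩, hf, hi⟩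
  · rintro ⟨X, Y, t, rfl, h, hf, hi⟩
    refine ⟨X, Y, rfl, h.one, ⟨t, h.bit_top, h.lt, ?_⟩, hf, hi⟩
    obtain ⟨Z, hZ, rfl⟩ := h.top
    rw [two_mul]
    gcongr

theorem d0_isSetCode : D0Pred (IsSetCode : M → Prop) := fun n i => by
  refine D0.of_iff (Q := fun e => ∃ X, X ≤ e i ∧ ∃ Y, Y ≤ e i ∧ e i = BA.pair X Y ∧ Bit 1 Y ∧
    (∃ t, t ≤ Y ∧ Bit t Y ∧ X < t ∧ Y < 2 * t) ∧
    (∀ u, u ≤ Y → ∀ v, v ≤ Y → ∀ a, a ≤ X → Entry X Y u v a → v ≤ 2 * (a * u)) ∧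
    (∀ u, u ≤ Y → ∀ v, v ≤ Y → ∀ w, w ≤ Y → ∀ a, a ≤ X → ∀ b, b ≤ X → Entry X Y u v a →
      Entry X Y v w b → a < b)) (fun v => ?_) inferInstance
  simp only [IsSetCode, num_one, num_two, less_iff]
  constructor
  · rintro ⟨X, Y, h, h1, ⟨t, ht, h2⟩, hf, hi⟩
    exact ⟨X, by rw [h]; exact le_pair_left _ _, Y, by rw [h]; exact le_pair_right _ _, h, h1,
      ⟨t, ht.le, ht, h2⟩, fun u _ v _ a _ => hf u v a, fun u _ v _ w _ a _ b _ => hi u v w a b⟩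
  · rintro ⟨X, _, Y, _, h, h1, ⟨t, _, ht⟩, hf, hi⟩
    exact ⟨X, Y, h, h1, ⟨t, ht⟩, fun u v a he => hf u he.le.1 v he.le.2.1 a he.le.2.2 he,
      fun u v w a b he he' => hi u he.le.1 v he.le.2.1 w he'.le.2.1 a he.le.2.2 b he'.le.2.2 he he'⟩

instance D0.isSetCode {n : ℕ} {t : (Fin (n + 1) → M) → M} [ht : Poly t] :
    D0 (fun v => IsSetCode (t v)) := d0_isSetCode.comp ht

namespace Chain

variable {X Y t : M}

theorem exists_next (_ : Chain X Y t) {u w : M} (hu : Bit u Y) (hw : Bit w Y) (huw : u < w) :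
    ∃ v a, Entry X Y u v a := by
  obtain ⟨v, ⟨hv, huv⟩, hm⟩ := D0Pred.least (P := fun v => Bit v Y ∧ u < v)
    (fun n i => inferInstance) ⟨w, hw, huw⟩
  obtain ⟨a, ha⟩ := exists_block X hu.pow2.pos hv.pow2.pos
  exact ⟨v, a, entry_iff.2 ⟨hu, hv, huv, fun w hw h =>
    not_lt.1 fun hn => hm w hn ⟨hw, h⟩, ha⟩⟩

theorem exists_prev (h : Chain X Y t) {v : M} (hv : Bit v Y) (h1 : v ≠ 1) :
    ∃ u a, Entry X Y u v a := by
  obtain ⟨u, ⟨hu, huv⟩, hm⟩ := D0Pred.greatest (P := fun u => Bit u Y ∧ u < v)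
    (fun n i => inferInstance) v (fun x hx => hx.2.le)
    ⟨1, h.one, lt_of_le_of_ne hv.pow2.one_le (Ne.symm h1)⟩
  obtain ⟨a, ha⟩ := exists_block X hu.pow2.pos hv.pow2.pos
  exact ⟨u, a, entry_iff.2 ⟨hu, hv, huv, fun w hw h =>
    not_lt.1 fun hn => absurd (hm w ⟨hw, hn⟩) (not_le.2 h), ha⟩⟩

/-- Induction along the marks. -/
theorem induct (h : Chain X Y t) {P : M → Prop} (hP : D0Pred P) (h1 : P 1)
    (hs : ∀ u v a, Entry X Y u v a → P u → P v) {v : M} (hv : Bit v Y) : P v := by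
  have : D0Pred (fun v => Bit v Y → P v) := fun n i => by
    have := hP n i
    infer_instance
  refine this.strong (fun v ih hv => ?_) v hv
  by_cases hv1 : v = 1
  · rwa [hv1]
  · obtain ⟨u, a, he⟩ := h.exists_prev hv hv1
    exact hs u v a he (ih u he.lt he.1)

end Chain

namespace SetChain

variable {X Y t : M}

/-- Only neighbouring blocks are required to increase; distant ones are compared by going back mark
by mark. -/
theorem lt_of_le (h : SetChain X Y t) {u v u' v' a a' : M} (h₁ : Entry X Y u v a)
    (h₂ : Entry X Y u' v' a') (hle : v ≤ u') : a < a' := by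
  have : D0Pred (fun v' => ∀ u', u' ≤ Y → ∀ a', a' ≤ X → Entry X Y u' v' a' → v ≤ u' → a < a') :=
    fun n i => inferInstance
  refine this.strong (fun v' ih u' _ a' _ h₂ hle => ?_) v' u' h₂.le.1 a' h₂.le.2.2 h₂ hle
  rcases hle.lt_or_eq with h3 | rfl
  · obtain ⟨u'', a'', h4⟩ := h.exists_prev h₂.1 (h₁.2.1.pow2.one_le.trans_lt h3).ne'
    exact (ih u' h₂.lt u'' h4.le.1 a'' h4.le.2.2 h4 (h4.le_of_lt h₁.2.1 h3)).trans
      (h.incr _ _ _ _ _ h4 h₂)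
  · exact h.incr _ _ _ _ _ h₁ h₂

theorem pos (h : SetChain X Y t) {u v a : M} (he : Entry X Y u v a) : 0 < a := by
  rw [pos_iff_ne_zero]
  rintro rfl
  have := h.full _ _ _ he
  rw [zero_mul, mul_zero] at this
  exact absurd this (not_le.2 he.2.1.pow2.pos)

theorem append {X₁ Y₁ t₁ X₂ Y₂ t₂ : M} (h₁ : SetChain X₁ (t₁ + Y₁) t₁) (hY : Y₁ < t₁)
    (h₂ : SetChain X₂ Y₂ t₂) (hlt : ∀ u v a u' v' a', Entry X₁ (t₁ + Y₁) u v a →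
      Entry X₂ Y₂ u' v' a' → a < a') :
    SetChain (X₂ * t₁ + X₁) (Y₂ * t₁ + Y₁) (t₁ * t₂) := by
  have he := fun {u v a} => Chain.entry_append (u := u) (v := v) (a := a) h₁.toChain hY h₂.toChain
  have ht := h₁.pow2.pos
  refine ⟨h₁.toChain.append hY h₂.toChain, ?_, ?_⟩
  · intro u v a h
    rcases he.1 h with k | ⟨u', v', rfl, rfl, k⟩
    · exact h₁.full _ _ _ k
    · calc t₁ * v' ≤ t₁ * (2 * (a * u')) := by gcongr; exact h₂.full _ _ _ k
        _ = _ := by ring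
  · intro u v w a b h h'
    rcases he.1 h with k | ⟨u', v', rfl, rfl, k⟩ <;>
      rcases he.1 h' with k' | ⟨u'', v'', hu, rfl, k'⟩
    · exact h₁.incr _ _ _ _ _ k k'
    · exact hlt _ _ _ _ _ _ k k'
    · have h3 := k'.lt.trans_le (h₁.toChain.le_top k'.2.1)
      exact absurd h3 (not_lt.2 (le_mul_of_pos k.2.1.pow2.pos))
    · have := mul_left_cancel₀ ht.ne' hu
      subst this
      exact h₂.incr _ _ _ _ _ k k'

theorem split (h : SetChain X Y t) {u : M} (hu : Bit u Y) :
    ∃ X₁ Y₁ X₂ Y₂ t₂, SetChain X₁ (u + Y₁) u ∧ Y₁ < u ∧ SetChain X₂ Y₂ t₂ ∧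
      X = X₂ * u + X₁ ∧ Y = Y₂ * u + Y₁ ∧ t = u * t₂ := by
  obtain ⟨X₁, Y₁, X₂, Y₂, t₂, h₁, hY, h₂, rfl, rfl, rfl⟩ := h.toChain.split hu
  have he := fun {u' v a} => Chain.entry_append (u := u') (v := v) (a := a) h₁ hY h₂
  have ht := h₁.pow2.pos
  refine ⟨X₁, Y₁, X₂, Y₂, t₂, ⟨h₁, ?_, ?_⟩, hY, ⟨h₂, ?_, ?_⟩, rfl, rfl, rfl⟩
  · exact fun u v a h' => h.full _ _ _ (he.2 (Or.inl h'))
  · exact fun u v w a b h' h'' => h.incr _ _ _ _ _ (he.2 (Or.inl h')) (he.2 (Or.inl h''))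
  · intro u' v a h'
    have := h.full _ _ _ (he.2 (Or.inr ⟨_, _, rfl, rfl, h'⟩))
    refine le_of_mul_le_mul_left (this.trans (le_of_eq ?_)) ht
    ring
  · exact fun u' v w a b h' h'' => h.incr _ _ _ _ _ (he.2 (Or.inr ⟨_, _, rfl, rfl, h'⟩))
      (he.2 (Or.inr ⟨_, _, rfl, rfl, h''⟩))

theorem one_lt {x q : M} (h : x < q) (hx : 0 < x) : 1 < q := by
  refine lt_of_le_of_lt ?_ h
  rw [← zero_add (1 : M)]
  exact lt_iff_succ_le.1 hx

theorem single {x q : M} (hx : 0 < x) (hq : Pow2 q) (h : x < q) (h2 : q ≤ 2 * x) :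
    SetChain x (q + 1) q := by
  have h1 := one_lt h hx
  refine ⟨Chain.single hq h h1, ?_, ?_⟩
  · intro u v a he
    obtain ⟨rfl, rfl, rfl⟩ := (Chain.entry_single hq h h1).1 he
    rwa [mul_one]
  · intro u v w a b he he'
    obtain ⟨rfl, rfl, rfl⟩ := (Chain.entry_single hq h h1).1 he
    obtain ⟨rfl, _⟩ := (Chain.entry_single hq h h1).1 he'
    exact absurd h1 (lt_irrefl _)

theorem empty : SetChain (0 : M) 1 1 := by
  have hc : Chain (0 : M) 1 1 :=
    ⟨pow2_one, zero_lt_one, bit_self pow2_one, 0, zero_lt_one, (add_zero 1).symm⟩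
  have hn : ∀ u v a : M, ¬ Entry 0 1 u v a := fun u v a h =>
    absurd (hc.le_top h.2.1) (not_le.2 (h.1.pow2.one_le.trans_lt h.lt))
  exact ⟨hc, fun u v a h => absurd h (hn _ _ _), fun u v w a b h => absurd h (hn _ _ _)⟩

/-- X < t and t ≤ Y < 2t, so up to a constant the code is the square of the top mark. Size estimates
for sets can thus be made on t. -/
theorem code_le (h : SetChain X Y t) : pair X Y ≤ 10 * (t * t) ∧ t * t ≤ pair X Y := by
  obtain ⟨Z, hZ, hY⟩ := h.top
  constructor
  · have hX := h.lt
    have hpos := h.pow2.one_le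
    subst hY
    unfold pair
    have hx0 := Diff.coe_nonneg X
    have hz0 := Diff.coe_nonneg Z
    simp only [diff_lt, diff_le, push_cast] at *
    nlinarith
  · refine le_trans (mul_le_mul' ?_ ?_) (mul_self_le_pair X Y) <;> rw [hY] <;> exact le_self_add

end SetChain

theorem IsSetCode.pos {c : M} (h : IsSetCode c) : 0 < c := by
  obtain ⟨X, Y, t, rfl, k⟩ := isSetCode_iff.1 h
  exact (mul_pos k.pow2.pos k.pow2.pos).trans_le k.code_le.2

theorem IsSetCode.mem_pos {c a : M} (h : IsSetCode c) (ha : Mem a c) : 0 < a := by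
  obtain ⟨X, Y, t, rfl, k⟩ := isSetCode_iff.1 h
  obtain ⟨u, v, he⟩ := mem_pair.1 ha
  exact k.pos he

theorem isEmptyCode_one : IsEmptyCode (1 : M) := by
  have h1 : (1 : M) = pair 0 1 := by unfold pair; ring
  refine ⟨isSetCode_iff.2 ⟨0, 1, 1, h1, SetChain.empty⟩, ?_⟩
  rw [h1]
  intro z hz
  obtain ⟨u, v, h⟩ := mem_pair.1 hz
  exact absurd (SetChain.empty.toChain.le_top h.2.1) (not_le.2 (h.1.pow2.one_le.trans_lt h.lt))

/-- Adjoining an element to a coded set, with a bound on the code. -/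
theorem exists_insert {c x : M} (hc : IsSetCode c) (hx : 0 < x) :
    ∃ c', IsInsertCode c' c x ∧ c' ≤ 40 * (x * x) * c := by
  by_cases hxc : Mem x c
  · refine ⟨c, ⟨hc, fun z => ⟨Or.inl, ?_⟩⟩, ?_⟩
    · rintro (h | rfl)
      · exact h
      · exact hxc
    · exact le_mul_of_pos' (mul_pos (by norm_num) (mul_pos hx hx))
  obtain ⟨X, Y, t, rfl, h⟩ := isSetCode_iff.1 hc
  -- The insertion point is the greatest mark before which all blocks are less than x; by maximality
  -- the blocks after it exceed x.
  obtain ⟨u, ⟨hu, hlow⟩, hmax⟩ := D0Pred.greatest (P := fun u => Bit u Y ∧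
      ∀ u', u' ≤ Y → ∀ v', v' ≤ Y → ∀ a, a ≤ X → Entry X Y u' v' a → v' ≤ u → a < x)
    (fun n i => inferInstance) Y (fun u hu => hu.1.le)
    ⟨1, h.one, fun u' _ v' _ a _ he hv => absurd (he.1.pow2.one_le.trans_lt he.lt) (not_lt.2 hv)⟩
  have hlow' : ∀ {u' v' a}, Entry X Y u' v' a → v' ≤ u → a < x :=
    fun he => hlow _ he.le.1 _ he.le.2.1 _ he.le.2.2 he
  have hhigh : ∀ {u' v' a}, Entry X Y u' v' a → u ≤ u' → x < a := by
    intro u' v' a he hle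
    have hfirst : ∀ {v a}, Entry X Y u v a → x < a := by
      intro v a he
      by_contra hn
      have hax : a < x := lt_of_le_of_ne (not_lt.1 hn)
        (fun e => hxc (mem_pair.2 ⟨u, v, e ▸ he⟩))
      refine absurd (hmax v ⟨he.2.1, fun u' _ v' _ a' _ he' hv' => ?_⟩) (not_le.2 he.lt)
      rcases hv'.lt_or_eq with h1 | rfl
      · exact hlow' he' (he.le_of_lt he'.2.1 h1)
      · rw [(he'.left_unique he).2]; exact hax
    rcases hle.lt_or_eq with h1 | rfl
    · obtain ⟨v, b, hb⟩ := h.toChain.exists_next hu he.1 h1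
      exact (hfirst hb).trans (h.lt_of_le hb he ((entry_iff.1 hb).2.2.2.1 _ he.1 h1))
    · exact hfirst he
  obtain ⟨X₁, Y₁, X₂, Y₂, t₂, h₁, hY, h₂, rfl, rfl, rfl⟩ := h.split hu
  have he := fun {u' v a} =>
    Chain.entry_append (u := u') (v := v) (a := a) h₁.toChain hY h₂.toChain
  obtain ⟨p, hp, hpx, hxp⟩ := exists_pow2 hx
  have hq := hp.double
  have hq2 : 2 * p ≤ 2 * x := by gcongr
  have hs := SetChain.single hx hq hxp hq2
  have h1q := SetChain.one_lt hxp hx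
  have hes := fun {u v a} => Chain.entry_single (u := u) (v := v) (a := a) hq hxp h1q
  have hm := hs.append h1q h₂ (by
    intro u₁ v₁ a₁ u' v' a' h3 h4
    obtain ⟨_, _, rfl⟩ := hes.1 h3
    exact hhigh (he.2 (Or.inr ⟨_, _, rfl, rfl, h4⟩)) (le_mul_of_pos h4.1.pow2.pos))
  have hem := fun {u' v a} =>
    Chain.entry_append (u := u') (v := v) (a := a) hs.toChain h1q h₂.toChain
  have hf := h₁.append hY hm (by
    intro u₁ v₁ a₁ u' v' a' h3 h4
    have h5 := hlow' (he.2 (Or.inl h3)) (h₁.toChain.le_top h3.2.1)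
    rcases hem.1 h4 with h6 | ⟨u'', v'', rfl, rfl, h6⟩
    · obtain ⟨_, _, rfl⟩ := hes.1 h6
      exact h5
    · exact h5.trans (hhigh (he.2 (Or.inr ⟨_, _, rfl, rfl, h6⟩)) (le_mul_of_pos h6.1.pow2.pos)))
  have hef := fun {u' v a} =>
    Chain.entry_append (u := u') (v := v) (a := a) h₁.toChain hY hm.toChain
  refine ⟨_, ⟨isSetCode_iff.2 ⟨_, _, _, rfl, hf⟩, fun z => ?_⟩, ?_⟩
  · simp only [mem_pair]
    constructor
    · rintro ⟨u', v', h3⟩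
      rcases hef.1 h3 with h4 | ⟨u₁, v₁, rfl, rfl, h4⟩
      · exact Or.inl ⟨_, _, he.2 (Or.inl h4)⟩
      rcases hem.1 h4 with h5 | ⟨u₂, v₂, rfl, rfl, h5⟩
      · exact Or.inr (hes.1 h5).2.2
      · exact Or.inl ⟨_, _, he.2 (Or.inr ⟨_, _, rfl, rfl, h5⟩)⟩
    · rintro (⟨u', v', h3⟩ | rfl)
      · rcases he.1 h3 with h4 | ⟨u₁, v₁, rfl, rfl, h4⟩
        · exact ⟨_, _, hef.2 (Or.inl h4)⟩
        · exact ⟨_, _, hef.2 (Or.inr ⟨_, _, rfl, rfl, hem.2 (Or.inr ⟨_, _, rfl, rfl, h4⟩)⟩)⟩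
      · exact ⟨_, _, hef.2 (Or.inr ⟨_, _, rfl, rfl, hem.2 (Or.inl (hes.2 ⟨rfl, rfl, rfl⟩))⟩)⟩
  -- The new block multiplies the top mark by 2p ≤ 2x, so the constant is 10·2² = 40.
  · calc _ ≤ 10 * ((u * (2 * p * t₂)) * (u * (2 * p * t₂))) := hf.code_le.1
      _ = 10 * (2 * p * (2 * p)) * ((u * t₂) * (u * t₂)) := by ring
      _ ≤ 10 * (2 * x * (2 * x)) * pair (X₂ * u + X₁) (Y₂ * u + Y₁) :=
        mul_le_mul' (mul_le_mul' le_rfl (mul_le_mul' hq2 hq2)) h.code_le.2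
      _ = _ := by ring

end SetCodes

/-! ### Derivations as coded sets -/

section Derivations

variable {M : Type*} [Model M]

/-- `d` is a derivation with respect to `rule`. -/
def IsDer (rule : (M → Prop) → M → Prop) (d : M) : Prop :=
  IsSetCode d ∧ ∀ y, Mem y d → rule (fun z => Mem z d) y

/-- A rule which stays applicable if there are more premises. -/
def MonoRule (rule : (M → Prop) → M → Prop) : Prop :=
  ∀ D D' : M → Prop, (∀ z, D z → D' z) → ∀ y, rule D y → rule D' y

theorem derivable_iff {rule : (M → Prop) → M → Prop} {x : M} :
    Derivable rule x ↔ ∃ d, IsDer rule d ∧ Mem x d :=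
  ⟨fun ⟨d, h1, h2, h3⟩ => ⟨d, ⟨h1, h3⟩, h2⟩, fun ⟨d, ⟨h1, h3⟩, h2⟩ => ⟨d, h1, h2, h3⟩⟩

theorem IsDer.insert {rule : (M → Prop) → M → Prop} (hr : MonoRule rule) {d d' x : M}
    (h : IsDer rule d) (hx : rule (fun z => Mem z d) x) (hi : IsInsertCode d' d x) :
    IsDer rule d' := by
  refine ⟨hi.1, fun y hy => hr _ _ (fun z hz => (hi.2 z).2 (Or.inl hz)) y ?_⟩
  rcases (hi.2 y).1 hy with h1 | rfl
  · exact h.2 y h1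
  · exact hx

theorem isDer_one (rule : (M → Prop) → M → Prop) : IsDer rule 1 :=
  ⟨isEmptyCode_one.1, fun y hy => absurd hy (isEmptyCode_one.2 y)⟩

theorem D0Pred₂.isDer {rule : (M → Prop) → M → Prop}
    (h : D0Pred₂ (fun d y => rule (fun z => Mem z d) y)) : D0Pred (IsDer rule) := fun n i => by
  refine D0.of_iff (Q := fun v => IsSetCode (v i) ∧
    ∀ y, y ≤ v i → Mem y (v i) → rule (fun z => Mem z (v i)) y) (fun v => ?_) ?_
  · exact and_congr_right fun _ => forall_congr' fun y => ⟨fun h _ => h, fun h hy => h hy.le hy⟩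
  · have := h (n + 1) i.castSucc (Fin.last (n + 1))
    infer_instance

end Derivations

/-! ### The graph of exponentiation -/

section Exponentiation

variable {M : Type*} [Model M]

theorem expRule_iff {D : M → Prop} {x : M} : ExpRule D x ↔ x = pair 0 1 ∨
    (∃ a b, D (pair a b) ∧ a ≠ 0 ∧ x = pair (2 * a) (b * b)) ∨
    ∃ a b, D (pair a b) ∧ x = pair (2 * a + 1) (2 * (b * b)) := by
  rw [← num_one, ← num_two]
  constructor
  · rintro (_ | ⟨h, h'⟩ | h)
    · exact Or.inl rfl
    · exact Or.inr (Or.inl ⟨_, _, h, h', rfl⟩)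
    · exact Or.inr (Or.inr ⟨_, _, h, rfl⟩)
  · rintro (rfl | ⟨a, b, h, h', rfl⟩ | ⟨a, b, h, rfl⟩)
    · exact .zero
    · exact .even h h'
    · exact .odd h

theorem expRule_mono : MonoRule (ExpRule : (M → Prop) → M → Prop) := fun D D' h y hy => by
  rcases hy with _ | ⟨h1, h2⟩ | h1
  · exact .zero
  · exact .even (h _ h1) h2
  · exact .odd (h _ h1)

theorem d0_expRule : D0Pred₂ (fun d y : M => ExpRule (fun z => Mem z d) y) := fun n i j => by
  refine D0.of_iff (Q := fun v => v j = pair 0 1 ∨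
    (∃ a, a ≤ v i ∧ ∃ b, b ≤ v i ∧ Mem (pair a b) (v i) ∧ a ≠ 0 ∧ v j = pair (2 * a) (b * b)) ∨
    ∃ a, a ≤ v i ∧ ∃ b, b ≤ v i ∧ Mem (pair a b) (v i) ∧ v j = pair (2 * a + 1) (2 * (b * b)))
    (fun v => ?_) inferInstance
  refine expRule_iff.trans ?_
  have h1 : ∀ {a b d : M}, Mem (pair a b) d → a ≤ d ∧ b ≤ d := fun h =>
    ⟨(le_pair_left _ _).trans h.le, (le_pair_right _ _).trans h.le⟩
  refine or_congr Iff.rfl (or_congr ?_ ?_)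
  · exact ⟨fun ⟨a, b, h, h'⟩ => ⟨a, (h1 h).1, b, (h1 h).2, h, h'⟩,
      fun ⟨a, _, b, _, h⟩ => ⟨a, b, h⟩⟩
  · exact ⟨fun ⟨a, b, h, h'⟩ => ⟨a, (h1 h).1, b, (h1 h).2, h, h'⟩,
      fun ⟨a, _, b, _, h⟩ => ⟨a, b, h⟩⟩

theorem one_le_of_pos {x : M} (h : 0 < x) : 1 ≤ x := by
  rw [← zero_add (1 : M)]; exact lt_iff_succ_le.1 h

theorem pair_pos {x y : M} (h : 0 < y) : 0 < pair x y := h.trans_le (le_pair_right x y)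

/-- The rules square the value at each step, so the values occurring in a lean derivation of y have
geometrically shrinking lengths and the product of their powers is polynomial in y. This bounds the
quantifier over derivations and makes the graph of exponentiation a bounded relation. -/
theorem isDer_exp_bound {d : M} (hd : IsDer ExpRule d) {x y : M} (h : Mem (pair x y) d) :
    x < y ∧ ∃ e, e ≤ 40 * y ^ 20 ∧ IsDer ExpRule e ∧ Mem (pair x y) e := by
  have hdef := d0_expRule.isDer (M := M)
  have key : D0Pred (fun x => ∀ y, y ≤ d → Mem (pair x y) d →
      x < y ∧ ∃ e, e ≤ 40 * y ^ 20 ∧ IsDer ExpRule e ∧ Mem (pair x y) e) := fun n i => by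
    have := hdef (n + 2) (Fin.last (n + 2))
    infer_instance
  -- One inference inserts a pair with code at most p and multiplies the bound by 40·p². In both
  -- uses p is a multiple of b⁴ and y is at least b², so y²⁰ ≥ b²⁰·b²⁰ has room for this factor.
  have step : ∀ {x y p e b : M}, IsDer ExpRule e → e ≤ 40 * b ^ 20 →
      ExpRule (fun z => Mem z e) (pair x y) → x < y → 40 * (p * p) * b ^ 20 ≤ y ^ 20 →
      pair x y ≤ p → x < y ∧ ∃ e, e ≤ 40 * y ^ 20 ∧ IsDer ExpRule e ∧ Mem (pair x y) e := by
    intro x y p e b he hb hr hxy hp hpp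
    obtain ⟨e', hi, hle⟩ := exists_insert he.1 (pair_pos (x := x) (pos_of_gt hxy))
    refine ⟨hxy, e', ?_, he.insert expRule_mono hr hi, (hi.2 _).2 (Or.inr rfl)⟩
    calc e' ≤ 40 * (pair x y * pair x y) * e := hle
      _ ≤ 40 * (p * p) * (40 * b ^ 20) := by gcongr
      _ = 40 * (40 * (p * p) * b ^ 20) := by ring
      _ ≤ _ := by gcongr
  refine key.strong (fun x ih y _ hm => ?_) x y ((le_pair_right x y).trans h.le) h
  rcases expRule_iff.1 (hd.2 _ hm) with h1 | ⟨a, b, hab, ha, h1⟩ | ⟨a, b, hab, h1⟩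
  · obtain ⟨rfl, rfl⟩ := pair_inj.1 h1
    obtain ⟨e, hi, hle⟩ := exists_insert (isDer_one (M := M) ExpRule).1
      (pair_pos (x := (0 : M)) zero_lt_one)
    refine ⟨zero_lt_one, e, hle.trans (le_of_eq ?_), (isDer_one ExpRule).insert expRule_mono
      (expRule_iff.2 (Or.inl rfl)) hi, (hi.2 _).2 (Or.inr rfl)⟩
    unfold pair
    ring
  · obtain ⟨rfl, rfl⟩ := pair_inj.1 h1
    obtain ⟨hlt, e, he, hde, hme⟩ := ih a (lt_double (pos_iff_ne_zero.2 ha)) b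
      ((le_pair_right _ _).trans hab.le) hab
    -- The constant 1000 below is absorbed by b¹² ≥ 2¹², which needs b ≥ 2 and hence a ≠ 0. In the
    -- odd case the factor 2 in the value absorbs the constant instead.
    have hb2 : (2 : M) ≤ b := by
      rw [← one_add_one_eq_two]
      exact le_trans (by gcongr; exact one_le_of_pos (pos_iff_ne_zero.2 ha)) (lt_iff_succ_le.1 hlt)
    have hab2 : 2 * a < b * b :=
      (mul_lt_mul_of_pos_left hlt two_pos).trans_le (mul_le_mul_left hb2 b)
    refine step (p := 5 * b ^ 4) hde he (expRule_iff.2 (Or.inr (Or.inl ⟨a, b, hme, ha, rfl⟩))) hab2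
      ?_ ?_
    · calc 40 * (5 * b ^ 4 * (5 * b ^ 4)) * b ^ 20 = 1000 * b ^ 28 := by ring
        _ ≤ 2 ^ 12 * b ^ 28 := by gcongr; norm_num
        _ ≤ b ^ 12 * b ^ 28 := by gcongr
        _ = (b * b) ^ 20 := by ring
    · calc pair (2 * a) (b * b) ≤ pair (b * b) (b * b) := pair_mono hab2.le le_rfl
        _ = 4 * b ^ 4 + b ^ 2 * 1 := by unfold pair; ring
        _ ≤ 4 * b ^ 4 + b ^ 2 * b ^ 2 := by
          gcongr
          exact one_le_pow₀ (one_le_of_pos (pos_of_gt hlt))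
        _ = _ := by ring
  · obtain ⟨rfl, rfl⟩ := pair_inj.1 h1
    obtain ⟨hlt, e, he, hde, hme⟩ := ih a (lt_add_one_iff'.2 (by rw [two_mul]; exact le_self_add)) b
      ((le_pair_right _ _).trans hab.le) hab
    have hb1 : 1 ≤ b := one_le_of_pos (pos_of_gt hlt)
    have hab2 : 2 * a + 1 < 2 * (b * b) := by
      have h2 : 2 * (a + 1) ≤ 2 * (b * b) := by
        gcongr
        exact (lt_iff_succ_le.1 hlt).trans (self_le_mul_self b)
      refine lt_of_lt_of_le ?_ h2
      rw [mul_add, mul_one, ← one_add_one_eq_two, ← add_assoc]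
      exact lt_add_one _
    refine step (p := 18 * b ^ 4) hde he (expRule_iff.2 (Or.inr (Or.inr ⟨a, b, hme, rfl⟩))) hab2
      ?_ ?_
    · calc 40 * (18 * b ^ 4 * (18 * b ^ 4)) * b ^ 20 = 12960 * b ^ 28 := by ring
        _ ≤ 2 ^ 20 * b ^ 40 := by
          gcongr
          · norm_num
          · norm_num
        _ = (2 * (b * b)) ^ 20 := by ring
    · calc pair (2 * a + 1) (2 * (b * b)) ≤ pair (2 * (b * b)) (2 * (b * b)) :=
            pair_mono hab2.le le_rfl
        _ = 16 * b ^ 4 + 2 * b ^ 2 * 1 := by unfold pair; ring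
        _ ≤ 16 * b ^ 4 + 2 * b ^ 2 * b ^ 2 := by
          gcongr
          exact one_le_pow₀ hb1
        _ = _ := by ring

theorem exp_iff_bounded {x y : M} :
    Exp x y ↔ ∃ e, e ≤ 40 * y ^ 20 ∧ IsDer ExpRule e ∧ Mem (pair x y) e := by
  constructor
  · intro h
    obtain ⟨d, hd, hm⟩ := derivable_iff.1 h
    exact (isDer_exp_bound hd hm).2
  · rintro ⟨e, _, hd, hm⟩
    exact derivable_iff.2 ⟨e, hd, hm⟩

theorem Exp.lt {x y : M} (h : Exp x y) : x < y := by
  obtain ⟨d, hd, hm⟩ := derivable_iff.1 h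
  exact (isDer_exp_bound hd hm).1

theorem d0_exp : D0Pred₂ (Exp : M → M → Prop) := fun n i j => by
  refine D0.of_iff (fun v => exp_iff_bounded) ?_
  have := d0_expRule.isDer (M := M) (n + 1) (Fin.last (n + 1))
  infer_instance

instance D0.exp {n : ℕ} {t u : (Fin (n + 1) → M) → M} [ht : Poly t] [hu : Poly u] :
    D0 (fun v => Exp (t v) (u v)) := d0_exp.comp ht hu

theorem exp_intro {x y : M} (hy : 0 < y) {d : M} (hd : IsDer ExpRule d)
    (h : ExpRule (fun z => Mem z d) (pair x y)) : Exp x y := by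
  obtain ⟨e, hi, _⟩ := exists_insert hd.1 (pair_pos (x := x) hy)
  exact derivable_iff.2 ⟨e, hd.insert expRule_mono h hi, (hi.2 _).2 (Or.inr rfl)⟩

theorem exp_zero : Exp (0 : M) 1 :=
  exp_intro zero_lt_one (isDer_one _) (expRule_iff.2 (Or.inl rfl))

theorem Exp.pos {x y : M} (h : Exp x y) : 0 < y := pos_of_gt h.lt

theorem Exp.even {a b : M} (h : Exp a b) (ha : a ≠ 0) : Exp (2 * a) (b * b) := by
  obtain ⟨d, hd, hm⟩ := derivable_iff.1 h
  exact exp_intro (mul_pos h.pos h.pos) hd (expRule_iff.2 (Or.inr (Or.inl ⟨a, b, hm, ha, rfl⟩)))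

theorem Exp.odd {a b : M} (h : Exp a b) : Exp (2 * a + 1) (2 * (b * b)) := by
  obtain ⟨d, hd, hm⟩ := derivable_iff.1 h
  exact exp_intro (mul_pos two_pos (mul_pos h.pos h.pos)) hd
    (expRule_iff.2 (Or.inr (Or.inr ⟨a, b, hm, rfl⟩)))

theorem Exp.cases {x y : M} (h : Exp x y) : (x = 0 ∧ y = 1) ∨
    (∃ a b, Exp a b ∧ a ≠ 0 ∧ x = 2 * a ∧ y = b * b) ∨
    ∃ a b, Exp a b ∧ x = 2 * a + 1 ∧ y = 2 * (b * b) := by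
  obtain ⟨d, hd, hm⟩ := derivable_iff.1 h
  rcases expRule_iff.1 (hd.2 _ hm) with h1 | ⟨a, b, hab, ha, h1⟩ | ⟨a, b, hab, h1⟩
  · exact Or.inl (pair_inj.1 h1)
  · exact Or.inr (Or.inl ⟨a, b, derivable_iff.2 ⟨d, hd, hab⟩, ha, pair_inj.1 h1⟩)
  · exact Or.inr (Or.inr ⟨a, b, derivable_iff.2 ⟨d, hd, hab⟩, pair_inj.1 h1⟩)

/-- Induction on exponentiation. -/
theorem Exp.rec {R : M → M → Prop} (hR : D0Pred₂ R) (h0 : R 0 1)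
    (he : ∀ a b, Exp a b → a ≠ 0 → R a b → R (2 * a) (b * b))
    (ho : ∀ a b, Exp a b → R a b → R (2 * a + 1) (2 * (b * b))) {x y : M} (h : Exp x y) :
    R x y := by
  -- Quantifying the value below y keeps the induction formula bounded; values do not increase on
  -- the way down.
  have : D0Pred (fun x => ∀ z, z ≤ y → Exp x z → R x z) := fun n i => by
    have := hR (n + 1) i.castSucc (Fin.last (n + 1))
    infer_instance
  refine this.strong (fun x ih z hz h => ?_) x y le_rfl h
  rcases h.cases with ⟨rfl, rfl⟩ | ⟨a, b, hab, ha, rfl, rfl⟩ | ⟨a, b, hab, rfl, rfl⟩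
  · exact h0
  · exact he a b hab ha (ih a (lt_double (pos_iff_ne_zero.2 ha)) b
      ((self_le_mul_self b).trans hz) hab)
  · refine ho a b hab (ih a (lt_add_one_iff'.2 (by rw [two_mul]; exact le_self_add)) b ?_ hab)
    exact ((self_le_mul_self b).trans (le_mul_of_pos' two_pos)).trans hz

theorem Exp.zero_eq {y : M} (h : Exp 0 y) : y = 1 := by
  rcases h.cases with ⟨_, h⟩ | ⟨a, b, _, ha, h, _⟩ | ⟨a, b, _, h, _⟩
  · exact h
  · exact absurd (by simpa using h.symm) ha
  · exact absurd (by simpa using h) (even_ne_odd (a := 0) (b := a))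

theorem Exp.succ {x y : M} (h : Exp x y) : Exp (x + 1) (2 * y) := by
  refine Exp.rec (R := fun x y => Exp (x + 1) (2 * y)) (fun _ _ _ => inferInstance) ?_ ?_ ?_ h
  · have := (exp_zero (M := M)).odd
    rwa [mul_zero, mul_one] at this
  · exact fun a b hab _ _ => hab.odd
  · intro a b _ ih
    have := ih.even (by simp)
    convert this using 1 <;> ring

/-- The rules halve the exponent, while `Exp.induct` has to descend by one. If the exponent is 2a,
the claim for a gives a = c + 1, and the predecessor is 2c + 1. If it is 2a + 1, the predecessor is
2a. -/
theorem Exp.pred {x y : M} (h : Exp (x + 1) y) : ∃ z, y = 2 * z ∧ Exp x z := by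
  have key := Exp.rec (R := fun x y => ∀ w, w ≤ x → x = w + 1 → ∃ z, z ≤ y ∧ y = 2 * z ∧ Exp w z)
    (fun _ _ _ => inferInstance) (fun w _ hw => absurd hw (pos_of_gt (lt_add_one w)).ne)
    (fun a b hab ha ih w hw hx => ?_) (fun a b hab ih w hw hx => ?_) h x le_self_add rfl
  · obtain ⟨z, _, hz⟩ := key
    exact ⟨z, hz⟩
  · obtain ⟨a, rfl⟩ := exists_succ ha
    obtain ⟨b, _, rfl, hb⟩ := ih a le_self_add rfl
    have hw' : w = 2 * a + 1 := add_right_cancel (b := 1) (by rw [← hx]; ring)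
    subst hw'
    refine ⟨2 * (b * b), ?_, by ring, hb.odd⟩
    rw [show 2 * b * (2 * b) = 2 * (2 * (b * b)) by ring]
    exact le_mul_of_pos' two_pos
  · have hw' : w = 2 * a := add_right_cancel hx.symm
    subst hw'
    refine ⟨b * b, le_mul_of_pos' two_pos, rfl, ?_⟩
    by_cases ha : a = 0
    · subst ha
      rw [hab.zero_eq, mul_zero, mul_one]
      exact exp_zero
    · exact hab.even ha

/-- Induction on exponentiation, from `x` to `x + 1`. -/
theorem Exp.induct {R : M → M → Prop} (hR : D0Pred₂ R) (h0 : R 0 1)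
    (hs : ∀ a b, Exp a b → R a b → R (a + 1) (2 * b)) {x y : M} (h : Exp x y) : R x y := by
  have : D0Pred (fun x => ∀ z, z ≤ y → Exp x z → R x z) := fun n i => by
    have := hR (n + 1) i.castSucc (Fin.last (n + 1))
    infer_instance
  refine this.induct (fun z _ hz => by rw [hz.zero_eq]; exact h0) (fun x ih z hz hxz => ?_) x y
    le_rfl h
  obtain ⟨w, rfl, hw⟩ := hxz.pred
  exact hs x w hw (ih w ((le_mul_of_pos' two_pos).trans hz) hw)

theorem Exp.unique {x y z : M} (h : Exp x y) (h' : Exp x z) : y = z := by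
  refine Exp.induct (R := fun x y => ∀ w, w ≤ z → Exp x w → y = w) (fun _ _ _ => inferInstance)
    (fun w _ hw => hw.zero_eq.symm) (fun a b _ ih w hw h => ?_) h z le_rfl h'
  obtain ⟨v, rfl, hv⟩ := h.pred
  rw [ih v ((le_mul_of_pos' two_pos).trans hw) hv]

theorem Exp.add {x y x' y' : M} (h : Exp x y) (h' : Exp x' y') : Exp (x + x') (y * y') := by
  refine Exp.induct (R := fun x' y' => Exp (x + x') (y * y')) (fun _ _ _ => inferInstance)
    (by rwa [add_zero, mul_one]) (fun a b _ ih => ?_) h'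
  have := ih.succ
  convert this using 1 <;> ring

/-- Exponentiation may be partial, so the existence of a value is always inherited from a larger
one. -/
theorem Exp.exists_of_le {x y x' : M} (h : Exp x y) (hx : x' ≤ x) : ∃ z, z ≤ y ∧ Exp x' z := by
  refine Exp.induct (R := fun x y => ∀ w, w ≤ x → ∃ z, z ≤ y ∧ Exp w z)
    (fun _ _ _ => inferInstance) (fun w hw => ?_) (fun a b hab ih w hw => ?_) h x' hx
  · rw [nonpos_iff_eq_zero.1 hw]
    exact ⟨1, le_rfl, exp_zero⟩
  · rcases hw.lt_or_eq with h1 | rfl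
    · obtain ⟨z, hz, h2⟩ := ih w (lt_add_one_iff'.1 h1)
      exact ⟨z, hz.trans (le_mul_of_pos' two_pos), h2⟩
    · exact ⟨_, le_rfl, hab.succ⟩

theorem Exp.mono {x y x' y' : M} (h : Exp x y) (h' : Exp x' y') (hx : x ≤ x') : y ≤ y' := by
  obtain ⟨z, hz, h1⟩ := h'.exists_of_le hx
  rwa [h.unique h1]

theorem Exp.strictMono {x y x' y' : M} (h : Exp x y) (h' : Exp x' y') (hx : x < x') : y < y' :=
  (lt_double h.pos).trans_le (h.succ.mono h' (lt_iff_succ_le.1 hx))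

theorem Exp.le_of_le {x y x' y' : M} (h : Exp x y) (h' : Exp x' y') (hy : y ≤ y') : x ≤ x' := by
  by_contra hn
  exact absurd hy (not_le.2 (h'.strictMono h (not_le.1 hn)))

theorem Exp.exists_log {x y v : M} (h : Exp x y) (hv : Pow2 v) (hvy : v ≤ y) :
    ∃ i, i ≤ x ∧ Exp i v := by
  refine Pow2.induct (P := fun v => v ≤ y → ∃ i, i ≤ x ∧ Exp i v) (fun n i => inferInstance)
    (fun _ => ⟨0, zero_le, exp_zero⟩) (fun p _ ih hp => ?_) hv hvy
  obtain ⟨i, _, hi⟩ := ih ((le_mul_of_pos' two_pos).trans hp)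
  exact ⟨i + 1, hi.succ.le_of_le h hp, hi.succ⟩

end Exponentiation

/-! ### Unions, comprehension and size bounds -/

section SetOperations

variable {M : Type*} [Model M]

/-- The step of the inductions along marks: passing from u to v adds exactly one block. -/
theorem Entry.end_le_iff {X Y u v a u' v' z : M} (h : Entry X Y u v a) (h' : Entry X Y u' v' z) :
    v' ≤ v ↔ v' ≤ u ∨ (u' = u ∧ v' = v ∧ z = a) := by
  constructor
  · intro hv
    rcases hv.lt_or_eq with h1 | rfl
    · exact Or.inl (h.le_of_lt h'.2.1 h1)
    · obtain ⟨h2, h3⟩ := h'.left_unique h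
      exact Or.inr ⟨h2, rfl, h3⟩
  · rintro (h1 | ⟨_, rfl, _⟩)
    · exact h1.trans h.lt.le
    · exact le_rfl

/-- The union of two coded sets, with a bound on the code. -/
theorem exists_union {A B : M} (hA : IsSetCode A) (hB : IsSetCode B) :
    ∃ c, IsUnionCode c A B ∧ c ≤ A * B ^ 4 := by
  obtain ⟨X, Y, t, rfl, h⟩ := isSetCode_iff.1 hB
  -- The invariant at mark v: the blocks of B ending by v have been adjoined to A at a cost of v⁸.
  -- At the top mark t this is (t²)⁴ ≤ B⁴.
  have hP : D0Pred (fun v => ∃ Z, Z ≤ A * v ^ 8 ∧ IsSetCode Z ∧ ∀ z, z ≤ Z + A + X →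
      (Mem z Z ↔ Mem z A ∨ ∃ u', u' ≤ Y ∧ ∃ v', v' ≤ Y ∧ Entry X Y u' v' z ∧ v' ≤ v)) :=
    fun _ _ => inferInstance
  have key := h.toChain.induct hP ⟨A, by simp, hA, fun z _ => ?_⟩ (fun u v a he => ?_)
    h.toChain.bit_top
  · obtain ⟨Z, hZ, hs, hm⟩ := key
    refine ⟨Z, ⟨hs, fun z => ?_⟩, hZ.trans ?_⟩
    · rw [mem_pair]
      constructor
      · intro hz
        rcases (hm z (hz.le.trans (by rw [add_assoc]; exact le_self_add))).1 hz with
          h1 | ⟨u', _, v', _, h1, _⟩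
        · exact Or.inl h1
        · exact Or.inr ⟨u', v', h1⟩
      · rintro (h1 | ⟨u', v', h1⟩)
        · exact (hm z (h1.le.trans (le_add_self.trans le_self_add))).2 (Or.inl h1)
        · exact (hm z (h1.le.2.2.trans le_add_self)).2
            (Or.inr ⟨u', h1.le.1, v', h1.le.2.1, h1, h.toChain.le_top h1.2.1⟩)
    · calc A * t ^ 8 = A * (t * t) ^ 4 := by ring
        _ ≤ _ := by gcongr; exact h.code_le.2
  · constructor
    · exact Or.inl
    · rintro (h1 | ⟨u', _, v', _, h1, h2⟩)
      · exact h1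
      · exact absurd (h1.1.pow2.one_le.trans_lt h1.lt) (not_lt.2 h2)
  · rintro ⟨Z, hZ, hs, hm⟩
    obtain ⟨Z', hi, hle⟩ := exists_insert hs (h.pos he)
    refine ⟨Z', ?_, hi.1, fun z _ => ?_⟩
    -- A block a between u and v = u·s satisfies a < s and 2 ≤ s, so the insertion factor 40·a² is
    -- at most 2⁶·s² ≤ s⁸.
    · obtain ⟨s, hs2, rfl⟩ := he.1.pow2.exists_mul he.2.1.pow2 he.lt.le
      have ha : a < s := by
        have := (entry_iff.1 he).2.2.2.2.mul_lt
        rw [mul_comm u] at this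
        exact lt_of_mul_lt_mul_right this zero_le
      have h2s : 2 ≤ s := by
        rw [← one_add_one_eq_two]
        exact lt_iff_succ_le.1 ((one_le_of_pos (h.pos he)).trans_lt ha)
      calc Z' ≤ 40 * (a * a) * (A * u ^ 8) := hle.trans (by gcongr)
        _ ≤ 2 ^ 6 * (s * s) * (A * u ^ 8) := by gcongr; norm_num
        _ ≤ s ^ 6 * (s * s) * (A * u ^ 8) := by gcongr
        _ = A * (u * s) ^ 8 := by ring
    · rw [hi.2]
      constructor
      · rintro (h1 | rfl)
        · rcases (hm z (h1.le.trans (by rw [add_assoc]; exact le_self_add))).1 h1 with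
            h2 | ⟨u', h3, v', h4, h5, h6⟩
          · exact Or.inl h2
          · exact Or.inr ⟨u', h3, v', h4, h5, h6.trans he.lt.le⟩
        · exact Or.inr ⟨u, he.le.1, v, he.le.2.1, he, le_rfl⟩
      · rintro (h1 | ⟨u', h3, v', h4, h5, h6⟩)
        · exact Or.inl ((hm z (h1.le.trans (le_add_self.trans le_self_add))).2 (Or.inl h1))
        · rcases (he.end_le_iff h5).1 h6 with h7 | ⟨_, _, h7⟩
          · exact Or.inl ((hm z (h5.le.2.2.trans le_add_self)).2
              (Or.inr ⟨u', h3, v', h4, h5, h7⟩))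
          · exact Or.inr h7

theorem Exp.pow_four {x y : M} (h : Exp x y) : Exp (4 * x) (y ^ 4) := by
  have := (h.add h).add (h.add h)
  convert this using 1 <;> ring

/-- The union of a coded family of sets of bounded size is coded. -/
theorem exists_biUnion {c s S r R G : M} (hc : IsSetCode c) (hS : Exp s S) (hcS : c ≤ S)
    (hR : Exp r R) (hG : Exp (4 * r * s) G) {Q : M → M → Prop} (hQ : D0Pred₂ Q)
    (hF : ∀ a, Mem a c → ∃ f, f ≤ R ∧ IsSetCode f ∧ ∀ z, Mem z f ↔ Q a z) :
    ∃ Z, Z ≤ G ∧ IsSetCode Z ∧ ∀ z, Mem z Z ↔ ∃ a, Mem a c ∧ Q a z := by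
  obtain ⟨X, Y, t, rfl, h⟩ := isSetCode_iff.1 hc
  have htS : t ≤ S := by
    have ht : t ≤ Y := by
      obtain ⟨Z, _, rfl⟩ := h.top
      exact le_self_add
    exact (ht.trans (le_pair_right X Y)).trans hcS
  -- The binary logarithm i of the current mark bounds the number of blocks passed. Each union
  -- multiplies the code by at most R⁴ = exp(4r), so exp(4·r·i) bounds the partial union.
  have hP : D0Pred (fun v => ∃ i, i ≤ s ∧ ∃ g, g ≤ G ∧ Exp i v ∧ Exp (4 * r * i) g ∧ ∃ Z, Z ≤ g ∧
      IsSetCode Z ∧ ∀ z, z ≤ G + R → (Mem z Z ↔ ∃ u', u' ≤ Y ∧ ∃ v', v' ≤ Y ∧ ∃ a, a ≤ X ∧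
        Entry X Y u' v' a ∧ v' ≤ v ∧ Q a z)) := fun n i => by
    have := hQ (n + 7) (Fin.last (n + 7)) (Fin.last (n + 4)).castSucc.castSucc.castSucc
    infer_instance
  have hQR : ∀ {a z}, Mem a (pair X Y) → Q a z → z ≤ R := fun ha hq => by
    obtain ⟨f, hf, _, h1⟩ := hF _ ha
    exact ((h1 _).2 hq).le.trans hf
  have key := h.toChain.induct hP
    ⟨0, zero_le, 1, hG.pos |> one_le_of_pos, exp_zero, by rw [mul_zero]; exact exp_zero, 1, le_rfl,
      isEmptyCode_one.1, fun z _ => ?_⟩ (fun u v a he => ?_) h.toChain.bit_top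
  · obtain ⟨i, hi, g, hg, _, hg', Z, hZ, hs, hm⟩ := key
    refine ⟨Z, hZ.trans hg, hs, fun z => ?_⟩
    constructor
    · intro hz
      obtain ⟨u', _, v', _, a, _, h1, _, h2⟩ :=
        (hm z (hz.le.trans ((hZ.trans hg).trans le_self_add))).1 hz
      exact ⟨a, mem_pair.2 ⟨u', v', h1⟩, h2⟩
    · rintro ⟨a, ha, hq⟩
      obtain ⟨u', v', h1⟩ := mem_pair.1 ha
      exact (hm z ((hQR ha hq).trans le_add_self)).2 ⟨u', h1.le.1, v', h1.le.2.1, a, h1.le.2.2,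
        h1, h.toChain.le_top h1.2.1, hq⟩
  · refine ⟨fun hz => absurd hz (isEmptyCode_one.2 z), ?_⟩
    rintro ⟨u', _, v', _, a, _, h1, h2, _⟩
    exact absurd (h1.1.pow2.one_le.trans_lt h1.lt) (not_lt.2 h2)
  · rintro ⟨i, hi, g, hg, hiu, hig, Z, hZ, hs, hm⟩
    have ha : Mem a (pair X Y) := mem_pair.2 ⟨u, v, he⟩
    obtain ⟨f, hf, hfs, hfm⟩ := hF a ha
    obtain ⟨i', hi', hiv⟩ := hS.exists_log he.2.1.pow2 ((h.toChain.le_top he.2.1).trans htS)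
    have hii : i + 1 ≤ i' := by
      rw [← lt_iff_succ_le]
      by_contra hn
      exact absurd (hiv.mono hiu (not_lt.1 hn)) (not_le.2 he.lt)
    obtain ⟨g', hg', hig'⟩ := hG.exists_of_le (x' := 4 * r * i') (by gcongr)
    obtain ⟨Z', hu, hle⟩ := exists_union hs hfs
    refine ⟨i', hi', g', hg', hiv, hig', Z', ?_, hu.1, fun z hz => ?_⟩
    · calc Z' ≤ g * R ^ 4 := hle.trans (by gcongr)
        _ ≤ g' := (hig.add hR.pow_four).mono hig' (by
          calc 4 * r * i + 4 * r = 4 * r * (i + 1) := by ring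
            _ ≤ _ := by gcongr)
    · rw [hu.2, hm z hz, hfm]
      constructor
      · rintro (⟨u', h3, v', h4, b, h5, h6, h7, h8⟩ | h1)
        · exact ⟨u', h3, v', h4, b, h5, h6, h7.trans he.lt.le, h8⟩
        · exact ⟨u, he.le.1, v, he.le.2.1, a, he.le.2.2, he, le_rfl, h1⟩
      · rintro ⟨u', h3, v', h4, b, h5, h6, h7, h8⟩
        rcases (he.end_le_iff h6).1 h7 with h9 | ⟨_, _, rfl⟩
        · exact Or.inl ⟨u', h3, v', h4, b, h5, h6, h9, h8⟩
        · exact Or.inr h8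

/-- Comprehension for bounded formulas, for sets of small numbers. -/
theorem exists_comprehension {b G : M} (hG : Exp ((2 * b + 6) * b) G) {P : M → Prop}
    (hP : D0Pred P) : ∃ Z, Z ≤ G ∧ IsSetCode Z ∧ ∀ z, Mem z Z ↔ 0 < z ∧ z ≤ b ∧ P z := by
  -- Each insertion costs 40·(x+1)² ≤ 2⁶·(exp b)², that is 2b + 6 in the exponent.
  have hD : D0Pred (fun x => x ≤ b → ∃ g, g ≤ G ∧ Exp ((2 * b + 6) * x) g ∧ ∃ Z, Z ≤ g ∧
      IsSetCode Z ∧ ∀ z, z ≤ Z + x → (Mem z Z ↔ 0 < z ∧ z ≤ x ∧ P z)) := fun n i => by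
    have := hP (n + 3) (Fin.last (n + 3))
    infer_instance
  have key := hD.induct ?_ ?_ b le_rfl
  · obtain ⟨g, hg, _, Z, hZ, hs, hm⟩ := key
    refine ⟨Z, hZ.trans hg, hs, fun z => ⟨fun hz => (hm z (hz.le.trans le_self_add)).1 hz,
      fun hz => (hm z (hz.2.1.trans le_add_self)).2 hz⟩⟩
  · refine fun _ => ⟨1, one_le_of_pos hG.pos, by rw [mul_zero]; exact exp_zero, 1, le_rfl,
      isEmptyCode_one.1, fun z _ => ⟨fun hz => absurd hz (isEmptyCode_one.2 z), ?_⟩⟩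
    rintro ⟨h1, h2, _⟩
    exact absurd h1 (not_lt.2 h2)
  · intro x ih hx
    have hb : 1 ≤ b := le_add_self.trans hx
    obtain ⟨g, hg, hge, Z, hZ, hs, hm⟩ := ih (le_self_add.trans hx)
    obtain ⟨g', hg', hge'⟩ := hG.exists_of_le (x' := (2 * b + 6) * (x + 1)) (by gcongr)
    have hm' : ∀ z, Mem z Z ↔ 0 < z ∧ z ≤ x ∧ P z := fun z =>
      ⟨fun hz => (hm z (hz.le.trans le_self_add)).1 hz,
        fun hz => (hm z (hz.2.1.trans le_add_self)).2 hz⟩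
    by_cases hPx : P (x + 1)
    · obtain ⟨Z', hi, hle⟩ := exists_insert hs (pos_of_gt (lt_add_one x))
      refine ⟨g', hg', hge', Z', ?_, hi.1, fun z _ => ?_⟩
      · obtain ⟨B, _, hB⟩ := hG.exists_of_le (x' := b) (le_mul_of_pos' (pos_of_gt (lt_of_lt_of_le
          (lt_add_of_pos_left 5 one_pos) (by
            calc (1 : M) + 5 = 6 := by norm_num
              _ ≤ _ := le_add_self))))
        have h64 : Exp (6 : M) 64 := by
          have h0 := (((((exp_zero (M := M)).succ).succ).succ).succ).succ.succ
          convert h0 using 1 <;> norm_num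
        have hE := hge.add ((hB.add hB).add h64)
        calc Z' ≤ 40 * ((x + 1) * (x + 1)) * g := hle.trans (by gcongr)
          _ ≤ 64 * (B * B) * g := by
            have : x + 1 ≤ B := hx.trans hB.lt.le
            gcongr
            norm_num
          _ = g * (B * B * 64) := by ring
          _ ≤ g' := hE.mono hge' (le_of_eq (by ring))
      · rw [hi.2, hm']
        constructor
        · rintro (⟨h1, h2, h3⟩ | rfl)
          · exact ⟨h1, h2.trans le_self_add, h3⟩
          · exact ⟨pos_of_gt (lt_add_one x), le_rfl, hPx⟩
        · rintro ⟨h1, h2, h3⟩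
          rcases h2.lt_or_eq with h4 | h4
          · exact Or.inl ⟨h1, lt_add_one_iff'.1 h4, h3⟩
          · exact Or.inr h4
    · refine ⟨g', hg', hge', Z, hZ.trans (hge.mono hge' (by gcongr; exact le_self_add)), hs,
        fun z _ => ?_⟩
      rw [hm']
      refine and_congr_right fun _ => ⟨fun h => ⟨h.1.trans le_self_add, h.2⟩, fun h => ?_⟩
      rcases h.1.lt_or_eq with h4 | rfl
      · exact ⟨lt_add_one_iff'.1 h4, h.2⟩
      · exact absurd h.2 hPx

/-- A bound on the code of a set of small numbers. -/
theorem IsSetCode.le_of_forall_le {c b G : M} (hc : IsSetCode c) (hb : ∀ z, Mem z c → z ≤ b)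
    (hG : Exp ((b + 1) * b) G) : c ≤ 10 * (G * G) := by
  obtain ⟨X, Y, t, rfl, h⟩ := isSetCode_iff.1 hc
  -- A block a stretches the top mark by at most 2a ≤ exp(b+1). Blocks increase, so the block before
  -- a is at most a - 1, and the mark after a is at most exp((b+1)·a).
  have hP : D0Pred (fun v => v = 1 ∨ ∀ u, u ≤ Y → ∀ a, a ≤ X → Entry X Y u v a →
      ∃ g, g ≤ G ∧ Exp ((b + 1) * a) g ∧ v ≤ g) := fun _ _ => inferInstance
  have key := h.toChain.induct hP (Or.inl rfl) (fun u v a he ih => ?_) h.toChain.bit_top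
  · refine h.code_le.1.trans ?_
    have ht : t ≤ G := by
      rcases key with rfl | key
      · exact one_le_of_pos hG.pos
      · by_cases ht1 : t = 1
        · rw [ht1]; exact one_le_of_pos hG.pos
        · obtain ⟨u, a, he⟩ := h.toChain.exists_prev h.toChain.bit_top ht1
          obtain ⟨g, hg, _, htg⟩ := key u he.le.1 a he.le.2.2 he
          exact htg.trans hg
    gcongr
  · right
    intro u₁ _ a₁ _ he₁
    obtain ⟨rfl, rfl⟩ := he₁.left_unique he
    have hab : a₁ ≤ b := hb _ (mem_pair.2 ⟨_, _, he⟩)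
    have ha0 := h.pos he
    obtain ⟨g, hg, hge⟩ := hG.exists_of_le (x' := (b + 1) * a₁) (by gcongr)
    refine ⟨g, hg, hge, ?_⟩
    obtain ⟨W, _, hW⟩ := hge.exists_of_le (x' := b + 1) (le_mul_of_pos ha0)
    have h2bW : 2 * a₁ ≤ W := by
      obtain ⟨V, rfl, hV⟩ := hW.pred
      have := hab.trans hV.lt.le
      gcongr
    have hv : v ≤ W * u₁ := by
      calc v ≤ 2 * (a₁ * u₁) := h.full _ _ _ he
        _ = 2 * a₁ * u₁ := by ring
        _ ≤ _ := by gcongr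
    refine hv.trans ?_
    by_cases hu1 : u₁ = 1
    · rw [hu1, mul_one]
      exact hW.mono hge (le_mul_of_pos ha0)
    · obtain ⟨u', a', he'⟩ := h.toChain.exists_prev he.1 hu1
      rcases ih with h1 | ih
      · exact absurd h1 hu1
      · obtain ⟨g', _, hge', hu'⟩ := ih u' he'.le.1 a' he'.le.2.2 he'
        calc W * u₁ ≤ W * g' := by gcongr
          _ ≤ g := (hW.add hge').mono hge (by
            calc b + 1 + (b + 1) * a' = (b + 1) * (a' + 1) := by ring
              _ ≤ _ := by gcongr; exact lt_iff_succ_le.1 (h.incr _ _ _ _ _ he' he))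

end SetOperations

/-! ### Words and concatenation -/

section Words

variable {M : Type*} [Model M]

/-- Some power of two lies between y and 2y + 1, which bounds the least one; minimality needs to be
tested only below p. -/
theorem cat_iff {x y z : M} : Cat x y z ↔ ∃ p, p ≤ 2 * y + 1 ∧ Pow2 p ∧ y < p ∧
    (∀ q, q ≤ p → Pow2 q → y < q → p ≤ q) ∧ z = x * p + y := by
  simp only [Cat, less_iff]
  constructor
  · rintro ⟨p, hp, hy, hm, h⟩
    obtain ⟨q, hq, h1, h2⟩ := lt_pow2_self y
    exact ⟨p, (hm q hq h1).trans h2, hp, hy, fun q _ => hm q, h⟩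
  · rintro ⟨p, _, hp, hy, hm, h⟩
    refine ⟨p, hp, hy, fun q hq hyq => ?_, h⟩
    by_contra hn
    exact hn (hm q (not_le.1 hn).le hq hyq)

theorem d0_cat : D0Pred₃ (Cat : M → M → M → Prop) := fun _ _ _ _ =>
  D0.of_iff (fun _ => cat_iff) inferInstance

instance D0.cat {n : ℕ} {t u s : (Fin (n + 1) → M) → M} [ht : Poly t] [hu : Poly u]
    [hs : Poly s] : D0 (fun v => Cat (t v) (u v) (s v)) := d0_cat.comp ht hu hs

theorem exists_cat (x y : M) : ∃ z, Cat x y z := by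
  obtain ⟨p, ⟨hp, hy⟩, hm⟩ := D0Pred.least (P := fun p => Pow2 p ∧ y < p) (fun _ _ => inferInstance)
    (by obtain ⟨q, hq, h1, _⟩ := lt_pow2_self y; exact ⟨q, hq, h1⟩)
  exact ⟨x * p + y, p, hp, less_iff.2 hy, fun q hq hyq => not_lt.1 fun hn =>
    hm q hn ⟨hq, less_iff.1 hyq⟩, rfl⟩

theorem Cat.unique {x y z z' : M} (h : Cat x y z) (h' : Cat x y z') : z = z' := by
  obtain ⟨p, hp, hy, hm, rfl⟩ := h
  obtain ⟨q, hq, hy', hm', rfl⟩ := h'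
  rw [le_antisymm (hm q hq hy') (hm' p hp hy)]

theorem Cat.le_left {x y z : M} (h : Cat x y z) : x ≤ z := by
  obtain ⟨p, hp, _, _, rfl⟩ := h
  exact (le_mul_of_pos hp.pos).trans le_self_add

theorem Cat.le_right {x y z : M} (h : Cat x y z) : y ≤ z := by
  obtain ⟨p, hp, _, _, rfl⟩ := h
  exact le_add_self

theorem Cat.lt_left {x y z : M} (h : Cat x y z) (hy : 0 < y) : x < z := by
  obtain ⟨p, hp, _, _, rfl⟩ := h
  exact (le_mul_of_pos hp.pos).trans_lt (lt_add_of_pos_right _ hy)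

theorem Cat.lt_right {x y z : M} (h : Cat x y z) (hx : 0 < x) : y < z := by
  obtain ⟨p, hp, _, _, rfl⟩ := h
  exact lt_add_of_pos_left _ (mul_pos hx hp.pos)

theorem Cat.bound {x y z : M} (h : Cat x y z) : z + 1 ≤ 2 * ((x + 1) * (y + 1)) := by
  obtain ⟨p, hp, _, _, _, rfl⟩ := cat_iff.1 h
  calc x * p + y + 1 ≤ x * (2 * y + 1) + y + 1 := by gcongr
    _ ≤ x * (2 * y + 1) + y + 1 + (x + y + 1) := le_self_add
    _ = _ := by ring

instance D0.word_nil {n : ℕ} {t : (Fin (n + 1) → M) → M} [Poly t] :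
    D0 (fun v => Word [] (t v)) :=
  D0.of_iff (Q := fun v => t v = 0) (fun _ => Iff.rfl) inferInstance

instance D0.word_cons {n : ℕ} {t f : (Fin (n + 1) → M) → M} {l : (Fin (n + 1) → M) → List M}
    [ht : Poly t] [hf : Poly f]
    [D0 (fun w : Fin (n + 2) → M => Word (l (fun i => w i.castSucc)) (w (Fin.last (n + 1))))] :
    D0 (fun v => Word (f v :: l v) (t v)) := by
  refine D0.of_iff (Q := fun v => ∃ w, w ≤ t v ∧ Word (l v) w ∧ Cat (f v) w (t v)) (fun v => ?_) ?_
  · exact ⟨fun ⟨w, h, h'⟩ => ⟨w, h'.le_right, h, h'⟩, fun ⟨w, _, h⟩ => ⟨w, h⟩⟩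
  · have := ht.weaken
    have := hf.weaken
    infer_instance

theorem exists_word (l : List M) : ∃ z, Word l z := by
  induction l with
  | nil => exact ⟨0, rfl⟩
  | cons x l ih =>
    obtain ⟨w, hw⟩ := ih
    obtain ⟨z, hz⟩ := exists_cat x w
    exact ⟨z, w, hw, hz⟩

theorem word_unique {l : List M} {z z' : M} (h : Word l z) (h' : Word l z') : z = z' := by
  induction l generalizing z z' with
  | nil => exact Eq.trans (b := (0 : M)) h (Eq.symm h')
  | cons x l ih =>
    obtain ⟨w, hw, hz⟩ := h
    obtain ⟨w', hw', hz'⟩ := h'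
    rw [ih hw' hw] at hz'
    exact hz.unique hz'

theorem Word.mem_le {l : List M} {x z : M} (h : Word l z) (hx : x ∈ l) : x ≤ z := by
  induction l generalizing z with
  | nil => simp at hx
  | cons y l ih =>
    obtain ⟨w, hw, hz⟩ := h
    rcases List.mem_cons.1 hx with rfl | h1
    · exact hz.le_left
    · exact (ih hw h1).trans hz.le_right

/-- A leading symbol makes every later component strictly smaller than the word, as required for
induction on words. -/
theorem Word.tail_lt {a : M} (ha : 0 < a) {l : List M} {x z : M} (h : Word (a :: l) z)
    (hx : x ∈ l) : x < z := by
  obtain ⟨w, hw, hz⟩ := h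
  exact (hw.mem_le hx).trans_lt (hz.lt_right ha)

theorem Word.pos {a : M} (ha : 0 < a) {l : List M} {z : M} (h : Word (a :: l) z) : 0 < z :=
  ha.trans_le (h.mem_le List.mem_cons_self)

/-- A bound on the concatenation of a list of words. -/
theorem Word.bound {b : M} {l : List M} (hl : ∀ x ∈ l, x ≤ b) {z : M} (h : Word l z) :
    z + 1 ≤ (2 * (b + 1)) ^ l.length := by
  induction l generalizing z with
  | nil =>
    have : z = 0 := h
    rw [this]; simp
  | cons x l ih =>
    obtain ⟨w, hw, hz⟩ := h
    have h1 := ih (fun y hy => hl y (List.mem_cons_of_mem x hy)) hw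
    have h2 := hl x List.mem_cons_self
    calc z + 1 ≤ 2 * ((x + 1) * (w + 1)) := hz.bound
      _ ≤ 2 * ((b + 1) * (2 * (b + 1)) ^ l.length) := by gcongr
      _ = _ := by rw [List.length_cons]; ring

theorem sym_pos (s : Symb) : (0 : M) < sym s := by
  rw [sym, num_eq]
  exact Nat.cast_pos.2 (by cases s <;> decide)

end Words

/-! ### Bounded definitions of the set operations -/

section SetCodeDefinability

variable {M : Type*} [Model M]

theorem d0_isEmptyCode : D0Pred (IsEmptyCode : M → Prop) := fun _ i =>
  D0.of_iff (Q := fun v => IsSetCode (v i) ∧ ∀ z, z ≤ v i → ¬ Mem z (v i))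
    (fun _ => and_congr_right fun _ => forall_congr' fun _ =>
      ⟨fun h _ => h, fun h hz => h hz.le hz⟩) inferInstance

instance D0.isEmptyCode {n : ℕ} {t : (Fin (n + 1) → M) → M} [ht : Poly t] :
    D0 (fun v => IsEmptyCode (t v)) := d0_isEmptyCode.comp ht

theorem d0_isSingletonCode : D0Pred₂ (IsSingletonCode : M → M → Prop) := fun n i j =>
  D0.of_iff (Q := fun v => IsSetCode (v i) ∧ ∀ z, z ≤ v i + v j → (Mem z (v i) ↔ z = v j))
    (fun _ => and_congr_right fun _ => forall_congr' fun z => by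
      refine ⟨fun h _ => h, fun h => ⟨fun hz => (h (hz.le.trans le_self_add)).1 hz, fun hz =>
        (h (hz.le.trans le_add_self)).2 hz⟩⟩) inferInstance

instance D0.isSingletonCode {n : ℕ} {t u : (Fin (n + 1) → M) → M} [ht : Poly t] [hu : Poly u] :
    D0 (fun v => IsSingletonCode (t v) (u v)) := d0_isSingletonCode.comp ht hu

theorem d0_isUnionCode : D0Pred₃ (IsUnionCode : M → M → M → Prop) := fun n i j k =>
  D0.of_iff (Q := fun v => IsSetCode (v i) ∧
    ∀ z, z ≤ v i + v j + v k → (Mem z (v i) ↔ Mem z (v j) ∨ Mem z (v k)))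
    (fun _ => and_congr_right fun _ => forall_congr' fun z => by
      refine ⟨fun h _ => h, fun h => ⟨fun hz => (h (hz.le.trans (le_self_add.trans
        le_self_add))).1 hz, fun hz => ?_⟩⟩
      refine (h ?_).2 hz
      rcases hz with hz | hz
      · exact hz.le.trans (le_add_self.trans le_self_add)
      · exact hz.le.trans le_add_self) inferInstance

instance D0.isUnionCode {n : ℕ} {t u s : (Fin (n + 1) → M) → M} [ht : Poly t] [hu : Poly u]
    [hs : Poly s] : D0 (fun v => IsUnionCode (t v) (u v) (s v)) := d0_isUnionCode.comp ht hu hs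

theorem d0_isInsertCode : D0Pred₃ (IsInsertCode : M → M → M → Prop) := fun n i j k =>
  D0.of_iff (Q := fun v => IsSetCode (v i) ∧
    ∀ z, z ≤ v i + v j + v k → (Mem z (v i) ↔ Mem z (v j) ∨ z = v k))
    (fun _ => and_congr_right fun _ => forall_congr' fun z => by
      refine ⟨fun h _ => h, fun h => ⟨fun hz => (h (hz.le.trans (le_self_add.trans
        le_self_add))).1 hz, fun hz => ?_⟩⟩
      refine (h ?_).2 hz
      rcases hz with hz | hz
      · exact hz.le.trans (le_add_self.trans le_self_add)
      · exact hz.le.trans le_add_self) inferInstance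

instance D0.isInsertCode {n : ℕ} {t u s : (Fin (n + 1) → M) → M} [ht : Poly t] [hu : Poly u]
    [hs : Poly s] : D0 (fun v => IsInsertCode (t v) (u v) (s v)) := d0_isInsertCode.comp ht hu hs

theorem d0_isEraseCode : D0Pred₃ (IsEraseCode : M → M → M → Prop) := fun n i j k =>
  D0.of_iff (Q := fun v => IsSetCode (v i) ∧
    ∀ z, z ≤ v i + v j → (Mem z (v i) ↔ Mem z (v j) ∧ z ≠ v k))
    (fun _ => and_congr_right fun _ => forall_congr' fun z => by
      refine ⟨fun h _ => h, fun h => ⟨fun hz => (h (hz.le.trans le_self_add)).1 hz, fun hz =>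
        (h (hz.1.le.trans le_add_self)).2 hz⟩⟩) inferInstance

instance D0.isEraseCode {n : ℕ} {t u s : (Fin (n + 1) → M) → M} [ht : Poly t] [hu : Poly u]
    [hs : Poly s] : D0 (fun v => IsEraseCode (t v) (u v) (s v)) := d0_isEraseCode.comp ht hu hs

end SetCodeDefinability

/-! ### Bounded definability of the formation rules -/

section Formation

variable {M : Type*} [Model M]

theorem num_inj {a b : ℕ} : (num a : M) = num b ↔ a = b := by
  rw [num_eq, num_eq, Nat.cast_inj]

instance Poly.varJ {n : ℕ} {t : (Fin (n + 1) → M) → M} [Poly t] : Poly (fun v => varJ (t v)) := by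
  unfold BA.varJ; infer_instance

instance Poly.termJ {n : ℕ} {t u : (Fin (n + 1) → M) → M} [Poly t] [Poly u] :
    Poly (fun v => termJ (t v) (u v)) := by
  unfold BA.termJ; infer_instance

instance Poly.formJ {n : ℕ} {t u : (Fin (n + 1) → M) → M} [Poly t] [Poly u] :
    Poly (fun v => formJ (t v) (u v)) := by
  unfold BA.formJ; infer_instance

instance Poly.argsJ {n : ℕ} {t u s : (Fin (n + 1) → M) → M} [Poly t] [Poly u] [Poly s] :
    Poly (fun v => argsJ (t v) (u v) (s v)) := by
  unfold BA.argsJ; infer_instance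

theorem le_varJ (x : M) : x ≤ varJ x := le_pair_right _ _

theorem le_judge (k x y : M) : x ≤ pair k (pair x y) ∧ y ≤ pair k (pair x y) :=
  ⟨(le_pair_left _ _).trans (le_pair_right _ _), (le_pair_right _ _).trans (le_pair_right _ _)⟩

theorem le_argsJ (U w V : M) : U ≤ argsJ U w V ∧ w ≤ argsJ U w V ∧ V ≤ argsJ U w V :=
  ⟨(le_judge _ _ _).1, (le_pair_left _ _).trans (le_judge _ _ _).2,
    (le_pair_right _ _).trans (le_judge _ _ _).2⟩

theorem Mem.judge_le {k x y d : M} (h : Mem (pair k (pair x y)) d) : x ≤ d ∧ y ≤ d :=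
  ⟨(le_judge _ _ _).1.trans h.le, (le_judge _ _ _).2.trans h.le⟩

theorem Mem.argsJ_le {U w V d : M} (h : Mem (argsJ U w V) d) : U ≤ d ∧ w ≤ d ∧ V ≤ d :=
  ⟨(le_argsJ _ _ _).1.trans h.le, (le_argsJ _ _ _).2.1.trans h.le, (le_argsJ _ _ _).2.2.trans h.le⟩

theorem Mem.varJ_le {x d : M} (h : Mem (varJ x) d) : x ≤ d := (le_varJ x).trans h.le

/-- The rules that prefix a symbol to a variable. -/
def VarShape (s : Symb) (D : M → Prop) (z : M) : Prop :=
  ∃ x y, D (varJ x) ∧ Word [sym s, x] y ∧ z = varJ y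

/-- The rules that prefix a symbol to a term or formula. -/
def UnaryShape (k : ℕ) (s : Symb) (D : M → Prop) (z : M) : Prop :=
  ∃ t V y, D (pair (num k) (pair t V)) ∧ Word [sym s, t] y ∧ z = pair (num k) (pair y V)

/-- The rules that combine two terms or formulas. -/
def BinaryShape (k k' : ℕ) (s : Symb) (D : M → Prop) (z : M) : Prop :=
  ∃ t V u W Z y, D (pair (num k) (pair t V)) ∧ D (pair (num k) (pair u W)) ∧ IsUnionCode Z V W ∧
    Word [sym s, t, u] y ∧ z = pair (num k') (pair y Z)

/-- The rules for quantifiers. -/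
def QuantShape (s : Symb) (D : M → Prop) (z : M) : Prop :=
  ∃ x φ V U y, D (varJ x) ∧ D (formJ φ V) ∧ IsEraseCode U V x ∧ Word [sym s, x, φ] y ∧
    z = formJ y U

/-- The rule for Skolem terms. -/
def SkolemShape (D : M → Prop) (z : M) : Prop :=
  ∃ x ψ V U w W y, D (varJ x) ∧ D (formJ ψ V) ∧ IsEraseCode U V x ∧ D (argsJ U w W) ∧
    Word [sym .sk, sym .ex, x, ψ, w] y ∧ z = termJ y W

/-- The rule that extends a list of arguments. -/
def ConsShape (D : M → Prop) (z : M) : Prop :=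
  ∃ U w V t W U' v Z w', D (argsJ U w V) ∧ D (termJ t W) ∧ ¬ Mem v U ∧ IsInsertCode U' U v ∧
    IsUnionCode Z V W ∧ Word [w, t] w' ∧ z = argsJ U' w' Z

/-- Nineteen rules are grouped into a few shapes, so that definability is proved once for each
shape. -/
theorem formationRule_iff {D : M → Prop} {z : M} : FormationRule D z ↔
    (∃ x, Word [sym .v] x ∧ z = varJ x) ∨ VarShape .a D z ∨ VarShape .b D z ∨
    (∃ x V, D (varJ x) ∧ IsSingletonCode V x ∧ z = termJ x V) ∨
    (∃ y V, Word [sym .zero] y ∧ IsEmptyCode V ∧ z = termJ y V) ∨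
    UnaryShape 2 .succ D z ∨ BinaryShape 2 2 .add D z ∨ BinaryShape 2 2 .mul D z ∨
    SkolemShape D z ∨ (∃ U V, IsEmptyCode U ∧ IsEmptyCode V ∧ z = argsJ U 0 V) ∨ ConsShape D z ∨
    BinaryShape 2 3 .eq D z ∨ BinaryShape 2 3 .le D z ∨ UnaryShape 3 .not D z ∨
    BinaryShape 3 3 .and D z ∨ BinaryShape 3 3 .or D z ∨ BinaryShape 3 3 .imp D z ∨
    QuantShape .all D z ∨ QuantShape .ex D z := by
  constructor
  · rintro (h | ⟨h, h'⟩ | ⟨h, h'⟩ | ⟨h, h'⟩ | ⟨h, h'⟩ | ⟨h, h'⟩ | ⟨h₁, h₂, h₃, h₄⟩ | ⟨h₁, h₂, h₃, h₄⟩ |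
      ⟨h₁, h₂, h₃, h₄, h₅⟩ | ⟨h, h'⟩ | ⟨h₁, h₂, h₃, h₄, h₅, h₆⟩ | ⟨h₁, h₂, h₃, h₄⟩ |
      ⟨h₁, h₂, h₃, h₄⟩ | ⟨h, h'⟩ | ⟨h₁, h₂, h₃, h₄⟩ | ⟨h₁, h₂, h₃, h₄⟩ | ⟨h₁, h₂, h₃, h₄⟩ |
      ⟨h₁, h₂, h₃, h₄⟩ | ⟨h₁, h₂, h₃, h₄⟩)
    · left; exact ⟨_, h, rfl⟩
    · iterate 1 right
      left; exact ⟨_, _, h, h', rfl⟩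
    · iterate 2 right
      left; exact ⟨_, _, h, h', rfl⟩
    · iterate 3 right
      left; exact ⟨_, _, h, h', rfl⟩
    · iterate 4 right
      left; exact ⟨_, _, h, h', rfl⟩
    · iterate 5 right
      left; exact ⟨_, _, _, h, h', rfl⟩
    · iterate 6 right
      left; exact ⟨_, _, _, _, _, _, h₁, h₂, h₃, h₄, rfl⟩
    · iterate 7 right
      left; exact ⟨_, _, _, _, _, _, h₁, h₂, h₃, h₄, rfl⟩
    · iterate 8 right
      left; exact ⟨_, _, _, _, _, _, _, h₁, h₂, h₃, h₄, h₅, rfl⟩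
    · iterate 9 right
      left; exact ⟨_, _, h, h', rfl⟩
    · iterate 10 right
      left; exact ⟨_, _, _, _, _, _, _, _, _, h₁, h₄, h₂, h₃, h₅, h₆, rfl⟩
    · iterate 11 right
      left; exact ⟨_, _, _, _, _, _, h₁, h₂, h₃, h₄, rfl⟩
    · iterate 12 right
      left; exact ⟨_, _, _, _, _, _, h₁, h₂, h₃, h₄, rfl⟩
    · iterate 13 right
      left; exact ⟨_, _, _, h, h', rfl⟩
    · iterate 14 right
      left; exact ⟨_, _, _, _, _, _, h₁, h₂, h₃, h₄, rfl⟩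
    · iterate 15 right
      left; exact ⟨_, _, _, _, _, _, h₁, h₂, h₃, h₄, rfl⟩
    · iterate 16 right
      left; exact ⟨_, _, _, _, _, _, h₁, h₂, h₃, h₄, rfl⟩
    · iterate 17 right
      left; exact ⟨_, _, _, _, _, h₁, h₂, h₃, h₄, rfl⟩
    · iterate 18 right
      exact ⟨_, _, _, _, _, h₁, h₂, h₃, h₄, rfl⟩
  · rintro (⟨_, h, rfl⟩ | ⟨_, _, h, h', rfl⟩ | ⟨_, _, h, h', rfl⟩ | ⟨_, _, h, h', rfl⟩ |
      ⟨_, _, h, h', rfl⟩ | ⟨_, _, _, h, h', rfl⟩ | ⟨_, _, _, _, _, _, h₁, h₂, h₃, h₄, rfl⟩ |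
      ⟨_, _, _, _, _, _, h₁, h₂, h₃, h₄, rfl⟩ | ⟨_, _, _, _, _, _, _, h₁, h₂, h₃, h₄, h₅, rfl⟩ |
      ⟨_, _, h, h', rfl⟩ | ⟨_, _, _, _, _, _, _, _, _, h₁, h₄, h₂, h₃, h₅, h₆, rfl⟩ |
      ⟨_, _, _, _, _, _, h₁, h₂, h₃, h₄, rfl⟩ | ⟨_, _, _, _, _, _, h₁, h₂, h₃, h₄, rfl⟩ |
      ⟨_, _, _, h, h', rfl⟩ | ⟨_, _, _, _, _, _, h₁, h₂, h₃, h₄, rfl⟩ |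
      ⟨_, _, _, _, _, _, h₁, h₂, h₃, h₄, rfl⟩ | ⟨_, _, _, _, _, _, h₁, h₂, h₃, h₄, rfl⟩ |
      ⟨_, _, _, _, _, h₁, h₂, h₃, h₄, rfl⟩ | ⟨_, _, _, _, _, h₁, h₂, h₃, h₄, rfl⟩)
    · exact .var h
    · exact .varA h h'
    · exact .varB h h'
    · exact .termVar h h'
    · exact .termZero h h'
    · exact .termSucc h h'
    · exact .termAdd h₁ h₂ h₃ h₄
    · exact .termMul h₁ h₂ h₃ h₄
    · exact .termSkolem h₁ h₂ h₃ h₄ h₅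
    · exact .argsNil h h'
    · exact .argsCons h₁ h₂ h₃ h₄ h₅ h₆
    · exact .formEq h₁ h₂ h₃ h₄
    · exact .formLe h₁ h₂ h₃ h₄
    · exact .formNot h h'
    · exact .formAnd h₁ h₂ h₃ h₄
    · exact .formOr h₁ h₂ h₃ h₄
    · exact .formImp h₁ h₂ h₃ h₄
    · exact .formAll h₁ h₂ h₃ h₄
    · exact .formEx h₁ h₂ h₃ h₄

section Definability

variable {n : ℕ} (i j : Fin (n + 1))

theorem d0_varBase : D0 (fun v : Fin (n + 1) → M => ∃ x, Word [sym .v] x ∧ v j = varJ x) :=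
  D0.ex_of_bound (fun v => v j) (fun v x h => by rw [h.2]; exact le_varJ x) inferInstance

instance d0_varShape (s : Symb) :
    D0 (fun v : Fin (n + 1) → M => VarShape s (fun z => Mem z (v i)) (v j)) :=
  D0.of_iff (Q := fun v => ∃ x, x ≤ v i ∧ ∃ y, y ≤ v j ∧ Mem (varJ x) (v i) ∧ Word [sym s, x] y ∧
    v j = varJ y) (fun v => ⟨fun ⟨x, y, h, h', h''⟩ => ⟨x, h.varJ_le, y, by
      rw [h'']; exact le_varJ y, h, h', h''⟩, fun ⟨x, _, y, _, h⟩ => ⟨x, y, h⟩⟩) inferInstance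

instance d0_termVar : D0 (fun v : Fin (n + 1) → M =>
    ∃ x V, Mem (varJ x) (v i) ∧ IsSingletonCode V x ∧ v j = termJ x V) :=
  D0.of_iff (Q := fun v => ∃ x, x ≤ v j ∧ ∃ V, V ≤ v j ∧ Mem (varJ x) (v i) ∧
    IsSingletonCode V x ∧ v j = termJ x V) (fun v => ⟨fun ⟨x, y, h, h', h''⟩ => ⟨x, by
      rw [h'']; exact (le_judge _ _ _).1, y, by rw [h'']; exact (le_judge _ _ _).2, h, h', h''⟩,
      fun ⟨x, _, y, _, h⟩ => ⟨x, y, h⟩⟩) inferInstance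

instance d0_termZero : D0 (fun v : Fin (n + 1) → M =>
    ∃ y V, Word [sym .zero] y ∧ IsEmptyCode V ∧ v j = termJ y V) :=
  D0.of_iff (Q := fun v => ∃ y, y ≤ v j ∧ ∃ V, V ≤ v j ∧ Word [sym .zero] y ∧
    IsEmptyCode V ∧ v j = termJ y V) (fun v => ⟨fun ⟨x, y, h, h', h''⟩ => ⟨x, by
      rw [h'']; exact (le_judge _ _ _).1, y, by rw [h'']; exact (le_judge _ _ _).2, h, h', h''⟩,
      fun ⟨x, _, y, _, h⟩ => ⟨x, y, h⟩⟩) inferInstance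

instance d0_unaryShape (k : ℕ) (s : Symb) :
    D0 (fun v : Fin (n + 1) → M => UnaryShape k s (fun z => Mem z (v i)) (v j)) :=
  D0.of_iff (Q := fun v => ∃ t, t ≤ v i ∧ ∃ V, V ≤ v i ∧ ∃ y, y ≤ v j ∧
    Mem (pair (num k) (pair t V)) (v i) ∧ Word [sym s, t] y ∧ v j = pair (num k) (pair y V))
    (fun v => ⟨fun ⟨t, V, y, h, h', h''⟩ => ⟨t, h.judge_le.1, V, h.judge_le.2, y, by
      rw [h'']; exact (le_judge _ _ _).1, h, h', h''⟩,
      fun ⟨t, _, V, _, y, _, h⟩ => ⟨t, V, y, h⟩⟩) inferInstance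

instance d0_binaryShape (k k' : ℕ) (s : Symb) :
    D0 (fun v : Fin (n + 1) → M => BinaryShape k k' s (fun z => Mem z (v i)) (v j)) :=
  D0.of_iff (Q := fun v => ∃ t, t ≤ v i ∧ ∃ V, V ≤ v i ∧ ∃ u, u ≤ v i ∧ ∃ W, W ≤ v i ∧
    ∃ Z, Z ≤ v j ∧ ∃ y, y ≤ v j ∧ Mem (pair (num k) (pair t V)) (v i) ∧
    Mem (pair (num k) (pair u W)) (v i) ∧ IsUnionCode Z V W ∧ Word [sym s, t, u] y ∧
    v j = pair (num k') (pair y Z))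
    (fun v => ⟨fun ⟨t, V, u, W, Z, y, h₁, h₂, h₃, h₄, h₅⟩ => ⟨t, h₁.judge_le.1, V, h₁.judge_le.2, u,
      h₂.judge_le.1, W, h₂.judge_le.2, Z, by rw [h₅]; exact (le_judge _ _ _).2, y, by
      rw [h₅]; exact (le_judge _ _ _).1, h₁, h₂, h₃, h₄, h₅⟩,
      fun ⟨t, _, V, _, u, _, W, _, Z, _, y, _, h⟩ => ⟨t, V, u, W, Z, y, h⟩⟩) inferInstance

instance d0_quantShape (s : Symb) :
    D0 (fun v : Fin (n + 1) → M => QuantShape s (fun z => Mem z (v i)) (v j)) :=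
  D0.of_iff (Q := fun v => ∃ x, x ≤ v i ∧ ∃ φ, φ ≤ v i ∧ ∃ V, V ≤ v i ∧ ∃ U, U ≤ v j ∧
    ∃ y, y ≤ v j ∧ Mem (varJ x) (v i) ∧ Mem (formJ φ V) (v i) ∧ IsEraseCode U V x ∧
    Word [sym s, x, φ] y ∧ v j = formJ y U)
    (fun v => ⟨fun ⟨x, φ, V, U, y, h₁, h₂, h₃, h₄, h₅⟩ => ⟨x, h₁.varJ_le, φ, h₂.judge_le.1, V,
      h₂.judge_le.2, U, by rw [h₅]; exact (le_judge _ _ _).2, y, by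
      rw [h₅]; exact (le_judge _ _ _).1, h₁, h₂, h₃, h₄, h₅⟩,
      fun ⟨x, _, φ, _, V, _, U, _, y, _, h⟩ => ⟨x, φ, V, U, y, h⟩⟩) inferInstance

instance d0_skolemShape :
    D0 (fun v : Fin (n + 1) → M => SkolemShape (fun z => Mem z (v i)) (v j)) :=
  D0.of_iff (Q := fun v => ∃ x, x ≤ v i ∧ ∃ ψ, ψ ≤ v i ∧ ∃ V, V ≤ v i ∧ ∃ U, U ≤ v i ∧
    ∃ w, w ≤ v i ∧ ∃ W, W ≤ v i ∧ ∃ y, y ≤ v j ∧ Mem (varJ x) (v i) ∧ Mem (formJ ψ V) (v i) ∧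
    IsEraseCode U V x ∧ Mem (argsJ U w W) (v i) ∧ Word [sym .sk, sym .ex, x, ψ, w] y ∧
    v j = termJ y W)
    (fun v => ⟨fun ⟨x, ψ, V, U, w, W, y, h₁, h₂, h₃, h₄, h₅, h₆⟩ => ⟨x, h₁.varJ_le, ψ,
      h₂.judge_le.1, V, h₂.judge_le.2, U, h₄.argsJ_le.1, w, h₄.argsJ_le.2.1, W, h₄.argsJ_le.2.2, y,
      by rw [h₆]; exact (le_judge _ _ _).1, h₁, h₂, h₃, h₄, h₅, h₆⟩,
      fun ⟨x, _, ψ, _, V, _, U, _, w, _, W, _, y, _, h⟩ => ⟨x, ψ, V, U, w, W, y, h⟩⟩) inferInstance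

instance d0_argsNil : D0 (fun v : Fin (n + 1) → M =>
    ∃ U V, IsEmptyCode U ∧ IsEmptyCode V ∧ v j = argsJ U 0 V) :=
  D0.of_iff (Q := fun v => ∃ U, U ≤ v j ∧ ∃ V, V ≤ v j ∧ IsEmptyCode U ∧ IsEmptyCode V ∧
    v j = argsJ U 0 V) (fun v => ⟨fun ⟨x, y, h, h', h''⟩ => ⟨x, by
      rw [h'']; exact (le_argsJ _ _ _).1, y, by rw [h'']; exact (le_argsJ _ _ _).2.2, h, h', h''⟩,
      fun ⟨x, _, y, _, h⟩ => ⟨x, y, h⟩⟩) inferInstance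

instance d0_consShape :
    D0 (fun v : Fin (n + 1) → M => ConsShape (fun z => Mem z (v i)) (v j)) :=
  D0.of_iff (Q := fun e => ∃ U, U ≤ e i ∧ ∃ w, w ≤ e i ∧ ∃ V, V ≤ e i ∧ ∃ t, t ≤ e i ∧
    ∃ W, W ≤ e i ∧ ∃ U', U' ≤ e j ∧ ∃ v, v ≤ e j ∧ ∃ Z, Z ≤ e j ∧ ∃ w', w' ≤ e j ∧
    Mem (argsJ U w V) (e i) ∧ Mem (termJ t W) (e i) ∧ ¬ Mem v U ∧ IsInsertCode U' U v ∧
    IsUnionCode Z V W ∧ Word [w, t] w' ∧ e j = argsJ U' w' Z)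
    (fun e => ⟨fun ⟨U, w, V, t, W, U', v, Z, w', h₁, h₂, h₃, h₄, h₅, h₆, h₇⟩ => ⟨U, h₁.argsJ_le.1,
      w, h₁.argsJ_le.2.1, V, h₁.argsJ_le.2.2, t, h₂.judge_le.1, W, h₂.judge_le.2, U', by
      rw [h₇]; exact (le_argsJ _ _ _).1, v, (by
      rw [h₇]; exact ((h₄.2 v).2 (Or.inr rfl)).le.trans (le_argsJ _ _ _).1), Z, by
      rw [h₇]; exact (le_argsJ _ _ _).2.2, w', by rw [h₇]; exact (le_argsJ _ _ _).2.1,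
      h₁, h₂, h₃, h₄, h₅, h₆, h₇⟩,
      fun ⟨U, _, w, _, V, _, t, _, W, _, U', _, v, _, Z, _, w', _, h⟩ =>
        ⟨U, w, V, t, W, U', v, Z, w', h⟩⟩) inferInstance

end Definability

/-- Components of premises lie below d and components of the conclusion below z, so every
existential quantifier in the rules is bounded. -/
theorem d0_formationRule : D0Pred₂ (fun d z : M => FormationRule (fun y => Mem y d) z) :=
  fun n i j => by
  refine D0.of_iff (fun v => formationRule_iff) ?_
  have := d0_varBase (M := M) j
  infer_instance

end Formation

/-! ### Bounding derivations of formation judgements -/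

section FormationBounds

variable {M : Type*} [Model M]

/-- `V` is the code of a set of numbers that are at most `s`. -/
def SetBelow (V s : M) : Prop := IsSetCode V ∧ ∀ x, Mem x V → x ≤ s

theorem d0_setBelow : D0Pred₂ (SetBelow : M → M → Prop) := fun _ i j =>
  D0.of_iff (Q := fun v => IsSetCode (v i) ∧ ∀ x, x ≤ v i → Mem x (v i) → x ≤ v j)
    (fun _ => and_congr_right fun _ => forall_congr' fun _ =>
      ⟨fun h _ => h, fun h hz => h hz.le hz⟩) inferInstance

instance D0.setBelow {n : ℕ} {t u : (Fin (n + 1) → M) → M} [ht : Poly t] [hu : Poly u] :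
    D0 (fun v => SetBelow (t v) (u v)) := d0_setBelow.comp ht hu

theorem SetBelow.mono {V s s' : M} (h : SetBelow V s) (hs : s ≤ s') : SetBelow V s' :=
  ⟨h.1, fun x hx => (h.2 x hx).trans hs⟩

theorem SetBelow.union {V W Z s : M} (h : SetBelow V s) (h' : SetBelow W s)
    (hZ : IsUnionCode Z V W) : SetBelow Z s :=
  ⟨hZ.1, fun x hx => ((hZ.2 x).1 hx).elim (h.2 x) (h'.2 x)⟩

theorem SetBelow.erase {V U x s : M} (h : SetBelow V s) (hU : IsEraseCode U V x) : SetBelow U s :=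
  ⟨hU.1, fun z hz => h.2 z ((hU.2 z).1 hz).1⟩

theorem IsEmptyCode.setBelow {V : M} (h : IsEmptyCode V) (s : M) : SetBelow V s :=
  ⟨h.1, fun x hx => absurd hx (h.2 x)⟩

theorem varRule_pos {D : M → Prop} {x : M} (h : FormationRule D (varJ x)) : 0 < x := by
  generalize hz : varJ x = z at h
  cases h
  case var h =>
    simp only [varJ, pair_inj] at hz
    rw [hz.2]; exact h.pos (sym_pos _)
  case varA _ h | varB _ h =>
    simp only [varJ, pair_inj] at hz
    rw [hz.2]; exact h.pos (sym_pos _)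
  all_goals simp [varJ, termJ, formJ, argsJ, pair_inj, num_inj] at hz

/-- Terms are non-empty words; hence appending a term to an argument list strictly increases its
code. -/
theorem termRule_pos {D : M → Prop} (hD : ∀ x, D (varJ x) → 0 < x) {t V : M}
    (h : FormationRule D (termJ t V)) : 0 < t := by
  generalize hz : termJ t V = z at h
  cases h
  case termVar h _ =>
    simp only [termJ, pair_inj] at hz
    rw [hz.2.1]; exact hD _ h
  case termZero h _ =>
    simp only [termJ, pair_inj] at hz
    rw [hz.2.1]; exact h.pos (sym_pos _)
  case termSucc _ h | termAdd _ _ _ h | termMul _ _ _ h | termSkolem _ _ _ _ h =>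
    simp only [termJ, pair_inj] at hz
    rw [hz.2.1]; exact h.pos (sym_pos _)
  all_goals simp [varJ, termJ, formJ, argsJ, pair_inj, num_inj] at hz

/-- In a derivation, the sets in judgements about the word `s` consist of numbers below `s`. -/
def SetsBelow (d s : M) : Prop :=
  (∀ V, V ≤ d → Mem (termJ s V) d → SetBelow V s) ∧
  (∀ V, V ≤ d → Mem (formJ s V) d → SetBelow V s) ∧
  ∀ U, U ≤ d → ∀ V, V ≤ d → Mem (argsJ U s V) d → IsSetCode U ∧ SetBelow V s

/-- Variables of a word are subwords of it. Compound words inherit their set from proper subwords; a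
variable taken as a term has only itself. -/
theorem setsBelow_of_rule {d s : M} (ih : ∀ s', s' < s → SetsBelow d s') {k : ℕ}
    (hk : k = 2 ∨ k = 3) {V : M}
    (h : FormationRule (fun z => Mem z d) (pair (num k) (pair s V))) : SetBelow V s := by
  have hT : ∀ {t V}, t < s → Mem (termJ t V) d → SetBelow V s := fun ht h =>
    ((ih _ ht).1 _ h.judge_le.2 h).mono ht.le
  have hF : ∀ {t V}, t < s → Mem (formJ t V) d → SetBelow V s := fun ht h =>
    ((ih _ ht).2.1 _ h.judge_le.2 h).mono ht.le
  have hA : ∀ {w U V}, w < s → Mem (argsJ U w V) d → SetBelow V s := fun ht h =>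
    ((ih _ ht).2.2 _ h.argsJ_le.1 _ h.argsJ_le.2.2 h).2.mono ht.le
  generalize hz : pair (num k) (pair s V) = z at h
  cases h
  case termVar h h' =>
    obtain ⟨_, rfl, rfl⟩ := by simpa only [termJ, pair_inj] using hz
    exact ⟨h'.1, fun x hx => ((h'.2 x).1 hx).le⟩
  case termZero h h' =>
    obtain ⟨_, rfl, rfl⟩ := by simpa only [termJ, pair_inj] using hz
    exact h'.setBelow s
  case termSucc h h' =>
    obtain ⟨_, rfl, rfl⟩ := by simpa only [termJ, pair_inj] using hz
    exact hT (h'.tail_lt (sym_pos _) (by simp)) h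
  case formNot h h' =>
    obtain ⟨_, rfl, rfl⟩ := by simpa only [formJ, pair_inj] using hz
    exact hF (h'.tail_lt (sym_pos _) (by simp)) h
  case termAdd h h' hu hw | termMul h h' hu hw | formEq h h' hu hw | formLe h h' hu hw =>
    obtain ⟨_, rfl, rfl⟩ := by simpa only [termJ, formJ, pair_inj] using hz
    exact (hT (hw.tail_lt (sym_pos _) (by simp)) h).union
      (hT (hw.tail_lt (sym_pos _) (by simp)) h') hu
  case formAnd h h' hu hw | formOr h h' hu hw | formImp h h' hu hw =>
    obtain ⟨_, rfl, rfl⟩ := by simpa only [termJ, formJ, pair_inj] using hz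
    exact (hF (hw.tail_lt (sym_pos _) (by simp)) h).union
      (hF (hw.tail_lt (sym_pos _) (by simp)) h') hu
  case termSkolem _ _ _ h hw =>
    obtain ⟨_, rfl, rfl⟩ := by simpa only [termJ, formJ, pair_inj] using hz
    exact hA (hw.tail_lt (sym_pos _) (by simp)) h
  case formAll _ h he hw | formEx _ h he hw =>
    obtain ⟨_, rfl, rfl⟩ := by simpa only [termJ, formJ, pair_inj] using hz
    exact (hF (hw.tail_lt (sym_pos _) (by simp)) h).erase he
  all_goals
    have h1 := (pair_inj.1 hz).1
    rw [num_inj] at h1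
    omega

theorem IsDer.setsBelow {d : M} (hd : IsDer FormationRule d) (s : M) : SetsBelow d s := by
  have hD : D0Pred (SetsBelow d) := fun n i => by
    unfold SetsBelow
    infer_instance
  refine hD.strong (fun s ih => ?_) s
  have hT : ∀ V, Mem (termJ s V) d → SetBelow V s := fun V hm =>
    setsBelow_of_rule ih (Or.inl rfl) (hd.2 _ hm)
  refine ⟨fun V _ => hT V, fun V _ hm => setsBelow_of_rule ih (Or.inr rfl) (hd.2 _ hm),
    fun U _ V _ hm => ?_⟩
  have h := hd.2 _ hm
  generalize hz : argsJ U s V = z at h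
  cases h
  case argsNil h h' =>
    obtain ⟨_, rfl, rfl, rfl⟩ := by simpa only [argsJ, pair_inj] using hz
    exact ⟨h.1, h'.setBelow _⟩
  case argsCons h hv hi ht hu hw =>
    obtain ⟨_, rfl, rfl, rfl⟩ := by simpa only [argsJ, pair_inj] using hz
    have htp := termRule_pos (fun x hx => varRule_pos (hd.2 _ hx)) (hd.2 _ ht)
    obtain ⟨t', hw', hc⟩ := hw
    obtain ⟨w₀, hw₀, hc'⟩ := hw'
    have ht' := hc'.le_left
    have h1 := hc.lt_left (htp.trans_le ht')
    refine ⟨hi.1, SetBelow.union (((ih _ h1).2.2 _ h.argsJ_le.1 _ h.argsJ_le.2.2 h).2.mono h1.le)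
      ?_ hu⟩
    -- The last argument may be the whole word s, and the induction hypothesis is then not
    -- available; therefore terms of code s were settled first, in `hT`.
    rcases (ht'.trans hc.le_right).lt_or_eq with h2 | h2
    · exact ((ih _ h2).1 _ ht.judge_le.2 ht).mono h2.le
    · rw [h2] at ht
      exact hT _ ht
  all_goals simp [varJ, termJ, formJ, argsJ, pair_inj, num_inj] at hz

/-- `z` is a judgement about words and sets of numbers below `j`. -/
def SmallJ (j z : M) : Prop :=
  (∃ x, x ≤ z ∧ x ≤ j ∧ z = varJ x) ∨
  (∃ t, t ≤ z ∧ ∃ V, V ≤ z ∧ t ≤ j ∧ SetBelow V j ∧ (z = termJ t V ∨ z = formJ t V)) ∨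
  ∃ U, U ≤ z ∧ ∃ w, w ≤ z ∧ ∃ V, V ≤ z ∧ w ≤ j ∧ SetBelow U j ∧ SetBelow V j ∧ z = argsJ U w V

theorem d0_smallJ : D0Pred₂ (SmallJ : M → M → Prop) := fun n i j => by
  unfold SmallJ
  infer_instance

theorem smallJ_var {j x : M} : SmallJ j (varJ x) ↔ x ≤ j := by
  constructor
  · rintro (⟨y, _, h, hz⟩ | ⟨_, _, _, _, _, _, hz | hz⟩ | ⟨_, _, _, _, _, _, _, _, _, hz⟩)
    · rw [(pair_inj.1 hz).2]; exact h
    all_goals simp [varJ, termJ, formJ, argsJ, pair_inj, num_inj] at hz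
  · exact fun h => Or.inl ⟨x, le_varJ x, h, rfl⟩

theorem smallJ_term {j t V : M} : SmallJ j (termJ t V) ↔ t ≤ j ∧ SetBelow V j := by
  constructor
  · rintro (⟨y, _, h, hz⟩ | ⟨_, _, _, _, h, h', hz | hz⟩ | ⟨_, _, _, _, _, _, _, _, _, hz⟩)
    · simp [varJ, termJ, pair_inj, num_inj] at hz
    · obtain ⟨_, rfl, rfl⟩ := by simpa only [termJ, pair_inj] using hz
      exact ⟨h, h'⟩
    all_goals simp [termJ, formJ, argsJ, pair_inj, num_inj] at hz
  · exact fun h => Or.inr (Or.inl ⟨t, (le_judge _ _ _).1, V, (le_judge _ _ _).2, h.1, h.2,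
      Or.inl rfl⟩)

theorem smallJ_form {j t V : M} : SmallJ j (formJ t V) ↔ t ≤ j ∧ SetBelow V j := by
  constructor
  · rintro (⟨y, _, h, hz⟩ | ⟨_, _, _, _, h, h', hz | hz⟩ | ⟨_, _, _, _, _, _, _, _, _, hz⟩)
    · simp [varJ, formJ, pair_inj, num_inj] at hz
    · simp [termJ, formJ, pair_inj, num_inj] at hz
    · obtain ⟨_, rfl, rfl⟩ := by simpa only [formJ, pair_inj] using hz
      exact ⟨h, h'⟩
    all_goals simp [formJ, argsJ, pair_inj, num_inj] at hz
  · exact fun h => Or.inr (Or.inl ⟨t, (le_judge _ _ _).1, V, (le_judge _ _ _).2, h.1, h.2,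
      Or.inr rfl⟩)

theorem smallJ_args {j U w V : M} :
    SmallJ j (argsJ U w V) ↔ w ≤ j ∧ SetBelow U j ∧ SetBelow V j := by
  constructor
  · rintro (⟨y, _, h, hz⟩ | ⟨_, _, _, _, h, h', hz | hz⟩ | ⟨_, _, _, _, _, _, h, h', h'', hz⟩)
    · simp [varJ, argsJ, pair_inj, num_inj] at hz
    · simp [termJ, argsJ, pair_inj, num_inj] at hz
    · simp [formJ, argsJ, pair_inj, num_inj] at hz
    · obtain ⟨_, rfl, rfl, rfl⟩ := by simpa only [argsJ, pair_inj] using hz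
      exact ⟨h, h', h''⟩
  · exact fun h => Or.inr (Or.inr ⟨U, (le_argsJ _ _ _).1, w, (le_argsJ _ _ _).2.1, V,
      (le_argsJ _ _ _).2.2, h.1, h.2.1, h.2.2, rfl⟩)

/-- A subformula property: premises speak about subwords of the word in the conclusion. The counting
set U of an argument list is not controlled by that word. For a Skolem term it is small because it
consists of free variables of ψ. -/
theorem IsDer.small_rule {d : M} (hd : IsDer FormationRule d) {j z : M} (hz : Mem z d)
    (hs : SmallJ j z) : FormationRule (fun y => Mem y d ∧ SmallJ j y) z := by
  have hT : ∀ {t V}, t ≤ j → Mem (termJ t V) d → Mem (termJ t V) d ∧ SmallJ j (termJ t V) :=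
    fun ht h => ⟨h, smallJ_term.2 ⟨ht, ((hd.setsBelow _).1 _ h.judge_le.2 h).mono ht⟩⟩
  have hF : ∀ {t V}, t ≤ j → Mem (formJ t V) d → Mem (formJ t V) d ∧ SmallJ j (formJ t V) :=
    fun ht h => ⟨h, smallJ_form.2 ⟨ht, ((hd.setsBelow _).2.1 _ h.judge_le.2 h).mono ht⟩⟩
  have hA : ∀ {U w V}, w ≤ j → SetBelow U j → Mem (argsJ U w V) d →
      Mem (argsJ U w V) d ∧ SmallJ j (argsJ U w V) := fun ht hU h =>
    ⟨h, smallJ_args.2 ⟨ht, hU, ((hd.setsBelow _).2.2 _ h.argsJ_le.1 _ h.argsJ_le.2.2 h).2.mono ht⟩⟩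
  have hV : ∀ {x}, x ≤ j → Mem (varJ x) d → Mem (varJ x) d ∧ SmallJ j (varJ x) :=
    fun ht h => ⟨h, smallJ_var.2 ht⟩
  rcases hd.2 _ hz with h | ⟨h, h'⟩ | ⟨h, h'⟩ | ⟨h, h'⟩ | ⟨h, h'⟩ | ⟨h, h'⟩ | ⟨h₁, h₂, h₃, h₄⟩ |
      ⟨h₁, h₂, h₃, h₄⟩ | ⟨h₁, h₂, h₃, h₄, h₅⟩ | ⟨h, h'⟩ | ⟨h₁, h₂, h₃, h₄, h₅, h₆⟩ |
      ⟨h₁, h₂, h₃, h₄⟩ | ⟨h₁, h₂, h₃, h₄⟩ | ⟨h, h'⟩ | ⟨h₁, h₂, h₃, h₄⟩ | ⟨h₁, h₂, h₃, h₄⟩ |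
      ⟨h₁, h₂, h₃, h₄⟩ | ⟨h₁, h₂, h₃, h₄⟩ | ⟨h₁, h₂, h₃, h₄⟩
  · exact .var h
  · exact .varA (hV ((h'.mem_le (by simp)).trans (smallJ_var.1 hs)) h) h'
  · exact .varB (hV ((h'.mem_le (by simp)).trans (smallJ_var.1 hs)) h) h'
  · exact .termVar (hV (smallJ_term.1 hs).1 h) h'
  · exact .termZero h h'
  · exact .termSucc (hT ((h'.mem_le (by simp)).trans (smallJ_term.1 hs).1) h) h'
  · exact .termAdd (hT ((h₄.mem_le (by simp)).trans (smallJ_term.1 hs).1) h₁)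
      (hT ((h₄.mem_le (by simp)).trans (smallJ_term.1 hs).1) h₂) h₃ h₄
  · exact .termMul (hT ((h₄.mem_le (by simp)).trans (smallJ_term.1 hs).1) h₁)
      (hT ((h₄.mem_le (by simp)).trans (smallJ_term.1 hs).1) h₂) h₃ h₄
  · have hy := (smallJ_term.1 hs).1
    have hf := hF ((h₅.mem_le (by simp)).trans hy) h₂
    exact .termSkolem (hV ((h₅.mem_le (by simp)).trans hy) h₁) hf h₃
      (hA ((h₅.mem_le (by simp)).trans hy) ((smallJ_form.1 hf.2).2.erase h₃) h₄) h₅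
  · exact .argsNil h h'
  · obtain ⟨hw, hU, _⟩ := smallJ_args.1 hs
    refine .argsCons (hA ((h₆.mem_le (by simp)).trans hw) ⟨?_, fun x hx =>
      hU.2 x ((h₃.2 x).2 (Or.inl hx))⟩ h₁) h₂ h₃ (hT ((h₆.mem_le (by simp)).trans hw) h₄) h₅ h₆
    exact ((hd.setsBelow _).2.2 _ h₁.argsJ_le.1 _ h₁.argsJ_le.2.2 h₁).1
  · exact .formEq (hT ((h₄.mem_le (by simp)).trans (smallJ_form.1 hs).1) h₁)
      (hT ((h₄.mem_le (by simp)).trans (smallJ_form.1 hs).1) h₂) h₃ h₄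
  · exact .formLe (hT ((h₄.mem_le (by simp)).trans (smallJ_form.1 hs).1) h₁)
      (hT ((h₄.mem_le (by simp)).trans (smallJ_form.1 hs).1) h₂) h₃ h₄
  · exact .formNot (hF ((h'.mem_le (by simp)).trans (smallJ_form.1 hs).1) h) h'
  · exact .formAnd (hF ((h₄.mem_le (by simp)).trans (smallJ_form.1 hs).1) h₁)
      (hF ((h₄.mem_le (by simp)).trans (smallJ_form.1 hs).1) h₂) h₃ h₄
  · exact .formOr (hF ((h₄.mem_le (by simp)).trans (smallJ_form.1 hs).1) h₁)
      (hF ((h₄.mem_le (by simp)).trans (smallJ_form.1 hs).1) h₂) h₃ h₄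
  · exact .formImp (hF ((h₄.mem_le (by simp)).trans (smallJ_form.1 hs).1) h₁)
      (hF ((h₄.mem_le (by simp)).trans (smallJ_form.1 hs).1) h₂) h₃ h₄
  · exact .formAll (hV ((h₄.mem_le (by simp)).trans (smallJ_form.1 hs).1) h₁)
      (hF ((h₄.mem_le (by simp)).trans (smallJ_form.1 hs).1) h₂) h₃ h₄
  · exact .formEx (hV ((h₄.mem_le (by simp)).trans (smallJ_form.1 hs).1) h₁)
      (hF ((h₄.mem_le (by simp)).trans (smallJ_form.1 hs).1) h₂) h₃ h₄

/-- `B` is so much larger than `j` that derivations of judgements below `j` can be bounded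
by `B`. -/
def Room (j B : M) : Prop := ∃ G, G ≤ B ∧ Exp ((j + 1) * j) G ∧
  ∃ b, b ≤ B ∧ b = pair 4 (pair (10 * (G * G) + j) (pair (10 * (G * G) + j) (10 * (G * G) + j))) ∧
  ∃ H, H ≤ B ∧ Exp ((2 * b + 6) * b) H

theorem SetBelow.le {V j G : M} (h : SetBelow V j) (hG : Exp ((j + 1) * j) G) :
    V ≤ 10 * (G * G) := h.1.le_of_forall_le h.2 hG

theorem num_four : (num 4 : M) = 4 := (Nat.cast_ofNat : ((4 : ℕ) : M) = 4)
theorem num_three : (num 3 : M) = 3 := (Nat.cast_ofNat : ((3 : ℕ) : M) = 3)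

/-- A set of numbers up to j has code at most 10·G², and 4 is the largest tag, so one nested pair
bounds judgements of all four kinds. -/
theorem SmallJ.le {j z G : M} (h : SmallJ j z) (hG : Exp ((j + 1) * j) G) :
    z ≤ pair 4 (pair (10 * (G * G) + j) (pair (10 * (G * G) + j) (10 * (G * G) + j))) := by
  have h14 : (1 : M) ≤ 4 := by norm_num
  have h24 : (2 : M) ≤ 4 := by norm_num
  have h34 : (3 : M) ≤ 4 := by norm_num
  rcases h with ⟨y, _, h, rfl⟩ | ⟨t, _, V, _, h, h', rfl | rfl⟩ | ⟨U, _, w, _, V, _, h, h', h'', rfl⟩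
  · rw [varJ, num_one]
    exact pair_mono h14 ((h.trans le_add_self).trans (le_pair_left _ _))
  · rw [termJ, num_two]
    exact pair_mono h24 (pair_mono (h.trans le_add_self)
      (((h'.le hG).trans le_self_add).trans (le_pair_left _ _)))
  · rw [formJ, num_three]
    exact pair_mono h34 (pair_mono (h.trans le_add_self)
      (((h'.le hG).trans le_self_add).trans (le_pair_left _ _)))
  · rw [argsJ, num_four]
    exact pair_mono le_rfl (pair_mono ((h'.le hG).trans le_self_add)
      (pair_mono (h.trans le_add_self) ((h''.le hG).trans le_self_add)))

theorem formationRule_mono : MonoRule (FormationRule : (M → Prop) → M → Prop) := by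
  intro D D' hD y h
  rcases h with h | ⟨h, h'⟩ | ⟨h, h'⟩ | ⟨h, h'⟩ | ⟨h, h'⟩ | ⟨h, h'⟩ | ⟨h₁, h₂, h₃, h₄⟩ |
      ⟨h₁, h₂, h₃, h₄⟩ | ⟨h₁, h₂, h₃, h₄, h₅⟩ | ⟨h, h'⟩ | ⟨h₁, h₂, h₃, h₄, h₅, h₆⟩ |
      ⟨h₁, h₂, h₃, h₄⟩ | ⟨h₁, h₂, h₃, h₄⟩ | ⟨h, h'⟩ | ⟨h₁, h₂, h₃, h₄⟩ | ⟨h₁, h₂, h₃, h₄⟩ |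
      ⟨h₁, h₂, h₃, h₄⟩ | ⟨h₁, h₂, h₃, h₄⟩ | ⟨h₁, h₂, h₃, h₄⟩
  · exact .var h
  · exact .varA (hD _ h) h'
  · exact .varB (hD _ h) h'
  · exact .termVar (hD _ h) h'
  · exact .termZero h h'
  · exact .termSucc (hD _ h) h'
  · exact .termAdd (hD _ h₁) (hD _ h₂) h₃ h₄
  · exact .termMul (hD _ h₁) (hD _ h₂) h₃ h₄
  · exact .termSkolem (hD _ h₁) (hD _ h₂) h₃ (hD _ h₄) h₅
  · exact .argsNil h h'
  · exact .argsCons (hD _ h₁) h₂ h₃ (hD _ h₄) h₅ h₆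
  · exact .formEq (hD _ h₁) (hD _ h₂) h₃ h₄
  · exact .formLe (hD _ h₁) (hD _ h₂) h₃ h₄
  · exact .formNot (hD _ h) h'
  · exact .formAnd (hD _ h₁) (hD _ h₂) h₃ h₄
  · exact .formOr (hD _ h₁) (hD _ h₂) h₃ h₄
  · exact .formImp (hD _ h₁) (hD _ h₂) h₃ h₄
  · exact .formAll (hD _ h₁) (hD _ h₂) h₃ h₄
  · exact .formEx (hD _ h₁) (hD _ h₂) h₃ h₄

/-- Derivability of small judgements is a bounded property. -/
theorem derivable_small_iff {j B z : M} (hB : Room j B) (hz : SmallJ j z) :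
    Derivable FormationRule z ↔ ∃ d, d ≤ B ∧ IsDer FormationRule d ∧ Mem z d := by
  constructor
  · intro h
    obtain ⟨d, hd, hm⟩ := derivable_iff.1 h
    obtain ⟨G, _, hG, b, _, hb, H, hHB, hH⟩ := hB
    -- The derivation is cut down to its small judgements; by `IsDer.small_rule` it remains a
    -- derivation.
    obtain ⟨e, he, hes, hem⟩ := exists_comprehension hH (P := fun y => Mem y d ∧ SmallJ j y)
      (fun n i => by
        have := d0_smallJ.comp (Poly.const (n := n) j) (Poly.var i)
        infer_instance)
    have hem' : ∀ y, Mem y e ↔ Mem y d ∧ SmallJ j y := fun y => by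
      rw [hem]
      refine ⟨fun h => h.2.2, fun h => ⟨hd.1.mem_pos h.1, ?_, h⟩⟩
      rw [hb]
      exact h.2.le hG
    refine ⟨e, he.trans hHB, ⟨hes, fun y hy => ?_⟩, (hem' z).2 ⟨hm, hz⟩⟩
    have h1 := (hem' y).1 hy
    exact formationRule_mono _ _ (fun y hy => (hem' y).2 hy) _ (hd.small_rule h1.1 h1.2)
  · rintro ⟨d, _, hd, hm⟩
    exact derivable_iff.2 ⟨d, hd, hm⟩

theorem IsForm.setBelow {φ V : M} (h : IsForm φ V) : SetBelow V φ := by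
  obtain ⟨d, hd, hm⟩ := derivable_iff.1 h
  exact (hd.setsBelow φ).2.1 V hm.judge_le.2 hm

theorem isForm_iff {j B φ V : M} (hB : Room j B) (hφ : φ ≤ j) :
    IsForm φ V ↔ ∃ d, d ≤ B ∧ IsDer FormationRule d ∧ Mem (formJ φ V) d := by
  constructor
  · exact fun h => (derivable_small_iff hB (smallJ_form.2 ⟨hφ, h.setBelow.mono hφ⟩)).1 h
  · rintro ⟨d, _, hd, hm⟩
    exact derivable_iff.2 ⟨d, hd, hm⟩

theorem isVar_iff {j B x : M} (hB : Room j B) (hx : x ≤ j) :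
    IsVar x ↔ ∃ d, d ≤ B ∧ IsDer FormationRule d ∧ Mem (varJ x) d :=
  derivable_small_iff hB (smallJ_var.2 hx)

end FormationBounds

/-! ### Overspill, and an initial segment closed under coded unions -/

section Cuts

variable {M : Type*} [Model M]

instance D0.ex_mem {n : ℕ} {t : (Fin (n + 1) → M) → M} [ht : Poly t]
    {P : (Fin (n + 1) → M) → M → Prop}
    [D0 (fun v : Fin (n + 2) → M => P (fun i => v i.castSucc) (v (Fin.last (n + 1))))] :
    D0 (fun v => ∃ x, Mem x (t v) ∧ P v x) := by
  have := ht.weaken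
  exact D0.ex_of_bound t (fun _ _ h => h.1.le) inferInstance

theorem eq_natCast_of_le {x : M} : ∀ {k : ℕ}, x ≤ (k : M) → ∃ i : ℕ, i ≤ k ∧ x = (i : M)
  | 0, h => ⟨0, le_rfl, by simpa using h⟩
  | k + 1, h => by
    rcases h.lt_or_eq with h | h
    · rw [Nat.cast_succ, lt_add_one_iff'] at h
      obtain ⟨i, hi, rfl⟩ := eq_natCast_of_le h
      exact ⟨i, hi.trans k.le_succ, rfl⟩
    · exact ⟨k + 1, le_rfl, h⟩

theorem nonStandard_iff {x : M} : NonStandard x ↔ ∀ k : ℕ, (k : M) < x := by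
  refine ⟨fun h k => not_le.1 fun hk => ?_, fun h k hk => ?_⟩
  · obtain ⟨i, _, hi⟩ := eq_natCast_of_le hk
    exact h i hi
  · exact (h k).ne' hk

/-- A bounded property of all standard numbers holds for a non-standard number. -/
theorem D0Pred.overspill {P : M → Prop} (hP : D0Pred P) {N : M} (hN : NonStandard N)
    (h : ∀ k : ℕ, P (k : M)) : ∃ j, NonStandard j ∧ P j := by
  by_contra! hc
  -- If `P` failed at all non-standard numbers, this downward closed version would hold exactly at
  -- the standard ones and be inductive.
  have hD : D0Pred (fun x => ∀ y, y ≤ x → P y) := fun n i => by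
    have := hP (n + 1) (Fin.last (n + 1))
    infer_instance
  have hs : ∀ {x : M}, ¬ NonStandard x → ∃ k : ℕ, x = (k : M) := fun h => by
    simpa [NonStandard, num_eq] using h
  obtain ⟨k, hk⟩ := hs (x := N) fun hN => by
    refine hc N hN (hD.induct ?_ (fun x hx => ?_) N N le_rfl)
    · intro y hy
      obtain ⟨i, _, rfl⟩ := eq_natCast_of_le (k := 0) (hy.trans_eq Nat.cast_zero.symm)
      exact h i
    · obtain ⟨k, rfl⟩ := hs fun hx' => hc x hx' (hx x le_rfl)
      intro y hy
      obtain ⟨i, _, rfl⟩ := eq_natCast_of_le (k := k + 1) (by simpa using hy)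
      exact h i
  exact hN k hk

theorem Exp.pow {x y : M} (h : Exp x y) : ∀ e : ℕ, Exp ((e : M) * x) (y ^ e)
  | 0 => by simpa using exp_zero
  | e + 1 => by
    have := (h.pow e).add h
    rwa [pow_succ, Nat.cast_succ, add_mul, one_mul]

theorem exp_natCast (k : ℕ) : Exp (k : M) ((2 ^ k : ℕ) : M) := by
  have h : Exp (1 : M) 2 := by simpa using (exp_zero (M := M)).succ
  simpa using h.pow k

/-- `N` is non-standard and the iterated powers `exp (N ^ e)`, for standard `e`, are bounded by
`Y`. -/
structure Scale (N Y : M) : Prop where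
  lt (k : ℕ) : (k : M) < N
  exp (e : ℕ) : ∃ y, y ≤ Y ∧ Exp (N ^ e) y

/-- The initial segment of the numbers bounded by some `exp (N ^ e)` with standard `e`. -/
def Cut (N c : M) : Prop := ∃ e : ℕ, ∃ y, Exp (N ^ e) y ∧ c ≤ y

/-- With m = log log l and N = exp m, the hypothesis provides y = exp(exp(m²)). For standard e, N^e
= exp(e·m) ≤ exp(m²), because m is non-standard. -/
theorem exists_scale {l y : M} (hl : NonStandard l) (h : Omega 2 l y) :
    ∃ N, Scale N y ∧ Cut N l := by
  obtain ⟨n, z, ⟨⟨L, hL, hlL⟩, -⟩, ⟨m, w, ⟨⟨N, hN, hnN⟩, -⟩, rfl, hz⟩, hy⟩ := h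
  -- A standard N would make log l standard, and then l itself would be bounded by a standard power
  -- of two.
  have hNns : NonStandard N := fun k hk => by
    rw [num_eq] at hk
    obtain ⟨i, -, rfl⟩ := eq_natCast_of_le (hnN.trans_eq hk)
    rw [hL.unique (exp_natCast i)] at hlL
    exact absurd (nonStandard_iff.1 hl _) (not_lt.2 hlL)
  have hm : NonStandard m := fun k hk => by
    rw [num_eq] at hk
    subst hk
    exact hNns _ (hN.unique (exp_natCast k))
  have hexp : ∀ e : ℕ, ∃ u, u ≤ y ∧ Exp (N ^ e) u := fun e => by
    refine hy.exists_of_le ((hN.pow e).mono hz ?_)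
    gcongr
    exact (nonStandard_iff.1 hm e).le
  refine ⟨N, ⟨nonStandard_iff.1 hNns, hexp⟩, 1, ?_⟩
  obtain ⟨u, -, hu⟩ := hexp 1
  exact ⟨u, hu, hlL.trans (hL.mono hu (by simpa using hnN))⟩

namespace Scale

variable {N Y a b : M}

theorem one_le_pow (h : Scale N Y) (e : ℕ) : 1 ≤ N ^ e := by
  have h1 : (1 : M) ≤ N := by simpa using (h.lt 1).le
  exact one_le_pow₀ h1

theorem common (h : Scale N Y) (ha : Cut N a) (hb : Cut N b) :
    ∃ (e : ℕ) (y : M), Exp (N ^ e) y ∧ a ≤ y ∧ b ≤ y ∧ 2 ≤ y := by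
  obtain ⟨e, u, hu, hau⟩ := ha
  obtain ⟨f, v, hv, hbv⟩ := hb
  obtain ⟨y, -, hy⟩ := h.exp (e + f)
  have h1 : Exp (1 : M) 2 := by simpa using (exp_zero (M := M)).succ
  refine ⟨e + f, y, hy, hau.trans (hu.mono hy ?_), hbv.trans (hv.mono hy ?_),
    h1.mono hy (h.one_le_pow _)⟩
  · rw [pow_add]
    exact le_mul_of_one_le_right' (h.one_le_pow f)
  · rw [pow_add]
    exact le_mul_of_one_le_left' (h.one_le_pow e)

theorem mono (hb : Cut N b) (hab : a ≤ b) : Cut N a := by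
  obtain ⟨e, y, hy, hby⟩ := hb
  exact ⟨e, y, hy, hab.trans hby⟩

theorem le (h : Scale N Y) (ha : Cut N a) : a ≤ Y := by
  obtain ⟨e, y, hy, hay⟩ := ha
  obtain ⟨z, hz, hz'⟩ := h.exp e
  rw [hy.unique hz'] at hay
  exact hay.trans hz

/-- exp(N^e)² = exp(2·N^e), and 2 ≤ N. -/
theorem mul (h : Scale N Y) (ha : Cut N a) (hb : Cut N b) : Cut N (a * b) := by
  obtain ⟨e, y, hy, hay, hby, -⟩ := h.common ha hb
  obtain ⟨z, -, hz⟩ := h.exp (e + 1)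
  refine ⟨e + 1, z, hz, (mul_le_mul' hay hby).trans ((hy.add hy).mono hz ?_)⟩
  rw [pow_succ, ← mul_two]
  gcongr
  simpa using (h.lt 2).le

theorem add (h : Scale N Y) (ha : Cut N a) (hb : Cut N b) : Cut N (a + b) := by
  obtain ⟨e, y, hy, hay, hby, h2⟩ := h.common ha hb
  have hc : Cut N y := ⟨e, y, hy, le_rfl⟩
  refine mono (h.mul hc hc) ((add_le_add hay hby).trans ?_)
  rw [← two_mul]
  gcongr

theorem nat (h : Scale N Y) (k : ℕ) : Cut N (k : M) := by
  obtain ⟨y, -, hy⟩ := h.exp 1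
  exact ⟨1, y, hy, (h.lt k).le.trans (by simpa using hy.lt.le)⟩

theorem ofNat (h : Scale N Y) (k : ℕ) [k.AtLeastTwo] : Cut N (OfNat.ofNat k : M) := by
  rw [← Nat.cast_ofNat (R := M) (n := k)]
  exact h.nat k

theorem one (h : Scale N Y) : Cut N 1 := by simpa using h.nat 1

theorem pow (h : Scale N Y) (ha : Cut N a) : ∀ k : ℕ, Cut N (a ^ k)
  | 0 => by simpa using h.one
  | k + 1 => by
    rw [pow_succ]
    exact h.mul (h.pow ha k) ha

theorem pair (h : Scale N Y) (ha : Cut N a) (hb : Cut N b) : Cut N (pair a b) :=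
  h.add (h.mul (h.add ha hb) (h.add ha hb)) ha

/-- The exponents multiply: 4·N^e·N^e ≤ N^(1+2e). The bound G is chosen before c and Q so that it
serves a whole family of unions, as `Coded.prod` requires. -/
theorem biUnion (h : Scale N Y) {C R : M} (hC : Cut N C) (hR : Cut N R) : ∃ G, Cut N G ∧
    ∀ c, c ≤ C → IsSetCode c → ∀ Q : M → M → Prop, D0Pred₂ Q →
    (∀ a, Mem a c → ∃ f, f ≤ R ∧ IsSetCode f ∧ ∀ z, Mem z f ↔ Q a z) →
    ∃ Z, Z ≤ G ∧ IsSetCode Z ∧ ∀ z, Mem z Z ↔ ∃ a, Mem a c ∧ Q a z := by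
  obtain ⟨e, S, hS, hCS, hRS, -⟩ := h.common hC hR
  obtain ⟨G', -, hG'⟩ := h.exp (1 + e + e)
  obtain ⟨G, hGG, hG⟩ := hG'.exists_of_le (x' := 4 * N ^ e * N ^ e) (by
    rw [pow_add, pow_add, pow_one]
    gcongr
    simpa using (h.lt 4).le)
  refine ⟨G, ⟨_, _, hG', hGG⟩, fun c hc hc' Q hQ hF => ?_⟩
  exact exists_biUnion hc' hS (hc.trans hCS) hS hG hQ fun a ha =>
    (hF a ha).imp fun f hf => ⟨hf.1.trans hRS, hf.2⟩

end Scale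

/-- An image under a partial function is a union of sets with at most one member; these are the
fibres of that union. -/
theorem exists_subsingleton {q : M → Prop} {R : M} (hq : ∀ z, q z → 0 < z ∧ z ≤ R)
    (hq' : ∀ z z', q z → q z' → z = z') :
    ∃ f, f ≤ 40 * (R * R) + 1 ∧ IsSetCode f ∧ ∀ z, Mem z f ↔ q z := by
  by_cases he : ∃ z, q z
  · obtain ⟨z, hz⟩ := he
    obtain ⟨f, hf, hf'⟩ := exists_insert isEmptyCode_one.1 (hq z hz).1
    refine ⟨f, hf'.trans ?_, hf.1, fun x => (hf.2 x).trans
      ⟨fun h => ?_, fun h => Or.inr (hq' _ _ h hz)⟩⟩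
    · rw [mul_one]
      exact le_add_right (by gcongr <;> exact (hq z hz).2)
    · rcases h with h | rfl
      · exact absurd h (isEmptyCode_one.2 x)
      · exact hz
  · exact ⟨1, le_add_self, isEmptyCode_one.1, fun z => iff_of_false (isEmptyCode_one.2 z)
      fun h => he ⟨z, h⟩⟩

theorem Scale.image {N Y : M} (h : Scale N Y) {C R : M} (hC : Cut N C) (hR : Cut N R) :
    ∃ G, Cut N G ∧ ∀ c, c ≤ C → IsSetCode c → ∀ Q : M → M → Prop, D0Pred₂ Q →
    (∀ a z, Mem a c → Q a z → 0 < z ∧ z ≤ R) →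
    (∀ a z z', Mem a c → Q a z → Q a z' → z = z') →
    ∃ Z, Z ≤ G ∧ IsSetCode Z ∧ ∀ z, Mem z Z ↔ ∃ a, Mem a c ∧ Q a z := by
  obtain ⟨G, hG, H⟩ := h.biUnion hC (R := 40 * (R * R) + 1)
    (h.add (h.mul (h.ofNat 40) (h.mul hR hR)) h.one)
  exact ⟨G, hG, fun c hc hc' Q hQ hb hf => H c hc hc' Q hQ fun a ha =>
    exists_subsingleton (fun z hz => hb a z ha hz) fun z z' hz hz' => hf a z z' ha hz hz'⟩

/-- The set of the numbers satisfying `P` has a code in the cut given by `N`. -/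
def Coded (N : M) (P : M → Prop) : Prop := ∃ c, Cut N c ∧ IsSetCode c ∧ ∀ z, Mem z c ↔ P z

namespace Coded

variable {N Y : M} {P Q : M → Prop}

theorem congr (hP : Coded N P) (h : ∀ z, P z ↔ Q z) : Coded N Q := by
  obtain ⟨c, hc, hs, hm⟩ := hP
  exact ⟨c, hc, hs, fun z => (hm z).trans (h z)⟩

theorem union (h : Scale N Y) (hP : Coded N P) (hQ : Coded N Q) :
    Coded N (fun z => P z ∨ Q z) := by
  obtain ⟨c, hc, hs, hm⟩ := hP
  obtain ⟨c', hc', hs', hm'⟩ := hQ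
  obtain ⟨d, hd, hd'⟩ := exists_union hs hs'
  refine ⟨d, Scale.mono (h.mul hc (h.pow hc' 4)) hd', hd.1, fun z => ?_⟩
  rw [hd.2, hm, hm']

theorem singleton (h : Scale N Y) {x : M} (hx : 0 < x) (hx' : Cut N x) : Coded N (fun z => z = x) := by
  obtain ⟨f, hf, hs, hm⟩ := exists_subsingleton (q := fun z => z = x) (R := x)
    (by rintro z rfl; exact ⟨hx, le_rfl⟩) (by rintro z z' rfl rfl; rfl)
  exact ⟨f, Scale.mono (h.add (h.mul (h.ofNat 40) (h.mul hx' hx')) h.one) hf, hs, hm⟩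

theorem image (h : Scale N Y) (hP : Coded N P) {F : M → M → Prop} (hF : D0Pred₂ F) {R : M}
    (hR : Cut N R) (hb : ∀ a z, P a → F a z → 0 < z ∧ z ≤ R)
    (hf : ∀ a z z', P a → F a z → F a z' → z = z') : Coded N (fun z => ∃ a, P a ∧ F a z) := by
  obtain ⟨c, hc, hs, hm⟩ := hP
  obtain ⟨G, hG, H⟩ := h.image hc hR
  obtain ⟨Z, hZ, hZs, hZm⟩ := H c le_rfl hs F hF (fun a z ha => hb a z ((hm a).1 ha))
    (fun a z z' ha => hf a z z' ((hm a).1 ha))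
  exact ⟨Z, Scale.mono hG hZ, hZs, fun z => by simp only [hZm, hm]⟩

/-- A union over a of images under b ↦ `pair a b`, with one bound for all of these images. -/
theorem prod (h : Scale N Y) (hP : Coded N P) (hQ : Coded N Q) :
    Coded N (fun z => ∃ a b, P a ∧ Q b ∧ z = pair a b) := by
  obtain ⟨c, hc, hs, hm⟩ := hP
  obtain ⟨c', hc', hs', hm'⟩ := hQ
  obtain ⟨G, hG, H⟩ := h.image hc' (h.pair hc hc')
  obtain ⟨G', hG', H'⟩ := h.biUnion hc hG
  obtain ⟨Z, hZ, hZs, hZm⟩ := H' c le_rfl hs (fun a z => ∃ b, Mem b c' ∧ z = BA.pair a b)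
    (fun _ _ _ => inferInstance) fun a ha => H c' le_rfl hs' (fun b z => z = BA.pair a b)
      (fun _ _ _ => inferInstance)
      (by rintro b z hb rfl; exact ⟨pair_pos (hs'.mem_pos hb), pair_mono ha.le hb.le⟩)
      (by rintro b z z' _ rfl rfl; rfl)
  refine ⟨Z, Scale.mono hG' hZ, hZs, fun z => ?_⟩
  simp only [hZm, hm, hm']
  exact ⟨fun ⟨a, ha, b, hb, hz⟩ => ⟨a, b, ha, hb, hz⟩, fun ⟨a, b, ha, hb, hz⟩ => ⟨a, ha, b, hb, hz⟩⟩

theorem standard (h : Scale N Y) (hP : D0Pred P) (k : ℕ) (hk : ∀ z, P z → 0 < z ∧ z ≤ (k : M)) :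
    Coded N P := by
  obtain ⟨Z, hZ, hs, hm⟩ := exists_comprehension (b := (k : M)) (P := P)
    (by simpa using exp_natCast (M := M) ((2 * k + 6) * k)) hP
  refine ⟨Z, Scale.mono (h.nat (2 ^ ((2 * k + 6) * k))) (by simpa using hZ), hs, fun z => ?_⟩
  rw [hm]
  exact ⟨fun h => h.2.2, fun h => ⟨(hk z h).1, (hk z h).2, h⟩⟩

theorem bound (hP : Coded N P) : ∃ R, Cut N R ∧ ∀ z, P z → z ≤ R := by
  obtain ⟨c, hc, -, hm⟩ := hP
  exact ⟨c, hc, fun z hz => ((hm z).2 hz).le⟩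

end Coded

/-- For standard j all the numbers involved are computed from j by addition, multiplication and
exponentiation, so they are standard and lie below B. -/
theorem room_natCast {B : M} (hB : ∀ k : ℕ, (k : M) < B) (j : ℕ) : Room (j : M) B := by
  have hexp : ∀ k : ℕ, ∃ g : ℕ, Exp (k : M) (g : M) := fun k => ⟨_, exp_natCast k⟩
  have hpair : ∀ x y : ℕ, ∃ z : ℕ, pair (x : M) (y : M) = (z : M) := fun x y =>
    ⟨(x + y) * (x + y) + x, by simp [pair]⟩
  obtain ⟨g, hg⟩ := hexp ((j + 1) * j)
  obtain ⟨a, ha⟩ := hpair (10 * (g * g) + j) (10 * (g * g) + j)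
  obtain ⟨b, hb⟩ := hpair (10 * (g * g) + j) a
  obtain ⟨c, hc⟩ := hpair 4 b
  obtain ⟨G, hG⟩ := hexp ((2 * c + 6) * c)
  push_cast at hg ha hb hc hG
  exact ⟨g, (hB g).le, hg, c, (hB c).le, by rw [ha, hb, hc], G, (hB G).le, hG⟩

end Cuts

/-! ### The closure stages as a bounded formula -/

section Stages

variable {M : Type*} [Model M]

theorem tupleRule_iff {c T z : M} : TupleRule c (fun y => Mem y T) z ↔
    (∃ U, U ≤ z ∧ IsEmptyCode U ∧ z = pair U 0) ∨
    ∃ U, U ≤ T ∧ ∃ U', U' ≤ z ∧ ∃ v, v ≤ z ∧ ∃ w, w ≤ T ∧ ∃ w', w' ≤ z ∧ ∃ t, t ≤ c ∧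
      Mem (pair U w) T ∧ ¬ Mem v U ∧ IsInsertCode U' U v ∧ Mem t c ∧ Word [w, t] w' ∧
      z = pair U' w' := by
  constructor
  · rintro (h | ⟨h₁, h₂, h₃, h₄, h₅⟩)
    · exact Or.inl ⟨_, le_pair_left _ _, h, rfl⟩
    · exact Or.inr ⟨_, (le_pair_left _ _).trans h₁.le, _, le_pair_left _ _, _,
        ((h₃.2 _).2 (Or.inr rfl)).le.trans (le_pair_left _ _), _,
        (le_pair_right _ _).trans h₁.le, _, le_pair_right _ _, _, h₄.le, h₁, h₂, h₃, h₄, h₅, rfl⟩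
  · rintro (⟨U, _, h, rfl⟩ | ⟨U, _, U', _, v, _, w, _, w', _, t, _, h₁, h₂, h₃, h₄, h₅, rfl⟩)
    · exact .nil h
    · exact .cons h₁ h₂ h₃ h₄ h₅

theorem d0_tupleRule :
    D0Pred₃ (fun c T z : M => TupleRule c (fun y => Mem y T) z) := fun _ _ _ _ =>
  D0.of_iff (fun _ => tupleRule_iff) inferInstance

instance D0.tupleRule {n : ℕ} {t u s : (Fin (n + 1) → M) → M} [ht : Poly t] [hu : Poly u]
    [hs : Poly s] : D0 (fun v => TupleRule (t v) (fun y => Mem y (u v)) (s v)) :=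
  d0_tupleRule.comp ht hu hs

instance D0.isForm {n : ℕ} {t : (Fin (n + 1) → M) → M} [ht : Poly t] :
    D0 (fun v => IsDer FormationRule (t v)) := (d0_formationRule.isDer (M := M)).comp ht

/-- A bound for the codes of words made of five numbers that are at most `B`. -/
def wordBound (B : M) : M := (2 * (B + 1)) ^ 5

instance Poly.wordBound {n : ℕ} {t : (Fin (n + 1) → M) → M} [Poly t] :
    Poly (fun v => wordBound (t v)) := by
  unfold BA.wordBound; infer_instance

theorem Word.le_wordBound {B : M} {l : List M} (hl : ∀ x ∈ l, x ≤ B) (h5 : l.length ≤ 5) {z : M}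
    (h : Word l z) : z ≤ wordBound B := by
  refine (le_self_add (b := (1 : M))).trans ((h.bound hl).trans
    (pow_le_pow_right₀ (one_le_of_pos ?_) h5))
  positivity

theorem le_wordBound (B : M) : B ≤ wordBound B := by
  have h : (1 : M) ≤ 2 * (B + 1) := one_le_of_pos (by positivity)
  calc B ≤ B + (B + 2) := le_self_add
    _ = (2 * (B + 1)) ^ 1 := by ring
    _ ≤ wordBound B := pow_le_pow_right₀ h (by norm_num)

/-- `T` is a coded set of pairs `(U, w)` where `w` is a concatenation of as many members of `c` as
`U` has elements, and `T` contains all such pairs where `U` is a set of numbers below `j`. -/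
def IsTupleTable (c j B T : M) : Prop :=
  IsSetCode T ∧ (∀ z, z ≤ T → Mem z T → TupleRule c (fun y => Mem y T) z) ∧
  (∀ U, U ≤ B → IsEmptyCode U → Mem (pair U 0) T) ∧
  ∀ U, U ≤ B → ∀ U', U' ≤ B → ∀ v, v ≤ B → ∀ w, w ≤ T → ∀ t, t ≤ c → ∀ w', w' ≤ wordBound B →
    Mem (pair U w) T → ¬ Mem v U → IsInsertCode U' U v → SetBelow U' j → Mem t c →
    Word [w, t] w' → Mem (pair U' w') T

/-- The table is itself a derivation. Conversely, its closure conditions let it follow any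
derivation, however large, by strong induction on the word. -/
theorem IsTupleTable.mem_iff {c j B T : M} (h : IsTupleTable c j B T) (hc : IsSetCode c)
    (hcB : c ≤ B) (hTB : T ≤ B) (hB : Room j B) {U w : M} (hU : SetBelow U j) :
    IsTuple c U w ↔ Mem (pair U w) T := by
  obtain ⟨hT, hr, h0, hs⟩ := h
  constructor
  · rintro ⟨d, hd, hm, hdr⟩
    obtain ⟨G, -, hG, b, hb, hb', -⟩ := hB
    have hUB : ∀ {V}, SetBelow V j → V ≤ B := fun hV =>
      ((hV.le hG).trans (le_self_add.trans ((le_pair_left _ _).trans (le_pair_right _ _)))).trans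
        (hb' ▸ hb)
    have hD : D0Pred (fun w => ∀ U, U ≤ B → SetBelow U j → Mem (pair U w) d → Mem (pair U w) T) :=
      fun _ _ => inferInstance
    refine hD.strong (fun w ih U hUB' hU hm => ?_) w U (hUB hU) hU hm
    have hz := hdr _ hm
    generalize hp : pair U w = z at hz
    rcases hz with hz | ⟨h₁, h₂, h₃, h₄, h₅⟩
    · obtain ⟨rfl, rfl⟩ := pair_inj.1 hp
      exact h0 _ hUB' hz
    · obtain ⟨rfl, rfl⟩ := pair_inj.1 hp
      rename_i V v w' t
      have hV : SetBelow V j := by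
        refine ⟨?_, fun x hx => hU.2 x ((h₃.2 x).2 (Or.inl hx))⟩
        have hz := hdr _ h₁
        generalize hp : pair V w' = z at hz
        rcases hz with hz | ⟨_, _, h, _, _⟩
        · rw [(pair_inj.1 hp).1]; exact hz.1
        · rw [(pair_inj.1 hp).1]; exact h.1
      obtain ⟨t', ht', hcat⟩ := h₅
      obtain ⟨u, hu, hcat'⟩ := id ht'
      -- Members of a coded set are positive, so dropping the last term shortens the word.
      have hlt := hcat.lt_left ((hc.mem_pos h₄).trans_le hcat'.le_left)
      have hwT := ih _ hlt _ (hUB hV) hV h₁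
      have hw : w' ≤ T := (le_pair_right _ _).trans hwT.le
      refine hs _ (hUB hV) _ hUB' v (((h₃.2 v).2 (Or.inr rfl)).le.trans hUB') _ hw t h₄.le _
        ?_ hwT h₂ h₃ hU h₄ ⟨t', ht', hcat⟩
      refine Word.le_wordBound (l := [w', t]) ?_ (by simp) ⟨t', ht', hcat⟩
      simpa using ⟨hw.trans hTB, h₄.le.trans hcB⟩
  · exact fun hm => ⟨T, hT, hm, fun y hy => hr y hy.le hy⟩

/-- The bounded form of `NextStage`, with the tuples given by a table `T`. -/
def StageMember (k c B T y : M) : Prop :=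
  Mem y c ∨ Word [sym .zero] y ∨ (∃ t, Mem t c ∧ Word [sym .succ, t] y) ∨
  (∃ t, Mem t c ∧ ∃ u, Mem u c ∧ Word [sym .add, t, u] y) ∨
  (∃ t, Mem t c ∧ ∃ u, Mem u c ∧ Word [sym .mul, t, u] y) ∨
  ∃ x, x ≤ k ∧ ∃ ψ, ψ ≤ k ∧ ∃ V, V ≤ B ∧ ∃ U, U ≤ B ∧ ∃ w, w ≤ T ∧
    (∃ d, d ≤ B ∧ IsDer FormationRule d ∧ Mem (varJ x) d) ∧
    (∃ d, d ≤ B ∧ IsDer FormationRule d ∧ Mem (formJ ψ V) d) ∧ IsEraseCode U V x ∧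
    Mem (pair U w) T ∧ Word [sym .sk, sym .ex, x, ψ, w] y

/-- When ψ ≤ k ≤ j, the free variables of ψ are at most j. This places the argument set U in the
range where the table is complete and formation derivations are bounded. -/
theorem nextStage_iff {k j c B T y : M} (h : IsTupleTable c j B T) (hc : IsSetCode c)
    (hcB : c ≤ B) (hTB : T ≤ B) (hB : Room j B) (hk : k ≤ j) :
    NextStage k c y ↔ StageMember k c B T y := by
  have hUB : ∀ {V}, SetBelow V j → V ≤ B := fun hV => by
    obtain ⟨G, -, hG, b, hb, hb', -⟩ := hB
    exact ((hV.le hG).trans (le_self_add.trans ((le_pair_left _ _).trans (le_pair_right _ _)))).trans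
        (hb' ▸ hb)
  constructor
  · rintro (h' | h' | ⟨h₁, h₂⟩ | ⟨h₁, h₂, h₃⟩ | ⟨h₁, h₂, h₃⟩ | ⟨h₁, h₂, h₃, h₄, h₅, h₆, h₇⟩)
    · exact Or.inl h'
    · exact Or.inr (Or.inl h')
    · exact Or.inr (Or.inr (Or.inl ⟨_, h₁, h₂⟩))
    · exact Or.inr (Or.inr (Or.inr (Or.inl ⟨_, h₁, _, h₂, h₃⟩)))
    · exact Or.inr (Or.inr (Or.inr (Or.inr (Or.inl ⟨_, h₁, _, h₂, h₃⟩))))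
    · have hV := h₂.setBelow.mono (h₄.trans hk)
      have hT := (h.mem_iff hc hcB hTB hB (hV.erase h₅)).1 h₆
      exact Or.inr (Or.inr (Or.inr (Or.inr (Or.inr ⟨_, h₃, _, h₄, _, hUB hV, _,
        hUB (hV.erase h₅), _, (le_pair_right _ _).trans hT.le, (isVar_iff hB (h₃.trans hk)).1 h₁,
        (isForm_iff hB (h₄.trans hk)).1 h₂, h₅, hT, h₇⟩))))
  · rintro (h' | h' | ⟨t, h₁, h₂⟩ | ⟨t, h₁, u, h₂, h₃⟩ | ⟨t, h₁, u, h₂, h₃⟩ |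
      ⟨x, h₃, ψ, h₄, V, _, U, _, w, _, h₁, h₂, h₅, h₆, h₇⟩)
    · exact .old h'
    · exact .zero h'
    · exact .succ h₁ h₂
    · exact .add h₁ h₂ h₃
    · exact .mul h₁ h₂ h₃
    · have hF := (isForm_iff hB (h₄.trans hk)).2 h₂
      have hV := hF.setBelow.mono (h₄.trans hk)
      exact .skolem ((isVar_iff hB (h₃.trans hk)).2 h₁) hF h₃ h₄ h₅
        ((h.mem_iff hc hcB hTB hB (hV.erase h₅)).2 h₆) h₇

/-- A new term has at most five components, each at most B, so `IsNextStage` loses nothing by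
testing candidates only up to `wordBound B`. -/
theorem StageMember.le {k c B T y : M} (h : StageMember k c B T y) (hk : k ≤ B) (hcB : c ≤ B)
    (hTB : T ≤ B) (hB : ∀ s, sym s ≤ B) : y ≤ wordBound B := by
  rcases h with h | h | ⟨t, h₁, h₂⟩ | ⟨t, h₁, u, h₂, h₃⟩ | ⟨t, h₁, u, h₂, h₃⟩ |
      ⟨x, h₃, ψ, h₄, V, _, U, _, w, hw, h₁, h₂, h₅, h₆, h₇⟩
  · exact (h.le.trans hcB).trans (le_wordBound B)
  · exact h.le_wordBound (by simp [hB]) (by simp)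
  · exact h₂.le_wordBound (by simpa [hB] using h₁.le.trans hcB) (by simp)
  · exact h₃.le_wordBound (by simpa [hB] using ⟨h₁.le.trans hcB, h₂.le.trans hcB⟩) (by simp)
  · exact h₃.le_wordBound (by simpa [hB] using ⟨h₁.le.trans hcB, h₂.le.trans hcB⟩) (by simp)
  · exact h₇.le_wordBound (by simpa [hB] using ⟨h₃.trans hk, h₄.trans hk, hw.trans hTB⟩) (by simp)

/-- `c'` is the code of the stage after the stage with index `k` and code `c`, and this is
witnessed below `B`. -/
def IsNextStage (j B k c c' : M) : Prop := IsSetCode c ∧ IsSetCode c' ∧ ∃ T, T ≤ B ∧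
  IsTupleTable c j B T ∧ ∀ y, y ≤ wordBound B → (Mem y c' ↔ StageMember k c B T y)

/-- The stages up to `j` have a derivation, and this is witnessed below `B`. -/
def HasStages (l B j : M) : Prop := Room j B ∧ ∃ d, d ≤ B ∧ IsSetCode d ∧
  (∃ c, c ≤ B ∧ Mem (pair j c) d) ∧ ∀ y, y ≤ d → Mem y d → y = pair 0 l ∨
    ∃ k, k ≤ j ∧ ∃ c, c ≤ B ∧ ∃ c', c' ≤ B ∧ Mem (pair k c) d ∧ y = pair (k + 1) c' ∧
      IsNextStage j B k c c'

instance D0.isTupleTable (B : M) {n : ℕ} {c j T : (Fin (n + 1) → M) → M} [hc : Poly c]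
    [hj : Poly j] [hT : Poly T] : D0 (fun v => IsTupleTable (c v) (j v) B (T v)) :=
  D0Pred₃.comp (P := fun c j T => IsTupleTable c j B T) (fun n i j k => by
    unfold IsTupleTable
    infer_instance) hc hj hT

instance D0.stageMember (B : M) {n : ℕ} {k c T y : (Fin (n + 1) → M) → M} [hk : Poly k]
    [hc : Poly c] [hT : Poly T] [hy : Poly y] :
    D0 (fun v => StageMember (k v) (c v) B (T v) (y v)) := by
  have h : ∀ {n : ℕ} (i j k l : Fin (n + 1)),
      D0 (fun v : Fin (n + 1) → M => StageMember (v i) (v j) B (v k) (v l)) := fun i j k l => by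
    unfold StageMember
    infer_instance
  refine D0.of_iff (Q := fun v => ∃ k', k' ≤ k v ∧ ∃ c', c' ≤ c v ∧ ∃ T', T' ≤ T v ∧
    ∃ y', y' ≤ y v ∧ k' = k v ∧ c' = c v ∧ T' = T v ∧ y' = y v ∧ StageMember k' c' B T' y')
    (fun v => ⟨fun h => ⟨_, le_rfl, _, le_rfl, _, le_rfl, _, le_rfl, rfl, rfl, rfl, rfl, h⟩,
      by rintro ⟨_, _, _, _, _, _, _, _, rfl, rfl, rfl, rfl, h⟩; exact h⟩) ?_
  have := hk.weaken.weaken.weaken.weaken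
  have := hc.weaken
  have := hc.weaken.weaken.weaken.weaken
  have := hT.weaken.weaken
  have := hT.weaken.weaken.weaken.weaken
  have := hy.weaken.weaken.weaken
  have := hy.weaken.weaken.weaken.weaken
  have := h (Fin.last (n + 1)).castSucc.castSucc.castSucc (Fin.last (n + 2)).castSucc.castSucc
    (Fin.last (n + 3)).castSucc (Fin.last (n + 4))
  infer_instance

theorem d0_hasStages (l B : M) : D0Pred (HasStages l B) := fun n i => by
  unfold HasStages IsNextStage Room
  infer_instance

/-- Under `Room` the bounded surrogates agree with the genuine notions, so the bounded witness is a
genuine derivation. -/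
theorem HasStages.exists_isStageCode {l B j : M} (hB : ∀ s, sym s ≤ B) (h : HasStages l B j) :
    ∃ c, IsStageCode l j c := by
  obtain ⟨hR, d, _, hd, ⟨c, _, hc⟩, hr⟩ := h
  refine ⟨c, d, hd, hc, fun y hy => ?_⟩
  rcases hr y hy.le hy with rfl | ⟨k, hk, c, hcB, c', hc'B, hm, rfl, hs, hs', T, hTB, hT, hiff⟩
  · exact .zero
  · rw [← succ_eq]
    refine .succ hm hs' fun y => ?_
    rw [nextStage_iff hT hs hcB hTB hR hk]
    have hjB : j ≤ B := by
      obtain ⟨G, -, -, b, hb, rfl, -⟩ := hR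
      exact (le_add_self.trans ((le_pair_left _ _).trans (le_pair_right _ _))).trans hb
    exact ⟨fun h => (hiff y ((h.le.trans hc'B).trans (le_wordBound B))).1 h,
      fun h => (hiff y (h.le (hk.trans hjB) hcB hTB hB)).2 h⟩

end Stages

/-! ### Standard stages have codes in the cut -/

section StandardStages

variable {M : Type*} [Model M]

theorem Scale.nat_lt {N Y : M} (h : Scale N Y) (k : ℕ) : (k : M) < Y := by
  obtain ⟨y, hy, hy'⟩ := h.exp 1
  rw [pow_one] at hy'
  exact (h.lt k).trans (hy'.lt.trans_le hy)

theorem Scale.wordBound {N Y a : M} (h : Scale N Y) (ha : Cut N a) : Cut N (wordBound a) :=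
  h.pow (h.mul (h.ofNat 2) (h.add ha h.one)) 5

/-- For standard J such a set is finite externally, so tuples indexed by it can be built by
recursion over ℕ. -/
theorem SetBelow.finite {U : M} {J : ℕ} (h : SetBelow U (J : M)) :
    {x | Mem x U}.Finite ∧ {x | Mem x U}.ncard ≤ J + 1 := by
  classical
  have hs : {x | Mem x U} ⊆ ((Finset.range (J + 1)).image (Nat.cast : ℕ → M) : Set M) := by
    intro x hx
    obtain ⟨i, hi, rfl⟩ := eq_natCast_of_le (h.2 x hx)
    simp only [Finset.coe_image, Set.mem_image, Finset.mem_coe, Finset.mem_range]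
    exact ⟨i, by omega, rfl⟩
  refine ⟨(Finset.finite_toSet _).subset hs,
    (Set.ncard_le_ncard hs (Finset.finite_toSet _)).trans ?_⟩
  rw [Set.ncard_coe_finset]
  simpa using Finset.card_image_le (s := Finset.range (J + 1)) (f := (Nat.cast : ℕ → M))

/-- `z` is a pair `(U, w)` where `U` is a set of `i` numbers below `j` and `w` is a concatenation
of `i` members of `c`. -/
def TupleLevel (c j : M) : ℕ → M → Prop
  | 0, z => ∃ U, IsEmptyCode U ∧ z = pair U 0
  | i + 1, z => ∃ U U' v w w' t, TupleLevel c j i (pair U w) ∧ ¬ Mem v U ∧ IsInsertCode U' U v ∧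
      SetBelow U' j ∧ Mem t c ∧ Word [w, t] w' ∧ z = pair U' w'

theorem TupleLevel.ncard {c : M} {J : ℕ} : ∀ {i : ℕ} {U w : M},
    TupleLevel c (J : M) i (pair U w) → SetBelow U (J : M) ∧ {x | Mem x U}.ncard = i
  | 0, U, w, ⟨V, hV, h⟩ => by
    obtain ⟨rfl, -⟩ := pair_inj.1 h
    refine ⟨hV.setBelow _, ?_⟩
    simp [hV.2]
  | i + 1, U, w, ⟨V, V', v, x, x', t, h, hv, hi, hb, _, _, he⟩ => by
    obtain ⟨rfl, -⟩ := pair_inj.1 he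
    obtain ⟨h1, h2⟩ := h.ncard
    refine ⟨hb, ?_⟩
    have : {x | Mem x U} = insert v {x | Mem x V} := by
      ext z
      simp [hi.2, or_comm]
    rw [this, Set.ncard_insert_of_notMem (by exact hv) h1.finite.1, h2]

theorem exists_setBelow_bound (J : ℕ) : ∃ s : ℕ, ∀ U : M, SetBelow U (J : M) → U ≤ (s : M) := by
  refine ⟨10 * (2 ^ ((J + 1) * J) * 2 ^ ((J + 1) * J)), fun U hU => ?_⟩
  have hG : Exp (((J : M) + 1) * J) ((2 ^ ((J + 1) * J) : ℕ) : M) := by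
    simpa using exp_natCast (M := M) ((J + 1) * J)
  simpa using hU.le hG

theorem exists_pair_bound (J : ℕ) :
    ∃ s : ℕ, ∀ x y : M, x ≤ (J : M) → y ≤ (J : M) → pair x y ≤ (s : M) :=
  ⟨(J + J) * (J + J) + J, fun x y hx hy => by simpa [pair] using pair_mono hx hy⟩

variable {N Y : M}

/-- The next level is the image of the product of the present level, the set c and the collection of
sets below J. Each external step keeps the code in the cut. -/
theorem coded_tupleLevel (h : Scale N Y) {c : M} (hc : IsSetCode c) (hcN : Cut N c) (J : ℕ) :
    ∀ i, Coded N (TupleLevel c (J : M) i)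
  | 0 => by
    obtain ⟨s, hs⟩ := exists_setBelow_bound (M := M) 0
    obtain ⟨s', hs'⟩ := exists_pair_bound (M := M) s
    refine (Coded.standard h (P := fun z => ∃ U, U ≤ z ∧ IsEmptyCode U ∧ z = pair U 0)
      (fun _ _ => by beta_reduce; infer_instance) s' ?_).congr fun z =>
        ⟨fun ⟨U, _, h⟩ => ⟨U, h⟩, fun ⟨U, h, h'⟩ => ⟨U, h' ▸ le_pair_left _ _, h, h'⟩⟩
    rintro z ⟨U, _, hU, rfl⟩
    exact ⟨hU.1.pos.trans_le (le_pair_left _ _), hs' _ _ (hs U (hU.setBelow _)) zero_le⟩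
  | i + 1 => by
    obtain ⟨s, hs⟩ := exists_setBelow_bound (M := M) J
    have hA := coded_tupleLevel h hc hcN J i
    obtain ⟨R, hR, hAR⟩ := hA.bound
    have hP : Coded N (fun U => SetBelow U (J : M)) := Coded.standard h
      (fun _ _ => inferInstance) s fun U hU => ⟨hU.1.pos, hs U hU⟩
    have hcc : Coded N (fun t => Mem t c) := ⟨c, hcN, hc, fun _ => Iff.rfl⟩
    -- The argument q is ((U, w), (t, U')). The relation is functional because the added element v
    -- affects only whether a value exists.
    refine ((hA.prod h (hcc.prod h hP)).image h (F := fun q z => ∃ a, a ≤ q ∧ ∃ b, b ≤ q ∧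
      q = pair a b ∧ ∃ U, U ≤ a ∧ ∃ w, w ≤ a ∧ a = pair U w ∧ ∃ t, t ≤ b ∧ ∃ U', U' ≤ b ∧
      b = pair t U' ∧ ∃ v, v ≤ U' ∧ ¬ Mem v U ∧ IsInsertCode U' U v ∧ ∃ w', w' ≤ z ∧
      Word [w, t] w' ∧ z = pair U' w') (R := pair (s : M) (wordBound (R + c)))
      (fun _ _ _ => by beta_reduce; infer_instance) (h.pair (h.nat s) (h.wordBound (h.add hR hcN))) ?_ ?_).congr ?_
    · rintro q z ⟨a, b, ha, ⟨t, U', ht, hU', rfl⟩, rfl⟩ ⟨a', _, b', _, hq, U, _, w, _, rfl, t₁, _,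
        U₁, _, rfl, v, _, _, _, w', _, hw', rfl⟩
      obtain ⟨rfl, hb⟩ := pair_inj.1 hq
      obtain ⟨rfl, rfl⟩ := pair_inj.1 hb
      refine ⟨hU'.1.pos.trans_le (le_pair_left _ _), pair_mono (hs _ hU')
        (hw'.le_wordBound ?_ (by simp))⟩
      have := ((le_pair_right U w).trans (hAR _ ha)).trans (le_self_add (b := c))
      simpa using ⟨this, ht.le.trans le_add_self⟩
    · rintro q z z' - ⟨a, _, b, _, rfl, U, _, w, _, rfl, t, _, U', _, rfl, v, _, _, _, w', _, hw',
        rfl⟩ ⟨a₁, _, b₁, _, hq, U₁, _, w₁, _, rfl, t₁, _, U₁', _, rfl, v₁, _, _, _, w₁', _, hw₁', rfl⟩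
      obtain ⟨ha, hb⟩ := pair_inj.1 hq
      obtain ⟨rfl, rfl⟩ := pair_inj.1 hb
      obtain ⟨rfl, rfl⟩ := pair_inj.1 ha
      rw [word_unique hw' hw₁']
    · intro z
      constructor
      · rintro ⟨q, ⟨a, b, ha, ⟨t, U', ht, hU', rfl⟩, rfl⟩, ⟨a', _, b', _, hq, U, _, w, _, rfl, t₁, _,
          U₁, _, rfl, v, _, hv, hi, w', _, hw', rfl⟩⟩
        obtain ⟨rfl, hb⟩ := pair_inj.1 hq
        obtain ⟨rfl, rfl⟩ := pair_inj.1 hb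
        exact ⟨U, U', v, w, w', t, ha, hv, hi, hU', ht, hw', rfl⟩
      · rintro ⟨U, U', v, w, w', t, ha, hv, hi, hU', ht, hw', rfl⟩
        exact ⟨_, ⟨_, _, ha, ⟨t, U', ht, hU', rfl⟩, rfl⟩, _, le_pair_left _ _, _, le_pair_right _ _,
          rfl, U, le_pair_left _ _, w, le_pair_right _ _, rfl, t, le_pair_left _ _, U',
          le_pair_right _ _, rfl, v, ((hi.2 v).2 (Or.inr rfl)).le, hv, hi, w', le_pair_right _ _,
          hw', rfl⟩

theorem coded_tupleLevels (h : Scale N Y) {c : M} (hc : IsSetCode c) (hcN : Cut N c) (J : ℕ) :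
    ∀ n, Coded N (fun z => ∃ i, i ≤ n ∧ TupleLevel c (J : M) i z)
  | 0 => (coded_tupleLevel h hc hcN J 0).congr fun z => by simp
  | n + 1 => ((coded_tupleLevels h hc hcN J n).union h (coded_tupleLevel h hc hcN J (n + 1))).congr
      fun z => ⟨by
        rintro (⟨i, hi, h⟩ | h)
        exacts [⟨i, hi.trans n.le_succ, h⟩, ⟨_, le_rfl, h⟩], fun ⟨i, hi, h⟩ => by
        rcases hi.lt_or_eq with hi | rfl
        exacts [Or.inl ⟨i, Nat.lt_succ_iff.1 hi, h⟩, Or.inr h]⟩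

theorem exists_tupleTable (h : Scale N Y) {c : M} (hc : IsSetCode c) (hcN : Cut N c) (J : ℕ) :
    ∃ T, Cut N T ∧ IsTupleTable c (J : M) Y T := by
  obtain ⟨T, hT, hTs, hm⟩ := coded_tupleLevels h hc hcN J (J + 1)
  refine ⟨T, hT, hTs, fun z _ hz => ?_, fun U _ hU => (hm _).2 ⟨0, Nat.zero_le _, U, hU, rfl⟩, ?_⟩
  · obtain ⟨i, hi, hz⟩ := (hm z).1 hz
    cases i with
    | zero =>
      obtain ⟨U, hU, rfl⟩ := hz
      exact .nil hU
    | succ i =>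
      obtain ⟨U, U', v, w, w', t, h₁, h₂, h₃, _, h₄, h₅, rfl⟩ := hz
      exact .cons ((hm _).2 ⟨i, by omega, h₁⟩) h₂ h₃ h₄ h₅
  · intro U _ U' _ v _ w _ t _ w' _ hz hv hi hU' ht hw'
    obtain ⟨i, _, hz⟩ := (hm _).1 hz
    have hL : TupleLevel c (J : M) (i + 1) (pair U' w') :=
      ⟨U, U', v, w, w', t, hz, hv, hi, hU', ht, hw', rfl⟩
    -- The level equals the number of elements of U', which is at most J + 1; hence finitely many
    -- levels are closed under the rule.
    exact (hm _).2 ⟨i + 1, hL.ncard.2 ▸ hU'.finite.2, hL⟩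

theorem coded_binary (h : Scale N Y) {c : M} (hc : IsSetCode c) (hcN : Cut N c) (s : Symb) :
    Coded N (fun z => ∃ t, Mem t c ∧ ∃ u, Mem u c ∧ Word [sym s, t, u] z) := by
  have hcc : Coded N (fun t => Mem t c) := ⟨c, hcN, hc, fun _ => Iff.rfl⟩
  refine ((hcc.prod h hcc).image h (F := fun q z => ∃ t, t ≤ q ∧ ∃ u, u ≤ q ∧ q = pair t u ∧
    Word [sym s, t, u] z) (R := wordBound (sym s + c)) (fun _ _ _ => by beta_reduce; infer_instance)
    (h.wordBound (h.add (h.nat _) hcN)) ?_ ?_).congr ?_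
  · rintro q z ⟨t, u, ht, hu, rfl⟩ ⟨t', _, u', _, hq, hw⟩
    obtain ⟨rfl, rfl⟩ := pair_inj.1 hq
    refine ⟨hw.pos (sym_pos _), hw.le_wordBound ?_ (by simp)⟩
    simpa using ⟨ht.le.trans le_add_self, hu.le.trans le_add_self⟩
  · rintro q z z' - ⟨t, _, u, _, rfl, hw⟩ ⟨t', _, u', _, hq, hw'⟩
    obtain ⟨rfl, rfl⟩ := pair_inj.1 hq
    exact word_unique hw hw'
  · intro z
    constructor
    · rintro ⟨q, ⟨t, u, ht, hu, rfl⟩, ⟨t', _, u', _, hq, hw⟩⟩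
      obtain ⟨rfl, rfl⟩ := pair_inj.1 hq
      exact ⟨t, ht, u, hu, hw⟩
    · rintro ⟨t, ht, u, hu, hw⟩
      exact ⟨_, ⟨t, u, ht, hu, rfl⟩, t, le_pair_left _ _, u, le_pair_right _ _, rfl, hw⟩

theorem coded_unary (h : Scale N Y) {c : M} (hc : IsSetCode c) (hcN : Cut N c) (s : Symb) :
    Coded N (fun z => ∃ t, Mem t c ∧ Word [sym s, t] z) := by
  have hcc : Coded N (fun t => Mem t c) := ⟨c, hcN, hc, fun _ => Iff.rfl⟩
  refine hcc.image h (F := fun t z => Word [sym s, t] z) (R := wordBound (sym s + c))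
    (fun _ _ _ => by beta_reduce; infer_instance) (h.wordBound (h.add (h.nat _) hcN)) ?_
    fun t z z' _ => word_unique
  intro t z ht hw
  refine ⟨hw.pos (sym_pos _), hw.le_wordBound ?_ (by simp)⟩
  simpa using ht.le.trans le_add_self

theorem coded_constant (h : Scale N Y) (s : Symb) : Coded N (fun z => Word [sym s] z) := by
  obtain ⟨z, hz⟩ := exists_word [(sym s : M)]
  refine (Coded.singleton h (x := z) (hz.pos (sym_pos _)) (Scale.mono
    (h.wordBound (h.nat s.code)) (hz.le_wordBound ?_ (by simp)))).congr fun z' =>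
      ⟨by rintro rfl; exact hz, fun hz' => word_unique hz' hz⟩
  simp [sym, num_eq]

theorem coded_skolem (h : Scale N Y) {T : M} (hT : IsSetCode T) (hTN : Cut N T) (k : ℕ) (B : M) :
    Coded N (fun z => ∃ x, x ≤ (k : M) ∧ ∃ ψ, ψ ≤ (k : M) ∧ ∃ V, V ≤ B ∧ ∃ U, U ≤ B ∧ ∃ w, w ≤ T ∧
    (∃ d, d ≤ B ∧ IsDer FormationRule d ∧ Mem (varJ x) d) ∧
    (∃ d, d ≤ B ∧ IsDer FormationRule d ∧ Mem (formJ ψ V) d) ∧ IsEraseCode U V x ∧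
    Mem (pair U w) T ∧ Word [sym .sk, sym .ex, x, ψ, w] z) := by
  have hTT : Coded N (fun t => Mem t T) := ⟨T, hTN, hT, fun _ => Iff.rfl⟩
  obtain ⟨s, hs⟩ := exists_pair_bound (M := M) (k + 1)
  -- The shift to ψ + 1 makes the pair positive, as members of coded sets must be.
  have hI : Coded N (fun b => ∃ x, x ≤ b ∧ ∃ ψ, ψ ≤ b ∧ b = pair x (ψ + 1) ∧ x ≤ (k : M) ∧
      ψ ≤ (k : M)) := by
    refine Coded.standard h (fun _ _ => inferInstance) s ?_
    rintro _ ⟨x, _, ψ, _, rfl, hx, hψ⟩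
    refine ⟨pair_pos (by positivity), hs _ _ ?_ ?_⟩
    · push_cast; exact hx.trans le_self_add
    · push_cast; gcongr
  refine ((hTT.prod h hI).image h (F := fun q z => ∃ a, a ≤ q ∧ ∃ b, b ≤ q ∧ q = pair a b ∧
    ∃ U, U ≤ a ∧ ∃ w, w ≤ a ∧ a = pair U w ∧ ∃ x, x ≤ b ∧ ∃ ψ, ψ ≤ b ∧ b = pair x (ψ + 1) ∧
    U ≤ B ∧ (∃ V, V ≤ B ∧ (∃ d, d ≤ B ∧ IsDer FormationRule d ∧ Mem (varJ x) d) ∧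
    (∃ d, d ≤ B ∧ IsDer FormationRule d ∧ Mem (formJ ψ V) d) ∧ IsEraseCode U V x) ∧
    Word [sym .sk, sym .ex, x, ψ, w] z)
    (R := wordBound (T + (k + 31 : ℕ))) (fun _ _ _ => by beta_reduce; infer_instance)
    (h.wordBound (h.add hTN (h.nat _))) ?_ ?_).congr ?_
  · rintro q z ⟨a, b, ha, ⟨x, _, ψ, _, rfl, hx, hψ⟩, rfl⟩ ⟨a', _, b', _, hq, U, _, w, _, rfl, x', _,
      ψ', _, rfl, _, _, hw⟩
    obtain ⟨rfl, hb⟩ := pair_inj.1 hq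
    obtain ⟨rfl, hb'⟩ := pair_inj.1 hb
    rw [add_left_inj] at hb'
    subst hb'
    refine ⟨hw.pos (sym_pos _), hw.le_wordBound ?_ (by simp)⟩
    -- 31 is the largest code of a symbol, so k + 31 covers the symbols as well as x and ψ.
    have h1 : ∀ n : ℕ, n ≤ 31 → (n : M) ≤ T + (k + 31 : ℕ) := fun n hn =>
      le_trans (Nat.cast_le.2 (by omega)) le_add_self
    have h2 : (k : M) ≤ T + (k + 31 : ℕ) := le_trans (Nat.cast_le.2 (by omega)) le_add_self
    intro y hy
    simp only [List.mem_cons, List.not_mem_nil, or_false] at hy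
    rcases hy with rfl | rfl | rfl | rfl | rfl
    · exact h1 31 le_rfl
    · exact h1 30 (by norm_num)
    · exact hx.trans h2
    · exact hψ.trans h2
    · exact ((le_pair_right _ _).trans ha.le).trans le_self_add
  · rintro q z z' - ⟨a, _, b, _, rfl, U, _, w, _, rfl, x, _, ψ, _, rfl, _, _, hw⟩
      ⟨a', _, b', _, hq, U', _, w', _, rfl, x', _, ψ', _, rfl, _, _, hw'⟩
    obtain ⟨ha, hb⟩ := pair_inj.1 hq
    obtain ⟨rfl, rfl⟩ := pair_inj.1 ha
    obtain ⟨rfl, hb'⟩ := pair_inj.1 hb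
    rw [add_left_inj] at hb'
    subst hb'
    exact word_unique hw hw'
  · intro z
    constructor
    · rintro ⟨q, ⟨a, b, ha, ⟨x, _, ψ, _, rfl, hx, hψ⟩, rfl⟩, ⟨a', _, b', _, hq, U, _, w, _, rfl, x', _,
        ψ', _, rfl, hU, ⟨V, hV, h₁, h₂, h₃⟩, hw⟩⟩
      obtain ⟨rfl, hb⟩ := pair_inj.1 hq
      obtain ⟨rfl, hb'⟩ := pair_inj.1 hb
      rw [add_left_inj] at hb'
      subst hb'
      exact ⟨x, hx, ψ, hψ, V, hV, U, hU, w, (le_pair_right _ _).trans ha.le, h₁, h₂, h₃, ha, hw⟩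
    · rintro ⟨x, hx, ψ, hψ, V, hV, U, hU, w, _, h₁, h₂, h₃, ha, hw⟩
      have hψ' : ψ ≤ pair x (ψ + 1) := le_self_add.trans (le_pair_right _ _)
      exact ⟨_, ⟨_, _, ha, ⟨x, le_pair_left _ _, ψ, hψ', rfl, hx, hψ⟩, rfl⟩, _, le_pair_left _ _, _,
        le_pair_right _ _, rfl, U, le_pair_left _ _, w, le_pair_right _ _, rfl, x, le_pair_left _ _,
        ψ, hψ', rfl, hU, ⟨V, hV, h₁, h₂, h₃⟩, hw⟩

theorem exists_nextStage (h : Scale N Y) {c : M} (hc : IsSetCode c) (hcN : Cut N c) (J k : ℕ) :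
    ∃ c', Cut N c' ∧ IsNextStage (J : M) Y (k : M) c c' := by
  obtain ⟨T, hT, hTt⟩ := exists_tupleTable h hc hcN J
  have hcc : Coded N (fun t => Mem t c) := ⟨c, hcN, hc, fun _ => Iff.rfl⟩
  obtain ⟨c', hc', hs, hm⟩ := hcc.union h ((coded_constant h .zero).union h
    ((coded_unary h hc hcN .succ).union h ((coded_binary h hc hcN .add).union h
      ((coded_binary h hc hcN .mul).union h (coded_skolem h hTt.1 hT k Y)))))
  exact ⟨c', hc', hc, hs, T, h.le hT, hTt, fun y _ => hm y⟩

/-- J fixes the range of the tuple tables while i runs up to it. Each external step enlarges the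
derivation by one pair, so after standardly many steps everything is still in the cut and below Y.
-/
theorem exists_stages (h : Scale N Y) {l : M} (hl : IsSetCode l) (hlN : Cut N l) (J : ℕ) :
    ∀ i ≤ J, ∃ d c : M, Cut N d ∧ Cut N c ∧ IsSetCode d ∧ IsSetCode c ∧ Mem (pair (i : M) c) d ∧
      ∀ y, Mem y d → y = pair 0 l ∨ ∃ k, k ≤ (J : M) ∧ ∃ c, c ≤ Y ∧ ∃ c', c' ≤ Y ∧
        Mem (pair k c) d ∧ y = pair (k + 1) c' ∧ IsNextStage (J : M) Y k c c'
  | 0, _ => by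
    obtain ⟨d, hd, hs, hm⟩ := Coded.singleton h (x := pair 0 l) (pair_pos hl.pos)
      (h.pair (by simpa using h.nat 0) hlN)
    exact ⟨d, l, hd, hlN, hs, hl, by simp [hm], fun y hy => Or.inl ((hm y).1 hy)⟩
  | i + 1, hi => by
    obtain ⟨d, c, hd, hc, hds, hcs, hm, hr⟩ := exists_stages h hl hlN J i (by omega)
    obtain ⟨c', hc', hn⟩ := exists_nextStage h hcs hc J i
    have hdd : Coded N (fun t => Mem t d) := ⟨d, hd, hds, fun _ => Iff.rfl⟩
    obtain ⟨d', hd', hds', hm'⟩ := hdd.union h (Coded.singleton h (x := pair ((i : M) + 1) c')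
      (pair_pos hn.2.1.pos) (h.pair (h.add (h.nat i) h.one) hc'))
    refine ⟨d', c', hd', hc', hds', hn.2.1, (hm' _).2 (Or.inr (by simp)), fun y hy => ?_⟩
    rcases (hm' y).1 hy with hy | rfl
    · rcases hr y hy with h | ⟨k, hk, c, hc, c', hc', hm, h⟩
      · exact Or.inl h
      · exact Or.inr ⟨k, hk, c, hc, c', hc', (hm' _).2 (Or.inl hm), h⟩
    · exact Or.inr ⟨i, Nat.cast_le.2 (by omega), c, h.le hc, c', h.le hc', (hm' _).2 (Or.inl hm),
        rfl, hn⟩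

theorem hasStages_natCast (h : Scale N Y) {l : M} (hl : IsSetCode l) (hlN : Cut N l) (J : ℕ) :
    HasStages l Y (J : M) := by
  obtain ⟨d, c, hd, hc, hds, -, hm, hr⟩ := exists_stages h hl hlN J J le_rfl
  exact ⟨room_natCast h.nat_lt J, d, h.le hd, hds, ⟨c, h.le hc, hm⟩, fun y _ => hr y⟩

theorem exists_nonStandard_isStageCode {l : M} (hl : IsSetCode l) (hns : NonStandard l)
    (hω : ∃ y : M, Omega 2 l y) : ∃ j c : M, NonStandard j ∧ IsStageCode l j c := by
  obtain ⟨Y, hY⟩ := hω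
  obtain ⟨N, h, hlN⟩ := exists_scale hns hY
  obtain ⟨j, hj, hs⟩ := (d0_hasStages l Y).overspill hns (hasStages_natCast h hl hlN)
  obtain ⟨c, hc⟩ := hs.exists_isStageCode fun s => (h.nat_lt s.code).le
  exact ⟨j, c, hj, hc⟩

end StandardStages

end BA

theorem theorem3p3 {M : Type*} [BA.ArithStructure M] (hM : BA.IsModelIDelta0 M)
    (l : M) (hl : BA.IsTermSetCode l) (hns : BA.NonStandard l)
    (hω : ∃ y : M, BA.Omega 2 l y) :
    ∃ j c : M, BA.NonStandard j ∧ BA.IsStageCode l j c := by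
  let _ : BA.Model M := { ‹BA.ArithStructure M› with isModel := hM }
  exact BA.exists_nonStandard_isStageCode hl.1 hns hω
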